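/- **Theorem (Connes' trace theorem for noncommutative tori).** Let $n\ge 2$ and let $\theta=(\theta_{jk})$ be a real antisymmetric $n\times n$ matrix with columns $\theta_1,\dots,\theta_n$. Let $\mathbb T^n=\mathbb R^n/2\pi\mathbb Z^n$ and let $L^2(\mathbb T^n)$ carry the inner product $\langle f,g\rangle=(2\pi)^{-n}\int f\bar g\,dx$. Let $A_\theta$ be the $C^*$-algebra generated by the unitaries $(U_jf)(x)=e^{ix_j}f(x+\pi\theta_j)$ of $L^2(\mathbb T^n)$, and put $U^k=U_1^{k_1}\cdots U_n^{k_n}$ for $k\in\mathbb Z^n$, $\tau(u)=\langle u1,1\rangle$, and $\alpha_s(u)=V_suV_s^{-1}$ for $s\in\mathbb R^n$, where $(V_sf)(x)=f(x+s)$. Let $\mathscr H_\theta$ be the Hilbert space completion of $A_\theta$ for $\langle u,v\rangle=\tau(uv^*)$. Let $\mathscr A_\theta$ be the algebra of all $u\in A_\theta$ such that $s\mapsto\alpha_s(u)$ is a $C^\infty$ map from $\mathbb R^n$ to $A_\theta$, with the topology of the semi-norms $u\mapsto\|\delta^\alpha u\|$, where $\delta^\alpha u=(-i)^{|\alpha|}\partial_s^\alpha\alpha_s(u)|_{s=0}$.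 For $q\in\mathbb C$, a classical symbol of order $q$ is a $C^\infty$ map $\rho:\mathbb R^n\to\mathscr A_\theta$ for which there are $C^\infty$ maps $\rho_{q-j}:\mathbb R^n\setminus 0\to\mathscr A_\theta$, $j\ge 0$, with $\rho_{q-j}(t\xi)=t^{q-j}\rho_{q-j}(\xi)$ for $t>0$, such that for all $N\ge 0$ and all multi-orders $\alpha,\beta$ there is a constant $C$ with $$\Big\|\delta^\alpha\partial_\xi^\beta\Big(\rho-\sum_{j<N}\rho_{q-j}\Big)(\xi)\Big\|\le C|\xi|^{\Re q-N-|\beta|}\qquad\text{for all }|\xi|\ge 1.$$ Let $\Psi^q(\mathbb T^n_\theta)$ be the set of all linear operators $P:\mathscr A_\theta\to\mathscr A_\theta$ for which there is a classical symbol $\rho$ of order $q$ with $Pu=\sum_{k\in\mathbb Z^n}u_k\,\rho(k)U^k$, $u_k=\tau(u(U^k)^*)$, for all $u\in\mathscr A_\theta$. For $P\in\Psi^q(\mathbb T^n_\theta)$ with $q\in\mathbb Z$, the noncommutative residue is $$\operatorname{Res}(P)=\int_{\mathbb S^{n-1}}\tau[\rho_{-n}(\xi)]\,d^{n-1}\xi,$$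 where $\rho_{-n}$ is the homogeneous component of degree $-n$ of a classical symbol of $P$ (it depends only on $P$, and $\rho_{-n}=0$ if $q<-n$). Let $\mathscr L^{1,\infty}$ be the space of compact operators $T$ on $\mathscr H_\theta$ with $\mu_k(T)=O(k^{-1})$, where $\mu_k(T)=\inf\{\|T|_{E^\perp}\|:\dim E=k\}$. A normalized positive trace on $\mathscr L^{1,\infty}$ is a linear form $\varphi:\mathscr L^{1,\infty}\to\mathbb C$ that vanishes on all commutators $[A,T]$ with $A$ a bounded operator on $\mathscr H_\theta$ and $T\in\mathscr L^{1,\infty}$, is non-negative on positive operators, and satisfies $\varphi(T_0)=1$ for an operator $T_0$ with $T_0\xi_k=(k+1)^{-1}\xi_k$, $k\ge0$, for some orthonormal basis $(\xi_k)_{k\ge 0}$ of $\mathscr H_\theta$ (the choice of $T_0$ does not matter). An operator $T\in\mathscr L^{1,\infty}$ is strongly measurable if all normalized positive traces take the same value at $T$; this value is denoted by $-\!\!\!\!\!\int T$. Then every $P\in\Psi^{-n}(\mathbb T^n_\theta)$ extends uniquely to a bounded operator on $\mathscr H_\theta$. This extension, again denoted by $P$, belongs to $\mathscr L^{1,\infty}$,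 it is strongly measurable, and $$-\!\!\!\!\!\int P=\frac1n\operatorname{Res}(P),$$ that is, $\varphi(P)=\frac1n\operatorname{Res}(P)$ for every normalized positive trace $\varphi$ on $\mathscr L^{1,\infty}$. -/

import Mathlib

open MeasureTheory

noncomputable section

namespace NCTorus

instance fact_two_pi_pos : Fact (0 < 2 * Real.pi) := ⟨Real.two_pi_pos⟩

/-- The ordinary torus `𝕋ⁿ = ℝⁿ / 2πℤⁿ`. -/
abbrev Torus (n : ℕ) : Type := Fin n → AddCircle (2 * Real.pi)

/-- The normalized Haar measure `(2π)⁻ⁿ dx` on `𝕋ⁿ`. -/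
abbrev torusMeasure (n : ℕ) : Measure (Torus n) :=
  Measure.pi fun _ => AddCircle.haarAddCircle

/-- `L²(𝕋ⁿ)` with the inner product `(2π)⁻ⁿ ∫ ξ η̄ dx`. -/
abbrev L2Torus (n : ℕ) : Type := Lp ℂ 2 (torusMeasure n)

/-- The bounded operators on `L²(𝕋ⁿ)`. -/
abbrev BL2 (n : ℕ) : Type := L2Torus n →L[ℂ] L2Torus n

/-- The class in `𝕋ⁿ` of a point of `ℝⁿ`. -/
def torusPt {n : ℕ} (s : Fin n → ℝ) : Torus n := fun j => (s j : AddCircle (2 * Real.pi))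

theorem memLp_circle_mul {n : ℕ} (w : C(Torus n, Circle)) (f : L2Torus n) :
    MemLp (fun x => (w x : ℂ) * f x) 2 (torusMeasure n) := by
  refine (Lp.memLp f).of_le ?_ ?_
  · exact (Continuous.aestronglyMeasurable (by fun_prop)).mul (Lp.aestronglyMeasurable f)
  · exact Filter.Eventually.of_forall fun x => by simp [Circle.norm_coe]

/-- Multiplication by a continuous function with values in the unit circle. -/
def mulCircleₗᵢ {n : ℕ} (w : C(Torus n, Circle)) : L2Torus n →ₗᵢ[ℂ] L2Torus n where
  toFun f := (memLp_circle_mul w f).toLp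
  map_add' f g := by
    rw [← MemLp.toLp_add]
    refine MemLp.toLp_congr _ _ ?_
    filter_upwards [Lp.coeFn_add f g] with x hx
    rw [hx, Pi.add_apply, mul_add]; rfl
  map_smul' c f := by
    rw [RingHom.id_apply, ← MemLp.toLp_const_smul]
    refine MemLp.toLp_congr _ _ ?_
    filter_upwards [Lp.coeFn_smul c f] with x hx
    simp [hx, mul_left_comm]
  norm_map' f := by
    change ‖(memLp_circle_mul w f).toLp‖ = ‖f‖
    rw [Lp.norm_toLp, Lp.norm_def]
    congr 1
    exact eLpNorm_congr_norm_ae (Filter.Eventually.of_forall fun x => by simp [Circle.norm_coe])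

/-- Translation `f ↦ f(· + a)`. -/
def translateₗᵢ {n : ℕ} (a : Torus n) : L2Torus n →ₗᵢ[ℂ] L2Torus n :=
  Lp.compMeasurePreservingₗᵢ ℂ (fun x => x + a) (measurePreserving_add_right (torusMeasure n) a)

theorem coeFn_mulCircle {n : ℕ} (w : C(Torus n, Circle)) (f : L2Torus n) :
    (mulCircleₗᵢ w f : Torus n → ℂ) =ᵐ[torusMeasure n] fun x => (w x : ℂ) * f x :=
  MemLp.coeFn_toLp (memLp_circle_mul w f)

theorem coeFn_translate {n : ℕ} (a : Torus n) (f : L2Torus n) :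
    (translateₗᵢ a f : Torus n → ℂ) =ᵐ[torusMeasure n] fun x => f (x + a) :=
  Lp.coeFn_compMeasurePreserving f (measurePreserving_add_right (torusMeasure n) a)

theorem ae_translate {n : ℕ} (a : Torus n) {p : Torus n → Prop}
    (h : ∀ᵐ x ∂torusMeasure n, p x) : ∀ᵐ x ∂torusMeasure n, p (x + a) :=
  (measurePreserving_add_right (torusMeasure n) a).quasiMeasurePreserving.ae h

theorem mulCircle_mulCircle {n : ℕ} (w w' : C(Torus n, Circle)) (f : L2Torus n) :
    mulCircleₗᵢ w (mulCircleₗᵢ w' f) = mulCircleₗᵢ (w * w') f := by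
  apply Lp.ext
  filter_upwards [coeFn_mulCircle w (mulCircleₗᵢ w' f), coeFn_mulCircle w' f,
    coeFn_mulCircle (w * w') f] with x h1 h2 h3
  rw [h1, h2, h3]
  simp [mul_assoc]

theorem mulCircle_one {n : ℕ} (f : L2Torus n) : mulCircleₗᵢ (1 : C(Torus n, Circle)) f = f := by
  apply Lp.ext
  filter_upwards [coeFn_mulCircle 1 f] with x h
  simp [h]

theorem translate_translate {n : ℕ} (a b : Torus n) (f : L2Torus n) :
    translateₗᵢ a (translateₗᵢ b f) = translateₗᵢ (a + b) f := by
  apply Lp.ext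
  filter_upwards [coeFn_translate a (translateₗᵢ b f), ae_translate a (coeFn_translate b f),
    coeFn_translate (a + b) f] with x h1 h2 h3
  rw [h1, h2, h3, add_assoc]

theorem translate_zero {n : ℕ} (f : L2Torus n) : translateₗᵢ (0 : Torus n) f = f := by
  apply Lp.ext
  filter_upwards [coeFn_translate 0 f] with x h
  simp [h]

theorem translate_mulCircle {n : ℕ} (a : Torus n) (w : C(Torus n, Circle)) (f : L2Torus n) :
    translateₗᵢ a (mulCircleₗᵢ w f) =
      mulCircleₗᵢ (w.comp ⟨fun x => x + a, by fun_prop⟩) (translateₗᵢ a f) := by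
  apply Lp.ext
  filter_upwards [coeFn_translate a (mulCircleₗᵢ w f), ae_translate a (coeFn_mulCircle w f),
    coeFn_mulCircle (w.comp ⟨fun x => x + a, by fun_prop⟩) (translateₗᵢ a f),
    coeFn_translate a f] with x h1 h2 h3 h4
  rw [h1, h2, h3, h4]
  simp

/-- Multiplication by a continuous circle-valued function, as a unitary. -/
def mulCircle {n : ℕ} (w : C(Torus n, Circle)) : L2Torus n ≃ₗᵢ[ℂ] L2Torus n :=
  { mulCircleₗᵢ w with
    invFun := mulCircleₗᵢ w⁻¹
    left_inv := fun f => by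
      change mulCircleₗᵢ w⁻¹ (mulCircleₗᵢ w f) = f
      rw [mulCircle_mulCircle, inv_mul_cancel, mulCircle_one]
    right_inv := fun f => by
      change mulCircleₗᵢ w (mulCircleₗᵢ w⁻¹ f) = f
      rw [mulCircle_mulCircle, mul_inv_cancel, mulCircle_one] }

/-- Translation `f ↦ f(· + a)`, as a unitary. -/
def translate {n : ℕ} (a : Torus n) : L2Torus n ≃ₗᵢ[ℂ] L2Torus n :=
  { translateₗᵢ a with
    invFun := translateₗᵢ (-a)
    left_inv := fun f => by
      change translateₗᵢ (-a) (translateₗᵢ a f) = f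
      rw [translate_translate, neg_add_cancel, translate_zero]
    right_inv := fun f => by
      change translateₗᵢ a (translateₗᵢ (-a) f) = f
      rw [translate_translate, add_neg_cancel, translate_zero] }

/-- The function `x ↦ e^{i x_j}` on `𝕋ⁿ`. -/
def coordChar {n : ℕ} (j : Fin n) : C(Torus n, Circle) :=
  ⟨fun x => AddCircle.toCircle (x j), AddCircle.continuous_toCircle.comp (continuous_apply j)⟩

/-- The unitary `(U_j f)(x) = e^{i x_j} f(x + π θ_j)` of `L²(𝕋ⁿ)`, with `θ_j` the `j`-th
column of `θ`. -/
def genU {n : ℕ} (θ : Matrix (Fin n) (Fin n) ℝ) (j : Fin n) : unitary (BL2 n) :=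
  Unitary.linearIsometryEquiv.symm
    ((translate (torusPt fun l => Real.pi * θ l j)).trans (mulCircle (coordChar j)))

/-- The translation unitary `(V_s f)(x) = f(x + s)`. -/
def transV {n : ℕ} (s : EuclideanSpace ℝ (Fin n)) : unitary (BL2 n) :=
  Unitary.linearIsometryEquiv.symm (translate (torusPt s))

theorem genU_apply {n : ℕ} (θ : Matrix (Fin n) (Fin n) ℝ) (j : Fin n) (f : L2Torus n) :
    (genU θ j : BL2 n) f =
      mulCircleₗᵢ (coordChar j) (translateₗᵢ (torusPt fun l => Real.pi * θ l j) f) := rfl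

theorem transV_apply {n : ℕ} (s : EuclideanSpace ℝ (Fin n)) (f : L2Torus n) :
    (transV s : BL2 n) f = translateₗᵢ (torusPt s) f := rfl

/-- The noncommutative torus `A_θ`: the C⋆-algebra generated by `U_1, …, U_n`. -/
def ncTorus {n : ℕ} (θ : Matrix (Fin n) (Fin n) ℝ) : StarSubalgebra ℂ (BL2 n) :=
  (StarAlgebra.adjoin ℂ (Set.range fun j => (genU θ j : BL2 n))).topologicalClosure

theorem genU_mem {n : ℕ} (θ : Matrix (Fin n) (Fin n) ℝ) (j : Fin n) :
    (genU θ j : BL2 n) ∈ ncTorus θ :=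
  StarSubalgebra.le_topologicalClosure _ (StarAlgebra.subset_adjoin ℂ _ ⟨j, rfl⟩)

theorem transV_mul_genU {n : ℕ} (θ : Matrix (Fin n) (Fin n) ℝ)
    (s : EuclideanSpace ℝ (Fin n)) (j : Fin n) :
    (transV s : BL2 n) * (genU θ j : BL2 n) =
      Complex.exp (Complex.I * s j) • ((genU θ j : BL2 n) * (transV s : BL2 n)) := by
  ext1 f
  change (transV s : BL2 n) ((genU θ j : BL2 n) f) =
    Complex.exp (Complex.I * s j) • (genU θ j : BL2 n) ((transV s : BL2 n) f)
  rw [transV_apply, genU_apply, genU_apply, transV_apply, translate_mulCircle,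
    translate_translate, translate_translate, add_comm (torusPt s)]
  apply Lp.ext
  refine (coeFn_mulCircle _ _).trans ?_
  refine Filter.EventuallyEq.trans ?_ (Lp.coeFn_smul _ _).symm
  filter_upwards [coeFn_mulCircle (coordChar j)
    (translateₗᵢ ((torusPt fun l => Real.pi * θ l j) + torusPt s) f)] with x hx
  rw [Pi.smul_apply, hx, smul_eq_mul, ← mul_assoc]
  congr 1
  simp only [coordChar, torusPt, ContinuousMap.comp_apply, ContinuousMap.coe_mk, Pi.add_apply,
    AddCircle.toCircle_add, Circle.coe_mul, AddCircle.toCircle_apply_mk, Circle.coe_exp]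
  rw [mul_comm, div_self (by positivity)]
  congr 2
  push_cast
  ring

/-- Conjugation by `V_s` preserves the noncommutative torus. -/
theorem conj_mem {n : ℕ} (θ : Matrix (Fin n) (Fin n) ℝ) (s : EuclideanSpace ℝ (Fin n))
    {u : BL2 n} (hu : u ∈ ncTorus θ) :
    Unitary.conjStarAlgAut ℂ (BL2 n) (transV s) u ∈ ncTorus θ := by
  set Φ := Unitary.conjStarAlgAut ℂ (BL2 n) (transV s)
  have hcont : Continuous Φ := by
    change Continuous fun x : BL2 n => (transV s : BL2 n) * x * (star (transV s : BL2 n))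
    fun_prop
  have hle : ncTorus θ ≤ (ncTorus θ).comap (Φ : BL2 n →⋆ₐ[ℂ] BL2 n) := by
    refine StarSubalgebra.topologicalClosure_minimal ?_ ?_
    · rw [StarAlgebra.adjoin_le_iff]
      rintro _ ⟨j, rfl⟩
      change (transV s : BL2 n) * (genU θ j : BL2 n) * star (transV s : BL2 n) ∈ ncTorus θ
      rw [transV_mul_genU, smul_mul_assoc, mul_assoc, Unitary.mul_star_self_of_mem (transV s).2, mul_one]
      exact SMulMemClass.smul_mem _ (genU_mem θ j)
    · exact (StarSubalgebra.isClosed_topologicalClosure _).preimage hcont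
  exact hle hu

/-- The action `α_s(u) = V_s u V_s⁻¹` of `ℝⁿ` on `A_θ`, so that `α_s(U_j) = e^{i s_j} U_j`. -/
def torusAction {n : ℕ} (θ : Matrix (Fin n) (Fin n) ℝ) (s : EuclideanSpace ℝ (Fin n))
    (u : ncTorus θ) : ncTorus θ :=
  ⟨Unitary.conjStarAlgAut ℂ (BL2 n) (transV s) u, conj_mem θ s u.2⟩

/-- `U_j` as a unitary element of `A_θ`. -/
def ncU {n : ℕ} (θ : Matrix (Fin n) (Fin n) ℝ) (j : Fin n) : unitary (ncTorus θ) :=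
  ⟨⟨genU θ j, genU_mem θ j⟩, by
    rw [Unitary.mem_iff]
    exact ⟨Subtype.ext (Unitary.coe_star_mul_self (genU θ j)),
      Subtype.ext (Unitary.coe_mul_star_self (genU θ j))⟩⟩

/-- The ordered monomials `U^k = U_1^{k_1} ⋯ U_n^{k_n}`, `k ∈ ℤⁿ`. -/
def ncMonomial {n : ℕ} (θ : Matrix (Fin n) (Fin n) ℝ) (k : Fin n → ℤ) : unitary (ncTorus θ) :=
  (List.ofFn fun j => ncU θ j ^ k j).prod

/-- The trace `τ(u) = ⟨u 1, 1⟩` (Mathlib's inner product is linear in its second argument). -/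
def ncTrace {n : ℕ} (θ : Matrix (Fin n) (Fin n) ℝ) (u : ncTorus θ) : ℂ :=
  inner ℂ (Lp.const 2 (torusMeasure n) (1 : ℂ))
    ((u : BL2 n) (Lp.const 2 (torusMeasure n) (1 : ℂ)))

/-- The algebra `A_θ` viewed as a space with the semi-inner product `⟨u, v⟩ = τ(u v⋆)`. -/
def PreHilbert {n : ℕ} (θ : Matrix (Fin n) (Fin n) ℝ) : Type := ncTorus θ

instance {n : ℕ} (θ : Matrix (Fin n) (Fin n) ℝ) : AddCommGroup (PreHilbert θ) :=
  inferInstanceAs (AddCommGroup (ncTorus θ))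

instance {n : ℕ} (θ : Matrix (Fin n) (Fin n) ℝ) : Module ℂ (PreHilbert θ) :=
  inferInstanceAs (Module ℂ (ncTorus θ))

/-- The identity map from `A_θ` to `PreHilbert θ`. -/
def toPreHilbert {n : ℕ} (θ : Matrix (Fin n) (Fin n) ℝ) : ncTorus θ ≃ₗ[ℂ] PreHilbert θ :=
  LinearEquiv.refl ℂ _

/-- The form `⟨u, v⟩ = τ(u v⋆)`, linear in `u`; as Mathlib's inner products are linear in the
second argument, `inner u v` stands for `⟨v, u⟩ = τ(v u⋆)`. -/
abbrev preHilbertCore {n : ℕ} (θ : Matrix (Fin n) (Fin n) ℝ) :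
    PreInnerProductSpace.Core ℂ (PreHilbert θ) where
  inner u v := ncTrace θ ((toPreHilbert θ).symm v * star ((toPreHilbert θ).symm u))
  conj_inner_symm u v := by
    simp only [ncTrace]
    rw [inner_conj_symm]
    change inner ℂ (((toPreHilbert θ).symm u : BL2 n) (star ((toPreHilbert θ).symm v : BL2 n) _)) _ =
      inner ℂ _ (((toPreHilbert θ).symm v : BL2 n) (star ((toPreHilbert θ).symm u : BL2 n) _))
    rw [ContinuousLinearMap.star_eq_adjoint, ContinuousLinearMap.star_eq_adjoint,
      ← ContinuousLinearMap.adjoint_inner_right, ContinuousLinearMap.adjoint_inner_left]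
  re_inner_nonneg u := by
    simp only [ncTrace]
    change 0 ≤ RCLike.re (inner ℂ _ (((toPreHilbert θ).symm u : BL2 n)
      (star ((toPreHilbert θ).symm u : BL2 n) _)))
    rw [ContinuousLinearMap.star_eq_adjoint, ← ContinuousLinearMap.adjoint_inner_left]
    exact inner_self_nonneg
  add_left u v w := by
    simp only [ncTrace, map_add, star_add, mul_add]
    change inner ℂ _ ((_ + _ : BL2 n) _) = _
    rw [add_apply, inner_add_right]
  smul_left u v c := by
    simp only [ncTrace, map_smul, star_smul, mul_smul_comm]
    change inner ℂ _ ((_ • _ : BL2 n) _) = _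
    rw [smul_apply, inner_smul_right]
    rfl

instance {n : ℕ} (θ : Matrix (Fin n) (Fin n) ℝ) : SeminormedAddCommGroup (PreHilbert θ) :=
  InnerProductSpace.Core.toSeminormedAddCommGroup (c := preHilbertCore θ)

instance {n : ℕ} (θ : Matrix (Fin n) (Fin n) ℝ) : InnerProductSpace ℂ (PreHilbert θ) :=
  InnerProductSpace.ofCore (preHilbertCore θ)

/-- The Hilbert space `L²(𝕋ⁿ_θ)`: the completion of `A_θ` for `⟨u, v⟩ = τ(u v⋆)`. -/
abbrev L2NCTorus {n : ℕ} (θ : Matrix (Fin n) (Fin n) ℝ) : Type :=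
  UniformSpace.Completion (PreHilbert θ)

/-- The canonical linear map `A_θ → L²(𝕋ⁿ_θ)`. -/
def toL2 {n : ℕ} (θ : Matrix (Fin n) (Fin n) ℝ) (u : ncTorus θ) : L2NCTorus θ :=
  ((toPreHilbert θ u : PreHilbert θ) : L2NCTorus θ)

/-- The smooth noncommutative torus: those `u ∈ A_θ` for which `s ↦ α_s(u)` is a `C^∞` map from
`ℝⁿ` to `A_θ`. -/
def smoothTorus {n : ℕ} (θ : Matrix (Fin n) (Fin n) ℝ) : Subalgebra ℂ (ncTorus θ) where
  carrier := {u | ContDiff ℝ (⊤ : ℕ∞) fun s => torusAction θ s u}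
  mul_mem' {u v} hu hv := by
    have h : (fun s => torusAction θ s (u * v)) =
        fun s => torusAction θ s u * torusAction θ s v :=
      funext fun s => Subtype.ext (map_mul (Unitary.conjStarAlgAut ℂ (BL2 n) (transV s)) _ _)
    rw [Set.mem_ofPred_eq] at hu hv ⊢
    rw [h]
    exact hu.mul hv
  add_mem' {u v} hu hv := by
    have h : (fun s => torusAction θ s (u + v)) =
        fun s => torusAction θ s u + torusAction θ s v :=
      funext fun s => Subtype.ext (map_add (Unitary.conjStarAlgAut ℂ (BL2 n) (transV s)) _ _)
    rw [Set.mem_ofPred_eq] at hu hv ⊢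
    rw [h]
    exact hu.add hv
  algebraMap_mem' c := by
    have h : (fun s => torusAction θ s (algebraMap ℂ (ncTorus θ) c)) =
        fun _ => algebraMap ℂ (ncTorus θ) c :=
      funext fun s => Subtype.ext
        (AlgHomClass.commutes (Unitary.conjStarAlgAut ℂ (BL2 n) (transV s)) c)
    rw [Set.mem_ofPred_eq, h]
    exact contDiff_const

section WeakTraceClass

variable {H : Type*} [NormedAddCommGroup H] [InnerProductSpace ℂ H]

/-- The set of the norms `‖T|_{E^⊥}‖`, `dim E ≤ k`. -/
def tailNorms (T : H →L[ℂ] H) (k : ℕ) : Set ℝ :=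
  {c | ∃ E : Submodule ℂ H, FiniteDimensional ℂ E ∧ Module.finrank ℂ E ≤ k ∧
    c = ‖T ∘L Eᗮ.subtypeL‖}

/-- The characteristic values `μ_k(T) = inf {‖T|_{E^⊥}‖ ; dim E = k}`. As `‖T|_{E^⊥}‖` decreases
when `E` grows, `dim E ≤ k` gives the same infimum (in a space of dimension at least `k`). -/
def charValue (T : H →L[ℂ] H) (k : ℕ) : ℝ := sInf (tailNorms T k)

theorem tailNorms_bddBelow (T : H →L[ℂ] H) (k : ℕ) : BddBelow (tailNorms T k) :=
  ⟨0, by rintro _ ⟨E, -, -, rfl⟩; exact ContinuousLinearMap.opNorm_nonneg _⟩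

theorem tailNorms_nonempty (T : H →L[ℂ] H) (k : ℕ) : (tailNorms T k).Nonempty :=
  ⟨_, ⊥, inferInstance, by simp, rfl⟩

theorem charValue_nonneg (T : H →L[ℂ] H) (k : ℕ) : 0 ≤ charValue T k :=
  Real.sInf_nonneg (by rintro _ ⟨E, -, -, rfl⟩; exact ContinuousLinearMap.opNorm_nonneg _)

theorem norm_tail_le_iff (T : H →L[ℂ] H) (E : Submodule ℂ H) {c : ℝ} (hc : 0 ≤ c) :
    ‖T ∘L Eᗮ.subtypeL‖ ≤ c ↔ ∀ x ∈ Eᗮ, ‖T x‖ ≤ c * ‖x‖ :=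
  ⟨fun h x hx => ((T ∘L Eᗮ.subtypeL).le_of_opNorm_le h ⟨x, hx⟩),
    fun h => ContinuousLinearMap.opNorm_le_bound _ hc fun x => h x x.2⟩

theorem charValue_le (T : H →L[ℂ] H) {k : ℕ} (E : Submodule ℂ H) [FiniteDimensional ℂ E]
    (hE : Module.finrank ℂ E ≤ k) {c : ℝ} (hc : 0 ≤ c) (h : ∀ x ∈ Eᗮ, ‖T x‖ ≤ c * ‖x‖) :
    charValue T k ≤ c :=
  (csInf_le (tailNorms_bddBelow T k) ⟨E, inferInstance, hE, rfl⟩).trans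
    ((norm_tail_le_iff T E hc).2 h)

theorem exists_of_charValue_lt (T : H →L[ℂ] H) {k : ℕ} {c : ℝ} (h : charValue T k < c) :
    ∃ E : Submodule ℂ H, FiniteDimensional ℂ E ∧ Module.finrank ℂ E ≤ k ∧
      ∀ x ∈ Eᗮ, ‖T x‖ ≤ c * ‖x‖ := by
  obtain ⟨_, ⟨E, hE, hk, rfl⟩, hlt⟩ := exists_lt_of_csInf_lt (tailNorms_nonempty T k) h
  exact ⟨E, hE, hk, (norm_tail_le_iff T E ((ContinuousLinearMap.opNorm_nonneg _).trans hlt.le)).1 hlt.le⟩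

theorem charValue_add_le (S T : H →L[ℂ] H) {k l m : ℕ} (hm : k + l ≤ m) :
    charValue (S + T) m ≤ charValue S k + charValue T l := by
  refine le_of_forall_pos_le_add fun ε hε => ?_
  obtain ⟨E, hE, hEk, hES⟩ := exists_of_charValue_lt S
    (show charValue S k < charValue S k + ε / 2 by linarith)
  obtain ⟨F, hF, hFl, hFT⟩ := exists_of_charValue_lt T
    (show charValue T l < charValue T l + ε / 2 by linarith)
  have h0 := charValue_nonneg S k
  have h1 := charValue_nonneg T l
  refine charValue_le _ (E ⊔ F) ?_ (by positivity) fun x hx => ?_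
  · exact (Submodule.finrank_add_le_finrank_add_finrank E F).trans
      ((add_le_add hEk hFl).trans hm)
  · have hxE := hES x (Submodule.orthogonal_le le_sup_left hx)
    have hxF := hFT x (Submodule.orthogonal_le le_sup_right hx)
    calc ‖(S + T) x‖ ≤ ‖S x‖ + ‖T x‖ := norm_add_le _ _
      _ ≤ _ := by nlinarith

theorem charValue_mul_left_le (A T : H →L[ℂ] H) (k : ℕ) :
    charValue (A * T) k ≤ ‖A‖ * charValue T k := by
  refine le_of_forall_pos_le_add fun ε hε => ?_
  obtain ⟨E, hE, hEk, h⟩ := exists_of_charValue_lt T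
    (show charValue T k < charValue T k + ε / (‖A‖ + 1) by
      have : 0 < ε / (‖A‖ + 1) := by positivity
      linarith)
  have h0 := charValue_nonneg T k
  have hA := norm_nonneg A
  have hε' : ‖A‖ * (ε / (‖A‖ + 1)) ≤ ε := by
    rw [← mul_div_assoc, div_le_iff₀ (by positivity)]
    nlinarith
  refine charValue_le _ E hEk (by positivity) fun x hx => ?_
  calc ‖(A * T) x‖ ≤ ‖A‖ * ‖T x‖ := A.le_opNorm _
    _ ≤ ‖A‖ * ((charValue T k + ε / (‖A‖ + 1)) * ‖x‖) := by gcongr; exact h x hx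
    _ = (‖A‖ * charValue T k + ‖A‖ * (ε / (‖A‖ + 1))) * ‖x‖ := by ring
    _ ≤ _ := by gcongr

variable [CompleteSpace H]

theorem charValue_mul_right_le (A T : H →L[ℂ] H) (k : ℕ) :
    charValue (T * A) k ≤ ‖A‖ * charValue T k := by
  refine le_of_forall_pos_le_add fun ε hε => ?_
  obtain ⟨E, hE, hEk, h⟩ := exists_of_charValue_lt T
    (show charValue T k < charValue T k + ε / (‖A‖ + 1) by
      have : 0 < ε / (‖A‖ + 1) := by positivity
      linarith)
  have h0 := charValue_nonneg T k
  have hA := norm_nonneg A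
  have hε' : ‖A‖ * (ε / (‖A‖ + 1)) ≤ ε := by
    rw [← mul_div_assoc, div_le_iff₀ (by positivity)]
    nlinarith
  refine charValue_le _ (E.map (ContinuousLinearMap.adjoint A : H →ₗ[ℂ] H))
    ((Submodule.finrank_map_le _ E).trans hEk) (by positivity) fun x hx => ?_
  have hAx : A x ∈ Eᗮ := by
    rw [Submodule.mem_orthogonal] at hx ⊢
    intro e he
    rw [← ContinuousLinearMap.adjoint_inner_left]
    exact hx _ (Submodule.mem_map_of_mem he)
  calc ‖(T * A) x‖ ≤ (charValue T k + ε / (‖A‖ + 1)) * ‖A x‖ := h _ hAx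
    _ ≤ (charValue T k + ε / (‖A‖ + 1)) * (‖A‖ * ‖x‖) := by gcongr; exact A.le_opNorm x
    _ = (‖A‖ * charValue T k + ‖A‖ * (ε / (‖A‖ + 1))) * ‖x‖ := by ring
    _ ≤ _ := by gcongr

variable (H) in
/-- The weak trace class `𝓛^{1,∞}`: the compact operators `T` with `μ_k(T) = O(k⁻¹)`. -/
def weakTraceClass : Submodule ℂ (H →L[ℂ] H) where
  carrier := {T | IsCompactOperator T ∧ ∃ C : ℝ, ∀ k : ℕ, charValue T k ≤ C / (k + 1)}
  zero_mem' := by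
    refine ⟨isCompactOperator_zero, 0, fun k => ?_⟩
    rw [zero_div]
    exact charValue_le 0 ⊥ (by simp) le_rfl (by simp)
  add_mem' {S T} := by
    rintro ⟨hS, C, hC⟩ ⟨hT, D, hD⟩
    refine ⟨hS.add hT, 2 * (C + D), fun k => ?_⟩
    have h := charValue_add_le S T (show k / 2 + k / 2 ≤ k by omega)
    have hCD : 0 ≤ C + D := by
      have h1 := (charValue_nonneg S 0).trans (hC 0)
      have h2 := (charValue_nonneg T 0).trans (hD 0)
      norm_num at h1 h2
      linarith
    have hk : (k : ℝ) + 1 ≤ 2 * (((k / 2 : ℕ) : ℝ) + 1) := by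
      have : k + 1 ≤ 2 * (k / 2 + 1) := by omega
      exact_mod_cast this
    calc charValue (S + T) k ≤ C / (((k / 2 : ℕ) : ℝ) + 1) + D / (((k / 2 : ℕ) : ℝ) + 1) :=
          h.trans (add_le_add (hC _) (hD _))
      _ = (C + D) / (((k / 2 : ℕ) : ℝ) + 1) := by ring
      _ ≤ 2 * (C + D) / (k + 1) := by
          rw [div_le_div_iff₀ (by positivity) (by positivity)]
          nlinarith
  smul_mem' c T := by
    rintro ⟨hT, C, hC⟩
    have h1 : c • T = (c • (1 : H →L[ℂ] H)) * T := by rw [smul_mul_assoc, one_mul]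
    refine ⟨hT.smul c, ‖c • (1 : H →L[ℂ] H)‖ * C, fun k => ?_⟩
    rw [h1, mul_div_assoc]
    exact (charValue_mul_left_le _ T k).trans (by gcongr; exact hC k)

theorem mul_mem_weakTraceClass_left (A : H →L[ℂ] H) {T : H →L[ℂ] H}
    (hT : T ∈ weakTraceClass H) : A * T ∈ weakTraceClass H := by
  obtain ⟨hc, C, hC⟩ := hT
  refine ⟨hc.clm_comp A, ‖A‖ * C, fun k => ?_⟩
  rw [mul_div_assoc]
  exact (charValue_mul_left_le A T k).trans (by gcongr; exact hC k)

theorem mul_mem_weakTraceClass_right (A : H →L[ℂ] H) {T : H →L[ℂ] H}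
    (hT : T ∈ weakTraceClass H) : T * A ∈ weakTraceClass H := by
  obtain ⟨hc, C, hC⟩ := hT
  refine ⟨hc.comp_clm A, ‖A‖ * C, fun k => ?_⟩
  rw [mul_div_assoc]
  exact (charValue_mul_right_le A T k).trans (by gcongr; exact hC k)

/-- The commutator `[A, T] = A T - T A` of a bounded operator `A` and `T ∈ 𝓛^{1,∞}`. -/
def weakCommutator (A : H →L[ℂ] H) (T : weakTraceClass H) : weakTraceClass H :=
  ⟨A * T - T * A, Submodule.sub_mem _ (mul_mem_weakTraceClass_left A T.2)
    (mul_mem_weakTraceClass_right A T.2)⟩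

variable (H) in
/-- The commutator subspace `Com(𝓛^{1,∞})`, spanned by all `[A, T]`. -/
def commutatorSubspace : Submodule ℂ (weakTraceClass H) :=
  Submodule.span ℂ {S | ∃ (A : H →L[ℂ] H) (T : weakTraceClass H), S = weakCommutator A T}

/-- `φ` is a normalized positive trace on `𝓛^{1,∞}`. -/
structure IsNormalizedPositiveTrace (φ : weakTraceClass H →ₗ[ℂ] ℂ) : Prop where
  /-- `φ` is annihilated by the commutator subspace. -/
  trace : ∀ S ∈ commutatorSubspace H, φ S = 0
  /-- `φ` is non-negative on positive operators. -/
  positive : ∀ T : weakTraceClass H, (T : H →L[ℂ] H).IsPositive → 0 ≤ (φ T).re ∧ (φ T).im = 0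
  /-- `φ(T₀) = 1` for an operator `T₀` with `T₀ ξ_k = (k + 1)⁻¹ ξ_k` for an orthonormal basis
  `(ξ_k)`. As `φ` is a trace, the choice of `T₀` and of the basis does not matter. -/
  normalized : ∃ (ξ : HilbertBasis ℕ ℂ H) (T₀ : weakTraceClass H),
    (∀ k : ℕ, (T₀ : H →L[ℂ] H) (ξ k) = ((k : ℂ) + 1)⁻¹ • ξ k) ∧ φ T₀ = 1

/-- The noncommutative integral of `T ∈ 𝓛^{1,∞}` is `L`: every normalized positive trace takes the
value `L` at `T`. -/
def HasNCIntegral (T : weakTraceClass H) (L : ℂ) : Prop :=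
  ∀ φ : weakTraceClass H →ₗ[ℂ] ℂ, IsNormalizedPositiveTrace φ → φ T = L

/-- `T ∈ 𝓛^{1,∞}` is strongly measurable: all normalized positive traces take the same value
at `T`. -/
def IsStronglyMeasurable (T : weakTraceClass H) : Prop := ∃ L : ℂ, HasNCIntegral T L

end WeakTraceClass
section Symbols

variable {n : ℕ} {θ : Matrix (Fin n) (Fin n) ℝ}

/-- The derivations `δ_{J_1} ⋯ δ_{J_k} u = D_{s_{J_1}} ⋯ D_{s_{J_k}} α_s(u) |_{s = 0}`, where
`D = -i ∂`. Each multi-order `β` with `|β| = k` is given by some word `J : Fin k → Fin n`. The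
topology of the smooth torus is defined by the semi-norms `u ↦ ‖δ_J u‖`. -/
def ncDeriv {k : ℕ} (J : Fin k → Fin n) (u : smoothTorus θ) : ncTorus θ :=
  (-Complex.I) ^ k • iteratedFDeriv ℝ k (fun s => torusAction θ s (u : ncTorus θ)) 0
    (fun i => EuclideanSpace.single (J i) 1)

/-- `ρ` is `C^∞` on `S ⊆ ℝⁿ` as a map to the smooth torus with the topology defined by the
semi-norms `u ↦ ‖δ_J u‖`: every `ξ ↦ δ_J ρ(ξ)` is a `C^∞` map to the Banach space `A_θ`. -/
def IsSmoothMapOn (S : Set (EuclideanSpace ℝ (Fin n)))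
    (ρ : EuclideanSpace ℝ (Fin n) → smoothTorus θ) : Prop :=
  ∀ (k : ℕ) (J : Fin k → Fin n), ContDiffOn ℝ (⊤ : ℕ∞) (fun ξ => ncDeriv J (ρ ξ)) S

/-- The homogeneous symbols of degree `q`: `C^∞` maps on `ℝⁿ ∖ 0` with `ρ(tξ) = t^q ρ(ξ)` for all
`t > 0` (the value at `0` is irrelevant). -/
structure IsHomogeneousSymbol (q : ℂ) (ρ : EuclideanSpace ℝ (Fin n) → smoothTorus θ) : Prop where
  smooth : IsSmoothMapOn {0}ᶜ ρ
  homogeneous : ∀ (t : ℝ) (ξ : EuclideanSpace ℝ (Fin n)), 0 < t → ξ ≠ 0 →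
    ρ (t • ξ) = (t : ℂ) ^ q • ρ ξ

/-- `ρ` is a classical symbol of order `q` with asymptotic expansion `ρ ∼ ∑_{j ≥ 0} ρ_{q - j}`;
`ρh j` is the homogeneous component `ρ_{q - j}`. The derivatives `∂_ξ^β`, `|β| = b`, are
taken together as the `b`-th Fréchet derivative. -/
structure IsClassicalSymbol (q : ℂ) (ρ : EuclideanSpace ℝ (Fin n) → smoothTorus θ)
    (ρh : ℕ → EuclideanSpace ℝ (Fin n) → smoothTorus θ) : Prop where
  smooth : IsSmoothMapOn Set.univ ρ
  homogeneous : ∀ j : ℕ, IsHomogeneousSymbol (q - j) (ρh j)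
  expansion : ∀ (N k b : ℕ) (J : Fin k → Fin n), ∃ C : ℝ,
    ∀ ξ : EuclideanSpace ℝ (Fin n), 1 ≤ ‖ξ‖ →
      ‖iteratedFDeriv ℝ b (fun η => ncDeriv J (ρ η - ∑ j ∈ Finset.range N, ρh j η)) ξ‖ ≤
        C * ‖ξ‖ ^ (q.re - N - b)

/-- The Fourier coefficients `u_k = ⟨u, U^k⟩ = τ(u (U^k)⋆)`. -/
def fourierCoeff (u : ncTorus θ) (k : Fin n → ℤ) : ℂ :=
  ncTrace θ (u * star (ncMonomial θ k : ncTorus θ))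

/-- The lattice point `k ∈ ℤⁿ ⊆ ℝⁿ`. -/
def latticePt (k : Fin n → ℤ) : EuclideanSpace ℝ (Fin n) := WithLp.toLp 2 fun j => (k j : ℝ)

/-- `P = P_ρ`, that is, `P u = ∑_{k ∈ ℤⁿ} u_k ρ(k) U^k` for all `u` in the smooth torus. -/
def IsPsiDOWithSymbol (ρ : EuclideanSpace ℝ (Fin n) → smoothTorus θ)
    (P : smoothTorus θ →ₗ[ℂ] smoothTorus θ) : Prop :=
  ∀ u : smoothTorus θ, HasSum (fun k : Fin n → ℤ => fourierCoeff (u : ncTorus θ) k •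
    ((ρ (latticePt k) : ncTorus θ) * (ncMonomial θ k : ncTorus θ))) (P u : ncTorus θ)

variable (θ) in
/-- The classical pseudodifferential operators of order `q ∈ ℂ` on the noncommutative torus. -/
def classicalPsiDO (q : ℂ) : Set (smoothTorus θ →ₗ[ℂ] smoothTorus θ) :=
  {P | ∃ ρ ρh, IsClassicalSymbol q ρ ρh ∧ IsPsiDOWithSymbol ρ P}

/-- `r = ∫_{𝕊^{n-1}} τ[ρ_{-n}(ξ)] d^{n-1}ξ` for a classical symbol `ρ` of integer order `q` of
`P`. The component `ρ_{-n}` is the one of index `q + n`, and is `0` if `q < -n`. -/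
def IsNCResidue (P : smoothTorus θ →ₗ[ℂ] smoothTorus θ) (r : ℂ) : Prop :=
  ∃ (q : ℤ) (ρ : EuclideanSpace ℝ (Fin n) → smoothTorus θ)
    (ρh : ℕ → EuclideanSpace ℝ (Fin n) → smoothTorus θ),
    IsClassicalSymbol (q : ℂ) ρ ρh ∧ IsPsiDOWithSymbol ρ P ∧
    r = if 0 ≤ q + n then
        ∫ ξ : Metric.sphere (0 : EuclideanSpace ℝ (Fin n)) 1,
          ncTrace θ (ρh (q + n).toNat ξ : ncTorus θ) ∂(volume.toSphere)
      else 0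

open Classical in
/-- The noncommutative residue `Res P` of a classical pseudodifferential operator of integer order
(the homogeneous component `ρ_{-n}` is determined by `P`); it is `0` for other maps. -/
def ncResidue (P : smoothTorus θ →ₗ[ℂ] smoothTorus θ) : ℂ :=
  if h : ∃ r, IsNCResidue P r then h.choose else 0

/-- `T` is a bounded operator on `L²(𝕋ⁿ_θ)` that extends `P`. -/
def IsBoundedExtension (P : smoothTorus θ →ₗ[ℂ] smoothTorus θ)
    (T : L2NCTorus θ →L[ℂ] L2NCTorus θ) : Prop :=
  ∀ u : smoothTorus θ, T (toL2 θ u) = toL2 θ (P u)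

end Symbols

end NCTorus

end

noncomputable section

namespace NCTorus

/-! ### Diagonal operators in a Hilbert basis and the weak trace class -/

section Diagonal

open Filter Topology ComplexConjugate

variable {H : Type*} [NormedAddCommGroup H] [InnerProductSpace ℂ H] {ι : Type*}

/-! The monomials U^k form a Hilbert basis of L², and P U^k = ρ(k) U^k. Expanding ρ(k) = ∑_m ρ(k)_m
U^m gives P = ∑_m L_m D_m, with L_m the left multiplication by U^m and D_m diagonal with entries
ρ(k)_m. Applying n + 1 derivations to ρ yields |ρ(k)_m| ≤ C (1 + |m|^(n+1))⁻¹ |k|⁻ⁿ for k ≠ 0. Hence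
P = BΛ, where Λ is diagonal with entries |k|⁻ⁿ (and 1 at the origin), and B is a sum that converges
in operator norm. As Λ is in 𝓛^{1,∞}, so is P.

Let φ be a normalized positive trace. The linear form A ↦ φ(AΛ) is positive on a C*-algebra, hence
bounded, so φ(P) = ∑_m φ(L_m D_m). Conjugation by a translation of the torus multiplies L_m D_m by
e^{is·m}, so all terms with m ≠ 0 vanish. What remains is φ(D_0), with D_0 diagonal with entries
τ(ρ(k)) (`IsClassicalSymbol.exists_weakTraceClass`).

On diagonal operators φ depends only on the eigenvalues, and it vanishes on rank one projections
because the harmonic series diverges. By positivity it takes the value L as soon as (rank + 1) ·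
eigenvalue → L (`map_eq_of_tendsto`). For g positive, continuous and homogeneous of degree -n,
sorting ℤⁿ by decreasing g is a lattice point count: the number of k ≠ 0 with 1/g(k) ≤ c is
asymptotic to c times the volume of {1/g ≤ 1}, which is (1/n) ∫ g over the sphere in polar
coordinates (`exists_lattice_enumeration`). Linearity extends this from positive g to τ(ρ_{-n}), and
the remainder O(|k|^(-n-1)) does not contribute (`map_lattice_of_asymptotic`).

Finally, τ(ρ(k)) = τ(P(U^k) (U^k)*) depends only on P. Comparing the expansions of two symbols along
the rays tk, and then using homogeneity and continuity, shows that τ(ρ_{-n}) depends only on P as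
well (`ncTrace_component_eq`), so the residue is well defined. -/

theorem clm_ext_hilbertBasis (b : HilbertBasis ι ℂ H) {F : Type*} [NormedAddCommGroup F]
    [NormedSpace ℂ F] {S T : H →L[ℂ] F} (h : ∀ i, S (b i) = T (b i)) : S = T := by
  refine ContinuousLinearMap.ext_on (s := Set.range b) ?_ ?_
  · rw [dense_iff_closure_eq, ← Submodule.topologicalClosure_coe, b.dense_span]; rfl
  · rintro _ ⟨i, rfl⟩; exact h i

/-- `T` is the diagonal operator with entries `f` in the Hilbert basis `b`. -/
def IsDiagonal (b : HilbertBasis ι ℂ H) (f : ι → ℂ) (T : H →L[ℂ] H) : Prop :=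
  ∀ i, T (b i) = f i • b i

/-- Diagonal operators with the same entries in two bases are unitarily equivalent. -/
theorem exists_conj_of_isDiagonal (b c : HilbertBasis ι ℂ H) {f : ι → ℂ} {S T : H →L[ℂ] H}
    (hS : IsDiagonal b f S) (hT : IsDiagonal c f T) :
    ∃ W W' : H →L[ℂ] H, W' * W = 1 ∧ T = W * S * W' := by
  classical
  let e : H ≃ₗᵢ[ℂ] H := b.repr.trans c.repr.symm
  have he : ∀ i, e (b i) = c i := fun i => by
    change c.repr.symm (b.repr (b i)) = c i
    rw [b.repr_self, c.repr_symm_single]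
  have he' : ∀ i, e.symm (c i) = b i := fun i => by rw [← he, e.symm_apply_apply]
  refine ⟨(e : H →L[ℂ] H), (e.symm : H →L[ℂ] H), ?_, ?_⟩
  · ext x; exact e.symm_apply_apply x
  · refine clm_ext_hilbertBasis c fun i => ?_
    change T (c i) = e (S (e.symm (c i)))
    rw [he', hS i, hT i, map_smul, he]

theorem exists_isDiagonal (b : HilbertBasis ι ℂ H) {f : ι → ℂ} {C : ℝ} (hf : ∀ i, ‖f i‖ ≤ C) :
    ∃ T : H →L[ℂ] H, IsDiagonal b f T := by
  classical
  have hK : ∀ i, ‖f i‖ ≤ max C 0 := fun i => (hf i).trans (le_max_left _ _)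
  let M := lp.mapCLM (E := fun _ : ι => ℂ) (F := fun _ : ι => ℂ) 2
    (fun i => f i • ContinuousLinearMap.id ℂ ℂ) (K := max C 0) (le_max_right _ _)
    (fun i => by simpa [norm_smul] using Or.inl (hf i))
  refine ⟨(b.repr.symm : lp (fun _ : ι => ℂ) 2 →L[ℂ] H) ∘L M ∘L (b.repr : H →L[ℂ] _), fun i => ?_⟩
  change b.repr.symm (M (b.repr (b i))) = _
  rw [LinearIsometryEquiv.symm_apply_eq, map_smul, b.repr_self]
  ext j
  simp only [M, lp.mapCLM_apply_coe, lp.coeFn_smul, Pi.smul_apply]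
  by_cases hij : j = i
  · subst hij; simp
  · simp [Pi.single_eq_of_ne hij]

namespace IsDiagonal

variable {b : HilbertBasis ι ℂ H} {f g : ι → ℂ} {S T : H →L[ℂ] H}

theorem unique (hS : IsDiagonal b f S) (hT : IsDiagonal b f T) : S = T :=
  clm_ext_hilbertBasis b fun i => (hS i).trans (hT i).symm

theorem add (hS : IsDiagonal b f S) (hT : IsDiagonal b g T) :
    IsDiagonal b (fun i => f i + g i) (S + T) := fun i => by
  simp [hS i, hT i, add_smul]

theorem sub (hS : IsDiagonal b f S) (hT : IsDiagonal b g T) :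
    IsDiagonal b (fun i => f i - g i) (S - T) := fun i => by
  simp [hS i, hT i, sub_smul]

theorem smul (c : ℂ) (hS : IsDiagonal b f S) : IsDiagonal b (fun i => c * f i) (c • S) := fun i => by
  simp [hS i, smul_smul]

theorem mul (hS : IsDiagonal b f S) (hT : IsDiagonal b g T) :
    IsDiagonal b (fun i => f i * g i) (S * T) := fun i => by
  simp [hS i, hT i, smul_smul, mul_comm]

theorem inner_apply (hT : IsDiagonal b f T) (i : ι) (x : H) :
    inner ℂ (b i) (T x) = f i * inner ℂ (b i) x := by
  classical
  have : (innerSL ℂ (b i)) ∘L T = f i • innerSL ℂ (b i) := by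
    refine clm_ext_hilbertBasis b fun j => ?_
    simp only [ContinuousLinearMap.comp_apply, innerSL_apply_apply, hT j, inner_smul_right,
      smul_apply, orthonormal_iff_ite.1 b.orthonormal, smul_eq_mul]
    split_ifs with h
    · rw [h]
    · simp
  exact congrArg (fun L : H →L[ℂ] ℂ => L x) this

/-- The second alternative serves vectors orthogonal to the basis vectors with large entries; this
is how the characteristic values of a diagonal operator are bounded. -/
theorem norm_apply_le (hT : IsDiagonal b f T) {c : ℝ} (hc : 0 ≤ c) {x : H}
    (h : ∀ i, ‖f i‖ ≤ c ∨ inner ℂ (b i) x = 0) : ‖T x‖ ≤ c * ‖x‖ := by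
  rw [← b.repr.norm_map (T x), ← b.repr.norm_map x]
  have : ‖b.repr (T x)‖ ≤ ‖(c : ℂ) • b.repr x‖ := by
    refine lp.norm_mono (by norm_num) fun i => ?_
    rw [b.repr_apply_apply, hT.inner_apply, lp.coeFn_smul, Pi.smul_apply, b.repr_apply_apply,
      norm_mul, norm_smul, Complex.norm_real, Real.norm_of_nonneg hc]
    rcases h i with h | h
    · gcongr
    · simp [h]
  rwa [norm_smul, Complex.norm_real, Real.norm_of_nonneg hc] at this

theorem norm_le (hT : IsDiagonal b f T) {c : ℝ} (hc : 0 ≤ c) (h : ∀ i, ‖f i‖ ≤ c) : ‖T‖ ≤ c :=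
  T.opNorm_le_bound hc fun _ => hT.norm_apply_le hc fun i => Or.inl (h i)

theorem isPositive {f : ι → ℝ} (hT : IsDiagonal b (fun i => (f i : ℂ)) T) (hf : ∀ i, 0 ≤ f i) :
    T.IsPositive := by
  rw [ContinuousLinearMap.isPositive_iff_complex]
  intro x
  have h1 : HasSum (fun i => ((f i * ‖(inner ℂ (b i) x : ℂ)‖ ^ 2 : ℝ) : ℂ)) (inner ℂ (T x) x) := by
    refine (b.hasSum_inner_mul_inner (T x) x).congr_fun ?_
    intro i
    rw [← inner_conj_symm (T x), hT.inner_apply, map_mul, Complex.conj_ofReal, mul_assoc,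
      ← Complex.normSq_eq_conj_mul_self, Complex.normSq_eq_norm_sq]
    push_cast; rfl
  have h2 : (∑' i, f i * ‖(inner ℂ (b i) x : ℂ)‖ ^ 2 : ℝ) = (inner ℂ (T x) x : ℂ) := by
    rw [← h1.tsum_eq, Complex.ofReal_tsum]
  rw [← h2]
  refine ⟨by simp, ?_⟩
  simp only [RCLike.re_to_complex, Complex.ofReal_re]
  exact tsum_nonneg fun i => mul_nonneg (hf i) (by positivity)

end IsDiagonal

variable [CompleteSpace H]

/-- Composing T with the projection onto a subspace of dimension at most k changes it by at most (C
+ 1)/(k + 1) in norm, so T is a norm limit of finite rank operators. The 1 is slack, since the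
infimum need not be attained. -/
theorem isCompactOperator_of_charValue_le {T : H →L[ℂ] H} {C : ℝ}
    (h : ∀ k : ℕ, charValue T k ≤ C / (k + 1)) : IsCompactOperator T := by
  have key : ∀ k : ℕ, ∃ F : H →L[ℂ] H, IsCompactOperator F ∧ ‖F - T‖ ≤ (C + 1) / (k + 1) := by
    intro k
    have hlt : charValue T k < (C + 1) / (k + 1) :=
      (h k).trans_lt (by gcongr; linarith)
    obtain ⟨E, hE, -, hb⟩ := exists_of_charValue_lt T hlt
    have hc : 0 ≤ (C + 1) / ((k : ℝ) + 1) := (charValue_nonneg T k).trans hlt.le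
    have hid : IsCompactOperator (_root_.id : E → E) :=
      isCompactOperator_id_iff_finiteDimensional (𝕜 := ℂ).2 hE
    refine ⟨T ∘L E.starProjection, ?_, ?_⟩
    · exact (hid.comp_clm (E.orthogonalProjectionOnto)).clm_comp (T ∘L E.subtypeL)
    · refine ContinuousLinearMap.opNorm_le_bound _ hc fun x => ?_
      have h1 : (T ∘L E.starProjection - T) x = -T (x - E.starProjection x) := by
        simp
      rw [h1, norm_neg]
      refine (hb _ (Submodule.sub_starProjection_mem_orthogonal x)).trans ?_
      gcongr
      have h2 : x - E.starProjection x = Eᗮ.starProjection x := by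
        rw [Submodule.starProjection_orthogonal']; simp
      rw [h2]
      exact Submodule.norm_starProjection_apply_le _ _
  choose F hF hFT using key
  refine isCompactOperator_of_tendsto (l := atTop) (F := F) ?_ (Eventually.of_forall hF)
  rw [tendsto_iff_norm_sub_tendsto_zero]
  refine squeeze_zero (fun _ => norm_nonneg _) hFT ?_
  have := (tendsto_one_div_add_atTop_nhds_zero_nat (𝕜 := ℝ)).const_mul (C + 1)
  simpa [div_eq_mul_inv] using this

/-- The basis vectors of rank below k span a space of dimension at most k, and on its orthogonal
complement only entries of size at most C/(k + 1) act. -/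
theorem IsDiagonal.mem_weakTraceClass {b : HilbertBasis ι ℂ H} {f : ι → ℂ} {T : H →L[ℂ] H}
    (hT : IsDiagonal b f T) {r : ι → ℕ} (hr : Function.Injective r) {C : ℝ} (hC : 0 ≤ C)
    (hf : ∀ i, ‖f i‖ ≤ C / (r i + 1)) : T ∈ weakTraceClass H := by
  have h : ∀ k : ℕ, charValue T k ≤ C / (k + 1) := by
    intro k
    have hfin : (r ⁻¹' Set.Iio k).Finite := (Set.finite_Iio k).preimage hr.injOn
    let s : Finset ι := hfin.toFinset
    classical
    have : FiniteDimensional ℂ (Submodule.span ℂ ((s.image b : Finset H) : Set H)) :=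
      FiniteDimensional.span_finset _ _
    refine charValue_le T (Submodule.span ℂ ((s.image b : Finset H) : Set H)) ?_
      (by positivity) fun x hx => ?_
    · refine (finrank_span_finset_le_card _).trans (Finset.card_image_le.trans ?_)
      have : s.image r ⊆ Finset.range k := by
        intro j hj
        obtain ⟨i, hi, rfl⟩ := Finset.mem_image.1 hj
        simpa [s] using hi
      rw [← Finset.card_image_of_injective s hr]
      exact (Finset.card_le_card this).trans (by simp)
    · refine hT.norm_apply_le (by positivity) fun i => ?_
      by_cases hi : r i < k
      · right
        refine (Submodule.mem_orthogonal _ x).1 hx _ (Submodule.subset_span ?_)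
        simp only [Finset.coe_image]
        exact ⟨i, by simpa [s] using hi, rfl⟩
      · left
        refine (hf i).trans ?_
        gcongr
        exact_mod_cast not_lt.1 hi
  exact ⟨isCompactOperator_of_charValue_le h, C, h⟩

end Diagonal

/-! ### Positive traces on diagonal operators -/

section Traces

open Filter Topology ComplexConjugate ComplexOrder

variable {H : Type*} [NormedAddCommGroup H] [InnerProductSpace ℂ H] [CompleteSpace H]
  {ι ι' : Type*}

/-- The Hilbert basis `i ↦ b (σ i)`. -/
def reindexBasis (b : HilbertBasis ι' ℂ H) (σ : ι ≃ ι') : HilbertBasis ι ℂ H :=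
  HilbertBasis.mk (v := fun i => b (σ i)) (b.orthonormal.comp σ σ.injective) (by
    have : Set.range (fun i => b (σ i)) = Set.range b := σ.surjective.range_comp b
    rw [this, b.dense_span])

theorem reindexBasis_apply (b : HilbertBasis ι' ℂ H) (σ : ι ≃ ι') (i : ι) :
    reindexBasis b σ i = b (σ i) := by
  rw [reindexBasis, HilbertBasis.coe_mk]

theorem isDiagonal_reindexBasis {b : HilbertBasis ι' ℂ H} {σ : ι ≃ ι'} {f : ι → ℂ}
    {T : H →L[ℂ] H} : IsDiagonal (reindexBasis b σ) f T ↔ IsDiagonal b (fun i => f (σ.symm i)) T := by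
  constructor
  · intro h i
    have := h (σ.symm i)
    rwa [reindexBasis_apply, σ.apply_symm_apply] at this
  · intro h i
    have := h (σ i)
    beta_reduce at this
    rwa [σ.symm_apply_apply, ← reindexBasis_apply] at this

theorem exists_mem_weakTraceClass (b : HilbertBasis ι ℂ H) {f : ι → ℂ} {r : ι → ℕ}
    (hr : Function.Injective r) {C : ℝ} (hC : 0 ≤ C) (hf : ∀ i, ‖f i‖ ≤ C / (r i + 1)) :
    ∃ T : weakTraceClass H, IsDiagonal b f (T : H →L[ℂ] H) := by
  obtain ⟨T, hT⟩ := exists_isDiagonal b (f := f) (C := C) fun i =>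
    (hf i).trans (div_le_self hC (by have : (0 : ℝ) ≤ r i := Nat.cast_nonneg _
                                     linarith))
  exact ⟨⟨T, hT.mem_weakTraceClass hr hC hf⟩, hT⟩

namespace IsNormalizedPositiveTrace

variable {φ : weakTraceClass H →ₗ[ℂ] ℂ}

theorem map_mul_comm (hφ : IsNormalizedPositiveTrace φ) (A : H →L[ℂ] H) (T : weakTraceClass H) :
    φ ⟨A * T, mul_mem_weakTraceClass_left A T.2⟩ = φ ⟨T * A, mul_mem_weakTraceClass_right A T.2⟩ := by
  rw [← sub_eq_zero, ← map_sub]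
  exact hφ.trace _ (Submodule.subset_span ⟨A, T, rfl⟩)

/-- Cyclicity, applied to the element SW' of the ideal: φ(W(SW')) = φ((SW')W) = φ(S). A one-sided
inverse is enough. -/
theorem map_conj (hφ : IsNormalizedPositiveTrace φ) {S T : weakTraceClass H} {W W' : H →L[ℂ] H}
    (hW : W' * W = 1) (hT : (T : H →L[ℂ] H) = W * S * W') : φ T = φ S := by
  have h := hφ.map_mul_comm W ⟨S * W', mul_mem_weakTraceClass_right W' S.2⟩
  have h1 : T = ⟨W * (S * W'), mul_mem_weakTraceClass_left W
      (mul_mem_weakTraceClass_right W' S.2)⟩ := Subtype.ext (by rw [hT, mul_assoc])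
  have h2 : S = ⟨S * W' * W, mul_mem_weakTraceClass_right W
      (mul_mem_weakTraceClass_right W' S.2)⟩ := Subtype.ext (by
    change (S : H →L[ℂ] H) = S * W' * W
    rw [mul_assoc, hW, mul_one])
  rw [h1, h]
  exact (congrArg φ h2).symm

/-- A unitary carries one basis to the other, so only the eigenvalues matter; with `reindexBasis`
they may also be permuted. -/
theorem map_eq_of_isDiagonal (hφ : IsNormalizedPositiveTrace φ) {b c : HilbertBasis ι ℂ H}
    {f : ι → ℂ} {S T : weakTraceClass H} (hS : IsDiagonal b f (S : H →L[ℂ] H))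
    (hT : IsDiagonal c f (T : H →L[ℂ] H)) : φ S = φ T := by
  obtain ⟨W, W', hW, h⟩ := exists_conj_of_isDiagonal b c hS hT
  exact (hφ.map_conj hW h).symm

/-- For a positive `Λ` in the weak trace class, `B ↦ φ(B Λ)` is a bounded linear form. -/
theorem exists_clm (hφ : IsNormalizedPositiveTrace φ) {Λ : weakTraceClass H}
    (hΛ : (Λ : H →L[ℂ] H).IsPositive) :
    ∃ ψ : (H →L[ℂ] H) →L[ℂ] ℂ, ∀ B, ψ B = φ ⟨B * Λ, mul_mem_weakTraceClass_left B Λ.2⟩ := by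
  let ψ : (H →L[ℂ] H) →ₗ[ℂ] ℂ :=
    { toFun := fun B => φ ⟨B * Λ, mul_mem_weakTraceClass_left B Λ.2⟩
      map_add' := fun A B => by
        rw [← map_add]; exact congrArg φ (Subtype.ext (add_mul _ _ _))
      map_smul' := fun c B => by
        rw [RingHom.id_apply, ← map_smul]; exact congrArg φ (Subtype.ext (smul_mul_assoc _ _ _)) }
  -- For B = C*C, cyclicity gives φ(C*CΛ) = φ(CΛC*), and CΛC* is positive.
  have hψ : ∀ B, 0 ≤ B → 0 ≤ ψ B := by
    intro B hB
    obtain ⟨C, rfl⟩ := CStarAlgebra.nonneg_iff_eq_star_mul_self.1 hB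
    have h1 : ψ (star C * C) = φ ⟨C * Λ * star C, mul_mem_weakTraceClass_right _
        (mul_mem_weakTraceClass_left C Λ.2)⟩ := by
      rw [← hφ.map_mul_comm (star C) ⟨C * Λ, mul_mem_weakTraceClass_left C Λ.2⟩]
      exact congrArg φ (Subtype.ext (mul_assoc _ _ _))
    have h2 : (C * (Λ : H →L[ℂ] H) * star C).IsPositive := by
      have := hΛ.conj_adjoint C
      rwa [ContinuousLinearMap.star_eq_adjoint]
    rw [h1, Complex.nonneg_iff]
    exact ⟨(hφ.positive _ h2).1, (hφ.positive _ h2).2.symm⟩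
  -- A positive linear form on a C*-algebra is automatically bounded.
  obtain ⟨C, hC⟩ := PositiveLinearMap.exists_norm_apply_le (PositiveLinearMap.mk₀ ψ hψ)
  exact ⟨ψ.mkContinuous C hC, fun B => rfl⟩

section Model

variable {ξ : HilbertBasis ℕ ℂ H} {T₀ : weakTraceClass H}

/-- Both δT₀ + T and δT₀ - T are positive, and φ(T₀) = 1. -/
theorem norm_map_le_of_isDiagonal_ofReal (hφ : IsNormalizedPositiveTrace φ)
    (hT₀ : ∀ k : ℕ, (T₀ : H →L[ℂ] H) (ξ k) = ((k : ℂ) + 1)⁻¹ • ξ k) (h1 : φ T₀ = 1)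
    {h : ℕ → ℝ} {T : weakTraceClass H} (hT : IsDiagonal ξ (fun j => (h j : ℂ)) (T : H →L[ℂ] H))
    {δ : ℝ} (hh : ∀ j, |h j| ≤ δ / (j + 1)) : ‖φ T‖ ≤ δ := by
  have hT₀' : IsDiagonal ξ (fun k : ℕ => ((k : ℂ) + 1)⁻¹) (T₀ : H →L[ℂ] H) := hT₀
  have hp := hφ.positive ((δ : ℂ) • T₀ + T) (IsDiagonal.isPositive (b := ξ)
    (f := fun j => δ / (j + 1) + h j)
    (by
      have : IsDiagonal ξ _ (((δ : ℂ) • T₀ + T : weakTraceClass H) : H →L[ℂ] H) :=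
        (hT₀'.smul (δ : ℂ)).add hT
      convert this using 2
      push_cast; rw [div_eq_mul_inv])
    (fun j => by linarith [neg_le_of_abs_le (hh j)]))
  have hm := hφ.positive ((δ : ℂ) • T₀ - T) (IsDiagonal.isPositive (b := ξ)
    (f := fun j => δ / (j + 1) - h j)
    (by
      have : IsDiagonal ξ _ (((δ : ℂ) • T₀ - T : weakTraceClass H) : H →L[ℂ] H) :=
        (hT₀'.smul (δ : ℂ)).sub hT
      convert this using 2
      push_cast; rw [div_eq_mul_inv])
    (fun j => by linarith [le_of_abs_le (hh j)]))
  rw [map_add, map_smul, h1] at hp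
  rw [map_sub, map_smul, h1] at hm
  simp at hp hm
  have : φ T = ((φ T).re : ℂ) := Complex.ext rfl (by simp [hm.2])
  rw [this, Complex.norm_real, Real.norm_eq_abs, abs_le]
  constructor <;> linarith

theorem norm_map_le_of_isDiagonal (hφ : IsNormalizedPositiveTrace φ)
    (hT₀ : ∀ k : ℕ, (T₀ : H →L[ℂ] H) (ξ k) = ((k : ℂ) + 1)⁻¹ • ξ k) (h1 : φ T₀ = 1)
    {h : ℕ → ℂ} {T : weakTraceClass H} (hT : IsDiagonal ξ h (T : H →L[ℂ] H))
    {δ : ℝ} (hδ : 0 ≤ δ) (hh : ∀ j, ‖h j‖ ≤ δ / (j + 1)) : ‖φ T‖ ≤ 2 * δ := by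
  have hre : ∀ j, |(h j).re| ≤ δ / (j + 1) := fun j => (Complex.abs_re_le_norm _).trans (hh j)
  have him : ∀ j, |(h j).im| ≤ δ / (j + 1) := fun j => (Complex.abs_im_le_norm _).trans (hh j)
  obtain ⟨A, hA⟩ := exists_mem_weakTraceClass ξ (f := fun j => ((h j).re : ℂ))
    Function.injective_id hδ (fun j => by simpa using hre j)
  obtain ⟨B, hB⟩ := exists_mem_weakTraceClass ξ (f := fun j => ((h j).im : ℂ))
    Function.injective_id hδ (fun j => by simpa using him j)
  have hAB : T = A + Complex.I • B := Subtype.ext (hT.unique (by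
    have : IsDiagonal ξ _ ((A + Complex.I • B : weakTraceClass H) : H →L[ℂ] H) :=
      hA.add (hB.smul Complex.I)
    convert this using 2 with j
    rw [mul_comm]; exact (Complex.re_add_im _).symm))
  rw [hAB, map_add, map_smul]
  refine (norm_add_le _ _).trans ?_
  rw [norm_smul, Complex.norm_I, one_mul, two_mul]
  exact add_le_add (hφ.norm_map_le_of_isDiagonal_ofReal hT₀ h1 hA hre)
    (hφ.norm_map_le_of_isDiagonal_ofReal hT₀ h1 hB him)

/-- Swapping basis vectors shows that all the rank one projections `p j` have the same trace c ≥ 0.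
Since ∑_{j<N} p_j/(j + 1) ≤ T₀, every partial sum of the harmonic series times c is at most 1, so c
= 0. -/
theorem map_eq_zero_of_isDiagonal_single (hφ : IsNormalizedPositiveTrace φ)
    (hT₀ : ∀ k : ℕ, (T₀ : H →L[ℂ] H) (ξ k) = ((k : ℂ) + 1)⁻¹ • ξ k) (h1 : φ T₀ = 1)
    {p : ℕ → weakTraceClass H}
    (hp : ∀ j, IsDiagonal ξ (Pi.single j 1) (p j : H →L[ℂ] H)) (j : ℕ) : φ (p j) = 0 := by
  have heq : ∀ j, φ (p j) = φ (p 0) := fun j => by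
    refine hφ.map_eq_of_isDiagonal (b := reindexBasis ξ (Equiv.swap 0 j)) (c := ξ)
      (f := Pi.single 0 1) ?_ (hp 0)
    rw [isDiagonal_reindexBasis]
    convert hp j using 2 with i
    simp only [Equiv.symm_swap, Pi.single_apply]
    congr 1
    rw [Equiv.swap_apply_eq_iff, Equiv.swap_apply_left]
  have hpos : 0 ≤ (φ (p 0)).re ∧ (φ (p 0)).im = 0 := hφ.positive _ (by
    refine IsDiagonal.isPositive (b := ξ) (f := Pi.single 0 1) ?_ ?_
    · convert hp 0 using 2 with i
      by_cases hi : i = 0 <;> simp [hi]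
    · intro i; by_cases hi : i = 0 <;> simp [hi])
  have hsum : ∀ N : ℕ, (∑ j ∈ Finset.range N, (1 : ℝ) / (j + 1)) * (φ (p 0)).re ≤ 1 := by
    intro N
    have hd : IsDiagonal ξ (fun i => ((if i < N then (0 : ℝ) else 1 / (i + 1) : ℝ) : ℂ))
        ((T₀ - ∑ j ∈ Finset.range N, ((1 / (j + 1) : ℝ) : ℂ) • p j : weakTraceClass H) :
          H →L[ℂ] H) := by
      intro i
      have : ∀ j, (p j : H →L[ℂ] H) (ξ i) = if i = j then ξ i else 0 := fun j => by
        rw [hp j i, Pi.single_apply]; split_ifs <;> simp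
      simp only [AddSubgroupClass.coe_sub, Submodule.coe_sum, Submodule.coe_smul, sub_apply,
        sum_apply, smul_apply, hT₀, this, smul_ite, smul_zero, Finset.sum_ite_eq,
        Finset.mem_range]
      split_ifs with hi
      · simp
      · simp
    have := (hφ.positive _ (hd.isPositive fun i => by split_ifs <;> positivity)).1
    rw [map_sub, map_sum, h1] at this
    simp only [map_smul, heq, Complex.sub_re, Complex.one_re, smul_eq_mul, ← Finset.sum_mul,
      ← Complex.ofReal_sum, Complex.re_ofReal_mul] at this
    linarith
  have hzero : (φ (p 0)).re = 0 := by
    by_contra hne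
    have hlt : 0 < (φ (p 0)).re := lt_of_le_of_ne hpos.1 (Ne.symm hne)
    obtain ⟨N, hN⟩ := (Real.tendsto_sum_range_one_div_nat_succ_atTop.eventually_gt_atTop
      (1 / (φ (p 0)).re)).exists
    have := hsum N
    rw [div_lt_iff₀ hlt] at hN
    linarith
  rw [heq j]
  exact Complex.ext hzero hpos.2

/-- Removing finitely many entries does not change the trace, and the remaining ones are at most
δ/(j + 1); so the trace is at most 2δ for every δ > 0. -/
theorem map_eq_zero_of_isDiagonal_tendsto (hφ : IsNormalizedPositiveTrace φ)
    (hT₀ : ∀ k : ℕ, (T₀ : H →L[ℂ] H) (ξ k) = ((k : ℂ) + 1)⁻¹ • ξ k) (h1 : φ T₀ = 1)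
    {h : ℕ → ℂ} {T : weakTraceClass H} (hT : IsDiagonal ξ h (T : H →L[ℂ] H))
    (hh : Tendsto (fun j : ℕ => ((j : ℂ) + 1) * h j) atTop (𝓝 0)) : φ T = 0 := by
  have hp : ∀ j : ℕ, ∃ p : weakTraceClass H, IsDiagonal ξ (Pi.single j 1) (p : H →L[ℂ] H) := by
    intro j
    refine exists_mem_weakTraceClass ξ Function.injective_id (C := j + 1) (by positivity)
      fun i => ?_
    by_cases hi : i = j
    · subst hi
      rw [Pi.single_eq_same, id, div_self (by positivity)]; simp
    · rw [Pi.single_eq_of_ne hi, norm_zero]; positivity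
  choose p hp using hp
  have hp0 := hφ.map_eq_zero_of_isDiagonal_single hT₀ h1 hp
  suffices ∀ δ : ℝ, 0 < δ → ‖φ T‖ ≤ 2 * δ by
    rw [← norm_le_zero_iff]
    refine le_of_forall_pos_le_add fun ε hε => ?_
    have := this (ε / 2) (by positivity)
    linarith
  intro δ hδ
  obtain ⟨N, hN⟩ := (Metric.tendsto_atTop.1 hh) δ hδ
  have hd : IsDiagonal ξ (fun i => if i < N then 0 else h i)
      ((T - ∑ j ∈ Finset.range N, h j • p j : weakTraceClass H) : H →L[ℂ] H) := by
    intro i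
    have : ∀ j, (p j : H →L[ℂ] H) (ξ i) = if i = j then ξ i else 0 := fun j => by
      rw [hp j i, Pi.single_apply]; split_ifs <;> simp
    simp only [AddSubgroupClass.coe_sub, Submodule.coe_sum, Submodule.coe_smul, sub_apply,
      sum_apply, smul_apply, hT i, this, smul_ite, smul_zero, Finset.sum_ite_eq,
      Finset.mem_range]
    split_ifs with hi
    · simp
    · simp
  have hle := hφ.norm_map_le_of_isDiagonal hT₀ h1 hd hδ.le fun j => by
    split_ifs with hj
    · rw [norm_zero]; positivity
    · have := (hN j (not_lt.1 hj)).le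
      rw [dist_zero_right, norm_mul] at this
      have hj1 : ‖(j : ℂ) + 1‖ = (j : ℝ) + 1 := by
        rw [← Nat.cast_succ, Complex.norm_natCast, Nat.cast_succ]
      rw [hj1] at this
      rw [le_div_iff₀ (by positivity)]
      linarith
  simpa [map_sub, map_sum, hp0] using hle

end Model

/-- If the eigenvalues satisfy `(r + 1) f → L` along an enumeration `r`, then every normalized
positive trace takes the value `L`. -/
theorem map_eq_of_tendsto (hφ : IsNormalizedPositiveTrace φ) {b : HilbertBasis ι ℂ H}
    {f : ι → ℂ} {T : weakTraceClass H} (hT : IsDiagonal b f (T : H →L[ℂ] H)) (r : ι ≃ ℕ) {L : ℂ}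
    (hf : Tendsto (fun i => ((r i : ℂ) + 1) * f i) cofinite (𝓝 L)) : φ T = L := by
  obtain ⟨ξ, T₀, hT₀, h1⟩ := hφ.normalized
  -- To be compared with `T₀`, the eigenvalues are moved to its basis `ξ`, in the order given by
  -- `r`. The copy is conjugate to `T`, hence in the weak trace class.
  obtain ⟨S, hS⟩ : ∃ S : weakTraceClass H, IsDiagonal ξ (fun j => f (r.symm j)) (S : H →L[ℂ] H) := by
    have hd : IsDiagonal (reindexBasis b r.symm) (fun j => f (r.symm j)) (T : H →L[ℂ] H) := by
      rw [isDiagonal_reindexBasis]; simpa using hT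
    have hbd : ∀ i, ‖f (r.symm i)‖ ≤ ‖(T : H →L[ℂ] H)‖ := fun i => by
      have := (T : H →L[ℂ] H).le_opNorm (reindexBasis b r.symm i)
      rwa [hd i, norm_smul, (reindexBasis b r.symm).orthonormal.1, mul_one, mul_one] at this
    obtain ⟨S, hS⟩ := exists_isDiagonal ξ hbd
    obtain ⟨W, W', -, h⟩ := exists_conj_of_isDiagonal _ _ hd hS
    exact ⟨⟨S, h ▸ mul_mem_weakTraceClass_right W' (mul_mem_weakTraceClass_left W T.2)⟩, hS⟩
  have hd : IsDiagonal (reindexBasis ξ r) f (S : H →L[ℂ] H) := by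
    rw [isDiagonal_reindexBasis]; exact hS
  rw [hφ.map_eq_of_isDiagonal hT hd]
  have hT₀' : IsDiagonal ξ (fun k : ℕ => ((k : ℂ) + 1)⁻¹) (T₀ : H →L[ℂ] H) := hT₀
  -- The entries of S - L T₀, multiplied by j + 1, are the differences (j + 1) f - L, which tend to
  -- 0.
  have hz : φ (S - L • T₀) = 0 := by
    refine hφ.map_eq_zero_of_isDiagonal_tendsto hT₀ h1 (hS.sub (hT₀'.smul L)) ?_
    have h2 : Tendsto (fun j : ℕ => ((j : ℂ) + 1) * f (r.symm j)) atTop (𝓝 L) := by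
      rw [← Nat.cofinite_eq_atTop]
      have := hf.comp r.symm.injective.tendsto_cofinite
      simpa [Function.comp_def] using this
    have h3 := h2.sub_const L
    rw [sub_self] at h3
    refine h3.congr fun j => ?_
    have : (j : ℂ) + 1 ≠ 0 := Nat.cast_add_one_ne_zero j
    field_simp
  rw [map_sub, map_smul, h1, sub_eq_zero] at hz
  simpa using hz

end IsNormalizedPositiveTrace

end Traces

/-! ### Ranking a set by a function and its counting asymptotics -/

section Enumeration

open Filter Topology

/-- A function with finite sublevel sets on an infinite countable type can be enumerated in
nondecreasing order. -/
theorem exists_equiv_nat_of_finite_sublevel {ι : Type*} [Countable ι] [Infinite ι] (F : ι → ℝ)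
    (hfin : ∀ c, {i | F i ≤ c}.Finite) :
    ∃ r : ι ≃ ℕ, ∀ i, {j | F j < F i}.ncard ≤ r i ∧ r i + 1 ≤ {j | F j ≤ F i}.ncard := by
  obtain ⟨e, he⟩ := exists_injective_nat ι
  -- Ties are broken by the injection `e`; the rank of `i` is the number of its predecessors in the
  -- resulting strict linear order.
  let seg : ι → Set ι := fun i => {j | F j < F i ∨ (F j = F i ∧ e j < e i)}
  have hseg_sub : ∀ i, seg i ⊆ {j | F j ≤ F i} := by
    rintro i j (h | h)
    · exact h.le
    · exact h.1.le
  have hseg_fin : ∀ i, (seg i).Finite := fun i => (hfin (F i)).subset (hseg_sub i)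
  have hself : ∀ i, i ∉ seg i := by
    rintro i (h | h)
    · exact lt_irrefl _ h
    · exact lt_irrefl _ h.2
  have htrans : ∀ i j, j ∈ seg i → insert j (seg j) ⊆ seg i := by
    intro i j hj k hk
    rcases Set.mem_insert_iff.1 hk with rfl | hk
    · exact hj
    · rcases hj with hj | hj <;> rcases hk with hk | hk
      · exact Or.inl (hk.trans hj)
      · exact Or.inl (hk.1.trans_lt hj)
      · exact Or.inl (hk.trans_eq hj.1)
      · exact Or.inr ⟨hk.1.trans hj.1, hk.2.trans hj.2⟩
  have htri : ∀ i j, i ≠ j → i ∈ seg j ∨ j ∈ seg i := by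
    intro i j hij
    rcases lt_trichotomy (F i) (F j) with h | h | h
    · exact Or.inl (Or.inl h)
    · rcases lt_or_gt_of_ne (he.ne hij) with h' | h'
      · exact Or.inl (Or.inr ⟨h, h'⟩)
      · exact Or.inr (Or.inr ⟨h.symm, h'⟩)
    · exact Or.inr (Or.inl h)
  let r : ι → ℕ := fun i => (seg i).ncard
  have hmono : ∀ i j, j ∈ seg i → r j < r i := by
    intro i j hj
    have := Set.ncard_le_ncard (htrans i j hj) (hseg_fin i)
    rwa [Set.ncard_insert_of_notMem (hself j) (hseg_fin j)] at this
  have hinj : Function.Injective r := by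
    intro i j hij
    by_contra hne
    rcases htri i j hne with h | h
    · exact (hmono _ _ h).ne hij
    · exact (hmono _ _ h).ne' hij
  -- The predecessors of `i` are mapped injectively into a set with equally many elements, so no
  -- value below `r i` is skipped. As the range of `r` is infinite, `r` is onto.
  have himage : ∀ i, r '' seg i = Set.Iio (r i) := by
    intro i
    refine Set.eq_of_subset_of_ncard_le ?_ ?_ (Set.finite_Iio _)
    · rintro _ ⟨j, hj, rfl⟩; exact hmono i j hj
    · rw [Set.ncard_image_of_injective _ hinj, ← Finset.coe_Iio, Set.ncard_coe_finset, Nat.card_Iio]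
  have hsurj : Function.Surjective r := by
    intro m
    obtain ⟨_, ⟨i, rfl⟩, hi⟩ := (Set.infinite_range_of_injective hinj).exists_gt m
    have : m ∈ r '' seg i := by rw [himage]; exact hi
    obtain ⟨j, -, hj⟩ := this
    exact ⟨j, hj⟩
  refine ⟨Equiv.ofBijective r ⟨hinj, hsurj⟩, fun i => ⟨?_, ?_⟩⟩
  · exact Set.ncard_le_ncard (fun j hj => Or.inl hj) (hseg_fin i)
  · change (seg i).ncard + 1 ≤ _
    rw [← Set.ncard_insert_of_notMem (hself i) (hseg_fin i)]
    refine Set.ncard_le_ncard (Set.insert_subset ?_ (hseg_sub i)) (hfin _)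
    exact le_refl (F i)

/-- If the counting function of `F` is asymptotic to `L c`, then `F` can be enumerated so that the
rank of `i` is asymptotic to `L F(i)`. -/
theorem exists_equiv_nat_tendsto {ι : Type*} [Countable ι] [Infinite ι] (F : ι → ℝ)
    (hfin : ∀ c, {i | F i ≤ c}.Finite) {L : ℝ}
    (hN : Tendsto (fun c : ℝ => ({i | F i ≤ c}.ncard : ℝ) / c) atTop (𝓝 L)) :
    ∃ r : ι ≃ ℕ, Tendsto (fun i => ((r i : ℝ) + 1) / F i) cofinite (𝓝 L) := by
  obtain ⟨r, hr⟩ := exists_equiv_nat_of_finite_sublevel F hfin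
  refine ⟨r, ?_⟩
  have hF : Tendsto F cofinite atTop := by
    refine tendsto_atTop.2 fun c => ?_
    refine (hfin c).subset fun i hi => ?_
    have hi' : ¬ c ≤ F i := hi
    exact (not_le.1 hi').le
  have hpos : ∀ᶠ i in cofinite, 0 < F i := hF.eventually_gt_atTop 0
  refine tendsto_order.2 ⟨fun a ha => ?_, fun a ha => ?_⟩
  -- The hypothesis counts closed sublevel sets, but the lower bound for the rank counts only F j <
  -- F i. For q < 1 close to 1 the set F j ≤ q F i lies inside and has about q L F i elements.
  · have h1 : Tendsto (fun q : ℝ => q * L) (𝓝[<] 1) (𝓝 L) := by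
      have : Tendsto (fun q : ℝ => q * L) (𝓝 1) (𝓝 (1 * L)) := tendsto_id.mul_const L
      rw [one_mul] at this
      exact this.mono_left nhdsWithin_le_nhds
    obtain ⟨q, hq, hq1, hq0⟩ := ((h1.eventually_const_lt ha).and
      ((eventually_mem_nhdsWithin (s := Set.Iio (1 : ℝ)) (a := 1)).and
        (eventually_nhdsWithin_of_eventually_nhds (eventually_gt_nhds zero_lt_one)))).exists
    have h2 : Tendsto (fun i => q * (({j | F j ≤ q * F i}.ncard : ℝ) / (q * F i))) cofinite
        (𝓝 (q * L)) := (hN.comp (hF.const_mul_atTop hq0)).const_mul q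
    filter_upwards [h2.eventually_const_lt hq, hpos] with i hi hFi
    refine hi.trans_le ?_
    rw [mul_div_assoc', mul_div_mul_left _ _ hq0.ne']
    gcongr
    have h3 : {j | F j ≤ q * F i} ⊆ {j | F j < F i} := fun j hj => by
      have hq1' : q < 1 := hq1
      have : F j ≤ q * F i := hj
      exact this.trans_lt (by nlinarith)
    have h4 := (Set.ncard_le_ncard h3 ((hfin (F i)).subset fun j (hj : F j < F i) => hj.le)).trans (hr i).1
    have : ({j | F j ≤ q * F i}.ncard : ℝ) ≤ r i := by exact_mod_cast h4
    linarith
  · filter_upwards [(hN.comp hF).eventually_lt_const ha, hpos] with i hi hFi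
    refine lt_of_le_of_lt ?_ hi
    simp only [Function.comp_apply]
    gcongr
    exact_mod_cast (hr i).2

end Enumeration

/-! ### Lattice points in sublevel sets of homogeneous functions -/

section LatticeCount

open Filter Topology

variable {n : ℕ}

/-- The minimum of F over the unit sphere is a possible m. If the sphere is empty, the space is
zero. -/
theorem exists_le_of_homogeneous {E : Type*} [NormedAddCommGroup E] [NormedSpace ℝ E]
    [FiniteDimensional ℝ E] {F : E → ℝ} (hc : Continuous F)
    (hF : ∀ (x : E) ⦃r : ℝ⦄, 0 ≤ r → F (r • x) = r ^ n * F x) (hpos : ∀ x, x ≠ 0 → 0 < F x) :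
    ∃ m > 0, ∀ x, m * ‖x‖ ^ n ≤ F x ∨ x = 0 := by
  have hK : IsCompact (Metric.sphere (0 : E) 1) := isCompact_sphere _ _
  rcases (Metric.sphere (0 : E) 1).eq_empty_or_nonempty with h | h
  · refine ⟨1, one_pos, fun x => Or.inr ?_⟩
    by_contra hx
    have : ‖x‖⁻¹ • x ∈ Metric.sphere (0 : E) 1 := by
      simp [norm_smul, norm_ne_zero_iff.2 hx]
    rw [h] at this
    exact this
  · obtain ⟨y, hy, hmin⟩ := hK.exists_isMinOn h hc.continuousOn
    refine ⟨F y, hpos y (by rintro rfl; simp at hy), fun x => ?_⟩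
    by_cases hx : x = 0
    · exact Or.inr hx
    · left
      have hn : ‖x‖ ≠ 0 := norm_ne_zero_iff.2 hx
      have h1 : ‖x‖⁻¹ • x ∈ Metric.sphere (0 : E) 1 := by simp [norm_smul, hn]
      have h2 : F x = ‖x‖ ^ n * F (‖x‖⁻¹ • x) := by
        rw [← hF _ (norm_nonneg x), smul_inv_smul₀ hn]
      rw [h2, mul_comm]
      have : F y ≤ F (‖x‖⁻¹ • x) := hmin h1
      gcongr

theorem isBounded_sublevel_of_homogeneous (hn : n ≠ 0) {E : Type*} [NormedAddCommGroup E]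
    [NormedSpace ℝ E] [FiniteDimensional ℝ E] {F : E → ℝ} (hc : Continuous F)
    (hF : ∀ (x : E) ⦃r : ℝ⦄, 0 ≤ r → F (r • x) = r ^ n * F x) (hpos : ∀ x, x ≠ 0 → 0 < F x)
    (c : ℝ) : Bornology.IsBounded {x | F x ≤ c} := by
  obtain ⟨m, hm, h⟩ := exists_le_of_homogeneous hc hF hpos
  refine (Metric.isBounded_closedBall (x := (0 : E)) (r := max 1 (c / m))).subset fun x hx => ?_
  rw [mem_closedBall_zero_iff]
  rcases h x with h | rfl
  · rcases le_total ‖x‖ 1 with h1 | h1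
    · exact h1.trans (le_max_left _ _)
    · refine le_trans ?_ (le_max_right _ _)
      rw [le_div_iff₀ hm, mul_comm]
      refine le_trans ?_ (h.trans hx)
      gcongr
      exact le_self_pow₀ h1 hn
  · simp

/-- Distinct level sets are disjoint, so only countably many have positive measure and some level c
> 0 is null. Dilation by c^(1/n) carries the level 1 into it. -/
theorem measure_level_of_homogeneous {E : Type*} [NormedAddCommGroup E]
    [NormedSpace ℝ E] [FiniteDimensional ℝ E] [MeasurableSpace E] [BorelSpace E] (μ : Measure E)
    [μ.IsAddHaarMeasure] (hn : n ≠ 0) {F : E → ℝ} (hc : Continuous F)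
    (hF : ∀ (x : E) ⦃r : ℝ⦄, 0 ≤ r → F (r • x) = r ^ n * F x) : μ {x | F x = 1} = 0 := by
  have hcount := Measure.countable_meas_level_set_pos (μ := μ) hc.measurable
  obtain ⟨c, hc0, hcz⟩ : ∃ c : ℝ, 0 < c ∧ μ {x | F x = c} = 0 := by
    by_contra! hcon
    have : Set.Ioi (0 : ℝ) ⊆ {t | 0 < μ {x | F x = t}} := fun t ht => pos_iff_ne_zero.2 (hcon t ht)
    have h0 := (hcount.mono this).measure_zero volume
    simp at h0
  obtain ⟨s, hs0, hsn⟩ : ∃ s : ℝ, 0 < s ∧ s ^ n = c :=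
    ⟨c ^ ((n : ℝ)⁻¹), Real.rpow_pos_of_pos hc0 _, Real.rpow_inv_natCast_pow hc0.le hn⟩
  have : {x | F x = 1} ⊆ (fun x => s • x) ⁻¹' {x | F x = c} := by
    intro x hx
    simp only [Set.mem_preimage, Set.mem_ofPred_eq] at hx ⊢
    rw [hF _ hs0.le, hx, hsn, mul_one]
  refine measure_mono_null this ?_
  rw [Measure.addHaar_preimage_smul _ hs0.ne', hcz, mul_zero]

theorem finite_lattice_sublevel (hn : n ≠ 0) {F : EuclideanSpace ℝ (Fin n) → ℝ} (hc : Continuous F)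
    (hF : ∀ (x : EuclideanSpace ℝ (Fin n)) ⦃r : ℝ⦄, 0 ≤ r → F (r • x) = r ^ n * F x)
    (hpos : ∀ x, x ≠ 0 → 0 < F x) (c : ℝ) : {k : Fin n → ℤ | F (latticePt k) ≤ c}.Finite := by
  obtain ⟨R, hR⟩ := (isBounded_sublevel_of_homogeneous hn hc hF hpos c).exists_norm_le
  refine (Set.finite_Icc (fun _ : Fin n => -⌈R⌉) (fun _ => ⌈R⌉)).subset fun k hk => ?_
  have h1 : ∀ j, |k j| ≤ ⌈R⌉ := fun j => by
    have h2 : ‖latticePt k j‖ ≤ R := (PiLp.norm_apply_le (latticePt k) j).trans (hR _ hk)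
    have h3 : ((|k j| : ℤ) : ℝ) ≤ R := by simpa [latticePt] using h2
    exact_mod_cast h3.trans (Int.le_ceil R)
  exact ⟨fun j => (abs_le.1 (h1 j)).1, fun j => (abs_le.1 (h1 j)).2⟩

theorem covolume_span_basisFun :
    ZLattice.covolume (Submodule.span ℤ (Set.range (Pi.basisFun ℝ (Fin n)))) volume = 1 := by
  have h := ZLattice.covolume_eq_measure_fundamentalDomain
    (Submodule.span ℤ (Set.range (Pi.basisFun ℝ (Fin n)))) volume
    (ZSpan.isAddFundamentalDomain (Pi.basisFun ℝ (Fin n)) volume)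
  rw [h, ZSpan.volume_real_fundamentalDomain]
  have : Matrix.of (Pi.basisFun ℝ (Fin n)) = 1 := by
    ext i j; simp [Matrix.one_apply, Pi.single_apply, eq_comm]
  rw [this]; simp

/-- The sublevel sets are dilates of {F ≤ 1}, which is bounded with null boundary, so the count of
lattice points is asymptotic to the volume over the covolume 1. The count takes place in `Fin n →
ℝ`; passing to the Euclidean space preserves volume. -/
theorem tendsto_lattice_count (hn : n ≠ 0) {F : EuclideanSpace ℝ (Fin n) → ℝ} (hc : Continuous F)
    (hF : ∀ (x : EuclideanSpace ℝ (Fin n)) ⦃r : ℝ⦄, 0 ≤ r → F (r • x) = r ^ n * F x)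
    (hpos : ∀ x, x ≠ 0 → 0 < F x) :
    Tendsto (fun c : ℝ => ({k : Fin n → ℤ | F (latticePt k) ≤ c}.ncard : ℝ) / c) atTop
      (𝓝 (volume.real {x | F x ≤ 1})) := by
  have : Nonempty (Fin n) := ⟨⟨0, Nat.pos_of_ne_zero hn⟩⟩
  let G : (Fin n → ℝ) → ℝ := fun x => F (WithLp.toLp 2 x)
  have hGc : Continuous G := hc.comp (PiLp.continuous_toLp 2 _)
  have hG : ∀ (x : Fin n → ℝ) ⦃r : ℝ⦄, 0 ≤ r → G (r • x) = r ^ n * G x := fun x r hr => by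
    simp only [G, WithLp.toLp_smul, hF _ hr]
  have hGpos : ∀ x, x ≠ 0 → 0 < G x := fun x hx => hpos _ (by simpa using hx)
  let L := Submodule.span ℤ (Set.range (Pi.basisFun ℝ (Fin n)))
  have key := ZLattice.covolume.tendsto_card_le_div L (X := Set.univ) (F := G) (by simp)
    (by simpa using hG)
    (by simpa using isBounded_sublevel_of_homogeneous hn hGc hG hGpos 1)
    (by simpa using (isClosed_le hGc continuous_const).measurableSet)
    (by
      simp only [Set.mem_univ, true_and]
      exact measure_mono_null (frontier_le_subset_eq hGc continuous_const)
        (measure_level_of_homogeneous volume hn hGc hG))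
  rw [covolume_span_basisFun, div_one] at key
  have hvol : volume.real {x | x ∈ Set.univ ∧ G x ≤ 1} = volume.real {x | F x ≤ 1} := by
    simp only [Set.mem_univ, true_and, measureReal_def]
    congr 1
    exact (PiLp.volume_preserving_toLp (Fin n)).measure_preimage
      (isClosed_le hc continuous_const).measurableSet.nullMeasurableSet
  rw [hvol] at key
  refine key.congr fun c => ?_
  congr 2
  rw [← Nat.card_coe_set_eq]
  refine (Nat.card_congr (Equiv.ofBijective
    (fun k : {k : Fin n → ℤ | F (latticePt k) ≤ c} =>
      (⟨fun j => ((k : Fin n → ℤ) j : ℝ), ⟨Set.mem_univ _, k.2⟩, by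
        rw [SetLike.mem_coe, (Pi.basisFun ℝ (Fin n)).mem_span_iff_repr_mem ℤ]
        exact fun i => ⟨(k : Fin n → ℤ) i, by simp⟩⟩ :
        ((({x | x ∈ Set.univ ∧ G x ≤ c} ∩ L : Set (Fin n → ℝ)) : Set (Fin n → ℝ)) : Type)))
    ⟨?_, ?_⟩)).symm
  · intro k l hkl
    refine Subtype.ext (funext fun j => ?_)
    have : ((k : Fin n → ℤ) j : ℝ) = ((l : Fin n → ℤ) j : ℝ) :=
      congrFun (congrArg Subtype.val hkl) j
    exact_mod_cast this
  · rintro ⟨x, ⟨-, hx⟩, hxL⟩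
    rw [SetLike.mem_coe, (Pi.basisFun ℝ (Fin n)).mem_span_iff_repr_mem ℤ] at hxL
    choose k hk using hxL
    have hk' : (fun j => (k j : ℝ)) = x := funext fun j => by simpa using hk j
    refine ⟨⟨k, ?_⟩, Subtype.ext hk'⟩
    change F (WithLp.toLp 2 fun j => (k j : ℝ)) ≤ c
    rw [hk']; exact hx

/-- Polar coordinates: in the direction ω the region extends to the radius R = F(ω)^(-1/n), and ∫
t^(n-1) dt over (0, R) is Rⁿ/n = F(ω)⁻¹/n. -/
theorem volume_sublevel_of_homogeneous (hn : n ≠ 0) {F : EuclideanSpace ℝ (Fin n) → ℝ}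
    (hc : Continuous F)
    (hF : ∀ (x : EuclideanSpace ℝ (Fin n)) ⦃r : ℝ⦄, 0 ≤ r → F (r • x) = r ^ n * F x)
    (hpos : ∀ x, x ≠ 0 → 0 < F x) :
    volume.real {x | F x ≤ 1} =
      (1 / (n : ℝ)) * ∫ ω : Metric.sphere (0 : EuclideanSpace ℝ (Fin n)) 1, (F ω)⁻¹
        ∂(volume.toSphere) := by
  have hdim : Module.finrank ℝ (EuclideanSpace ℝ (Fin n)) = n := by simp
  have hsph : ∀ ω : Metric.sphere (0 : EuclideanSpace ℝ (Fin n)) 1,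
      0 < F (ω : EuclideanSpace ℝ (Fin n)) := fun ω => hpos _ (ne_zero_of_mem_unit_sphere ω)
  have hF0 : F 0 = 0 := by
    have := hF 0 (le_refl (0 : ℝ))
    rwa [smul_zero, zero_pow hn, zero_mul] at this
  have : Nonempty (Fin n) := ⟨⟨0, Nat.pos_of_ne_zero hn⟩⟩
  have : Nontrivial (EuclideanSpace ℝ (Fin n)) :=
    Module.nontrivial_of_finrank_pos (R := ℝ) (by rw [hdim]; exact Nat.pos_of_ne_zero hn)
  -- Polar coordinates omit the origin, and the strict inequality turns the radial slices into the
  -- intervals `Iio`. Both changes are null.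
  have h1 : volume {x | F x ≤ 1} = volume ({x | F x < 1} \ {0}) := by
    have hU : {x | F x ≤ 1} = {x | F x < 1} ∪ {x | F x = 1} := by
      ext x; exact le_iff_lt_or_eq (a := F x) (b := 1)
    rw [measure_sdiff_null (measure_singleton _), hU]
    refine le_antisymm ((measure_union_le _ _).trans ?_) (measure_mono Set.subset_union_left)
    rw [measure_level_of_homogeneous volume hn hc hF, add_zero]
  let B : Set (Metric.sphere (0 : EuclideanSpace ℝ (Fin n)) 1 × Set.Ioi (0 : ℝ)) :=
    {p | (p.2 : ℝ) ^ n * F (p.1 : EuclideanSpace ℝ (Fin n)) < 1}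
  have hBo : IsOpen B := isOpen_lt (by fun_prop) continuous_const
  have h2 : volume ({x | F x < 1} \ {0}) =
      (volume.toSphere.prod (Measure.volumeIoiPow (n - 1))) B := by
    have hmp := Measure.measurePreserving_homeomorphUnitSphereProd
      (volume : Measure (EuclideanSpace ℝ (Fin n)))
    rw [hdim] at hmp
    rw [← hmp.measure_preimage hBo.measurableSet.nullMeasurableSet,
      comap_subtype_coe_apply (measurableSet_singleton _).compl]
    congr 1
    ext x
    simp only [Set.mem_sdiff, Set.mem_ofPred_eq, Set.mem_singleton_iff, Set.mem_image,
      Set.mem_preimage, Subtype.exists, exists_and_right, exists_eq_right, B]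
    have hval : ∀ hx : x ≠ 0, ‖x‖ ^ n * F (‖x‖⁻¹ • x) = F x := fun hx => by
      rw [← hF _ (norm_nonneg x), smul_inv_smul₀ (norm_ne_zero_iff.2 hx)]
    constructor
    · rintro ⟨h, hx⟩
      refine ⟨hx, ?_⟩
      simpa [homeomorphUnitSphereProd, hval hx] using h
    · rintro ⟨hx, h⟩
      refine ⟨?_, hx⟩
      simpa [homeomorphUnitSphereProd, hval hx] using h
  have h3 : (volume.toSphere.prod (Measure.volumeIoiPow (n - 1))) B =
      ∫⁻ ω : Metric.sphere (0 : EuclideanSpace ℝ (Fin n)) 1,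
        ENNReal.ofReal ((1 / (n : ℝ)) * (F ω)⁻¹) ∂(volume.toSphere) := by
    rw [Measure.prod_apply hBo.measurableSet]
    refine lintegral_congr fun ω => ?_
    have hω := hsph ω
    have hs : 0 < ((F ω)⁻¹ : ℝ) ^ ((n : ℝ)⁻¹) := Real.rpow_pos_of_pos (inv_pos.2 hω) _
    have hsn : (((F ω)⁻¹ : ℝ) ^ ((n : ℝ)⁻¹)) ^ n = (F ω)⁻¹ :=
      Real.rpow_inv_natCast_pow (inv_pos.2 hω).le hn
    have hset : Prod.mk ω ⁻¹' B = Set.Iio (⟨_, hs⟩ : Set.Ioi (0 : ℝ)) := by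
      ext t
      have ht : (0 : ℝ) < t := t.2
      simp only [Set.mem_preimage, Set.mem_ofPred_eq, Set.mem_Iio, B, ← Subtype.coe_lt_coe]
      rw [← pow_lt_pow_iff_left₀ ht.le hs.le hn, hsn, ← one_div, lt_div_iff₀ hω]
    rw [hset, Measure.volumeIoiPow_apply_Iio]
    congr 1
    have hn1 : n - 1 + 1 = n := Nat.sub_add_cancel (Nat.pos_of_ne_zero hn)
    have hn2 : ((n - 1 : ℕ) : ℝ) + 1 = n := by exact_mod_cast hn1
    rw [hn1, hn2, hsn]
    ring
  rw [measureReal_def, h1, h2, h3, ← integral_const_mul,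
    integral_eq_lintegral_of_nonneg_ae]
  · exact Filter.Eventually.of_forall fun ω => by
      have := hsph ω
      positivity
  · refine Continuous.aestronglyMeasurable ?_
    exact continuous_const.mul ((hc.comp continuous_subtype_val).inv₀ fun ω => (hsph ω).ne')

/-- A positive continuous function on `ℝⁿ ∖ 0`, homogeneous of degree `-n`, can be enumerated over
the lattice so that `(rank + 1) g` tends to the mean of `g` over the sphere. -/
theorem exists_lattice_enumeration (hn : n ≠ 0) {g : EuclideanSpace ℝ (Fin n) → ℝ}
    (hc : ContinuousOn g {0}ᶜ)
    (hg : ∀ (x : EuclideanSpace ℝ (Fin n)) (r : ℝ), 0 < r → x ≠ 0 → g (r • x) = (r ^ n)⁻¹ * g x)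
    (hpos : ∀ x, x ≠ 0 → 0 < g x) :
    ∃ r : (Fin n → ℤ) ≃ ℕ, Tendsto (fun k => ((r k : ℝ) + 1) * g (latticePt k)) cofinite
      (𝓝 ((1 / (n : ℝ)) * ∫ ω : Metric.sphere (0 : EuclideanSpace ℝ (Fin n)) 1, g ω
        ∂(volume.toSphere))) := by
  classical
  -- The reciprocal of g is homogeneous of degree n and extends continuously by 0 to the origin;
  -- decreasing g means increasing F.
  let F : EuclideanSpace ℝ (Fin n) → ℝ := fun x => if x = 0 then 0 else (g x)⁻¹
  have hF0 : F 0 = 0 := if_pos rfl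
  have hFx : ∀ x, x ≠ 0 → F x = (g x)⁻¹ := fun x hx => if_neg hx
  have hF : ∀ (x : EuclideanSpace ℝ (Fin n)) ⦃r : ℝ⦄, 0 ≤ r → F (r • x) = r ^ n * F x := by
    intro x r hr
    rcases hr.eq_or_lt with rfl | hr
    · rw [zero_smul, hF0, zero_pow hn, zero_mul]
    · by_cases hx : x = 0
      · rw [hx, smul_zero, hF0, mul_zero]
      · rw [hFx _ hx, hFx _ (smul_ne_zero hr.ne' hx), hg x r hr hx, mul_inv, inv_inv]
  have hFpos : ∀ x, x ≠ 0 → 0 < F x := fun x hx => by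
    rw [hFx x hx]; exact inv_pos.2 (hpos x hx)
  have hcont : ContinuousOn F {0}ᶜ :=
    (hc.inv₀ fun x hx => (hpos x hx).ne').congr fun x hx => hFx x hx
  have hFc : Continuous F := by
    rw [continuous_iff_continuousAt]
    intro x
    by_cases hx : x = 0
    · subst hx
      obtain ⟨M, hM⟩ := (isCompact_sphere (0 : EuclideanSpace ℝ (Fin n)) 1).exists_bound_of_continuousOn
        (hcont.mono fun x hx => by rintro rfl; simp at hx)
      have hbd : ∀ x, ‖F x‖ ≤ ‖x‖ ^ n * M := by
        intro x
        by_cases hx : x = 0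
        · subst hx; simp [hF0, zero_pow hn]
        · have hn' : ‖x‖ ≠ 0 := norm_ne_zero_iff.2 hx
          have h1 : F x = ‖x‖ ^ n * F (‖x‖⁻¹ • x) := by
            rw [← hF _ (norm_nonneg x), smul_inv_smul₀ hn']
          rw [h1, norm_mul, norm_pow, norm_norm]
          gcongr
          exact hM _ (by simp [norm_smul, hn'])
      rw [ContinuousAt, hF0]
      refine squeeze_zero_norm hbd ?_
      have : Tendsto (fun x : EuclideanSpace ℝ (Fin n) => ‖x‖ ^ n * M) (𝓝 0)
          (𝓝 (‖(0 : EuclideanSpace ℝ (Fin n))‖ ^ n * M)) :=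
        Continuous.tendsto (by fun_prop) 0
      simpa [zero_pow hn] using this
    · exact hcont.continuousAt (isOpen_compl_singleton.mem_nhds hx)
  have : Nonempty (Fin n) := ⟨⟨0, Nat.pos_of_ne_zero hn⟩⟩
  obtain ⟨r, hr⟩ := exists_equiv_nat_tendsto (fun k : Fin n → ℤ => F (latticePt k))
    (finite_lattice_sublevel hn hFc hF hFpos) (tendsto_lattice_count hn hFc hF hFpos)
  refine ⟨r, ?_⟩
  rw [volume_sublevel_of_homogeneous hn hFc hF hFpos] at hr
  have hint : ∀ ω : Metric.sphere (0 : EuclideanSpace ℝ (Fin n)) 1,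
      (F (ω : EuclideanSpace ℝ (Fin n)))⁻¹ = g ω := fun ω => by
    rw [hFx _ (ne_zero_of_mem_unit_sphere ω), inv_inv]
  simp only [hint] at hr
  refine hr.congr' ?_
  filter_upwards [(Set.finite_singleton (0 : Fin n → ℤ)).compl_mem_cofinite] with k hk
  have hk0 : latticePt k ≠ 0 := by
    intro h
    refine hk (funext fun j => ?_)
    have : latticePt k j = 0 := by rw [h]; rfl
    simpa [latticePt] using this
  rw [hFx _ hk0, div_inv_eq_mul]

end LatticeCount

/-! ### Weights and phase relations of the monomials U^k -/

section Structure

open Filter Topology ComplexConjugate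

variable {n : ℕ} {θ : Matrix (Fin n) (Fin n) ℝ}

/-- `e^{i s·k}`. -/
def phase (s : EuclideanSpace ℝ (Fin n)) (k : Fin n → ℤ) : ℂ :=
  Complex.exp (Complex.I * ((∑ j, s j * k j : ℝ) : ℂ))

theorem phase_zero (s : EuclideanSpace ℝ (Fin n)) : phase s 0 = 1 := by simp [phase]

theorem phase_add (s : EuclideanSpace ℝ (Fin n)) (k l : Fin n → ℤ) :
    phase s (k + l) = phase s k * phase s l := by
  rw [phase, phase, phase, ← Complex.exp_add, ← mul_add, ← Complex.ofReal_add,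
    ← Finset.sum_add_distrib]
  simp [mul_add]

theorem phase_neg (s : EuclideanSpace ℝ (Fin n)) (k : Fin n → ℤ) :
    phase s (-k) = conj (phase s k) := by
  rw [phase, phase, ← Complex.exp_conj]
  simp

theorem norm_phase (s : EuclideanSpace ℝ (Fin n)) (k : Fin n → ℤ) : ‖phase s k‖ = 1 := by
  rw [phase, mul_comm]; exact Complex.norm_exp_ofReal_mul_I _

theorem phase_single (s : EuclideanSpace ℝ (Fin n)) (j : Fin n) :
    phase s (Pi.single j 1) = Complex.exp (Complex.I * s j) := by
  rw [phase]
  congr 3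
  rw [Finset.sum_eq_single j]
  · simp
  · intro i _ hi; simp [hi]
  · simp

theorem exists_phase_ne_one {k : Fin n → ℤ} (hk : k ≠ 0) :
    ∃ s : EuclideanSpace ℝ (Fin n), phase s k ≠ 1 := by
  obtain ⟨j, hj⟩ := Function.ne_iff.1 hk
  refine ⟨EuclideanSpace.single j (Real.pi / k j), ?_⟩
  have hj' : (k j : ℝ) ≠ 0 := by exact_mod_cast hj
  have : (∑ i, (EuclideanSpace.single j (Real.pi / k j) : EuclideanSpace ℝ (Fin n)) i * k i : ℝ) =
      Real.pi := by
    rw [Finset.sum_eq_single j]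
    · simp [hj']
    · intro i _ hi; simp [hi]
    · simp
  rw [phase, this, mul_comm, Complex.exp_pi_mul_I]
  norm_num

/-- The action of `ℝⁿ` on `A_θ` by star automorphisms. -/
def actionHom (θ : Matrix (Fin n) (Fin n) ℝ) (s : EuclideanSpace ℝ (Fin n)) :
    ncTorus θ →⋆ₐ[ℂ] ncTorus θ where
  toFun := torusAction θ s
  map_one' := Subtype.ext (map_one (Unitary.conjStarAlgAut ℂ (BL2 n) (transV s)))
  map_mul' _ _ := Subtype.ext (map_mul (Unitary.conjStarAlgAut ℂ (BL2 n) (transV s)) _ _)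
  map_zero' := Subtype.ext (map_zero (Unitary.conjStarAlgAut ℂ (BL2 n) (transV s)))
  map_add' _ _ := Subtype.ext (map_add (Unitary.conjStarAlgAut ℂ (BL2 n) (transV s)) _ _)
  commutes' c := Subtype.ext
    (AlgHomClass.commutes (Unitary.conjStarAlgAut ℂ (BL2 n) (transV s)) c)
  map_star' _ := Subtype.ext (map_star (Unitary.conjStarAlgAut ℂ (BL2 n) (transV s)) _)

theorem actionHom_apply (s : EuclideanSpace ℝ (Fin n)) (u : ncTorus θ) :
    actionHom θ s u = torusAction θ s u := rfl

/-- `u` has weight `k` under the action of `ℝⁿ`. -/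
def HasWeight (u : ncTorus θ) (k : Fin n → ℤ) : Prop :=
  ∀ s, actionHom θ s u = phase s k • u

namespace HasWeight

variable {u v : ncTorus θ} {k l : Fin n → ℤ}

theorem one : HasWeight (1 : ncTorus θ) 0 := fun s => by rw [map_one, phase_zero, one_smul]

theorem mul (hu : HasWeight u k) (hv : HasWeight v l) : HasWeight (u * v) (k + l) := fun s => by
  rw [map_mul, hu s, hv s, phase_add, smul_mul_smul_comm]

theorem adjoint (hu : HasWeight u k) : HasWeight (star u) (-k) := fun s => by
  rw [map_star, hu s, star_smul, phase_neg]; rfl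

end HasWeight

theorem hasWeight_ncU (j : Fin n) :
    HasWeight (ncU θ j : ncTorus θ) (Pi.single j 1) := by
  intro s
  refine Subtype.ext ?_
  change (transV s : BL2 n) * (genU θ j : BL2 n) * star (transV s : BL2 n) =
    phase s (Pi.single j 1) • (genU θ j : BL2 n)
  rw [transV_mul_genU, smul_mul_assoc, mul_assoc, Unitary.mul_star_self_of_mem (transV s).2,
    mul_one, phase_single]

/-- A relation between unitaries of `A_θ` and elements of `ℤⁿ` that is compatible with the group
structures and holds at the generators holds at the monomials. -/
theorem ncMonomial_mem_of_subgroup (K : Subgroup (unitary (ncTorus θ) × Multiplicative (Fin n → ℤ)))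
    (h : ∀ j, (ncU θ j, Multiplicative.ofAdd (Pi.single j 1)) ∈ K) (k : Fin n → ℤ) :
    (ncMonomial θ k, Multiplicative.ofAdd k) ∈ K := by
  -- The product that defines `ncMonomial`, formed in the product group: its components are U^k and
  -- k.
  have h1 : (List.ofFn fun j => (ncU θ j, Multiplicative.ofAdd (Pi.single j (1 : ℤ))) ^ k j).prod ∈ K :=
    Subgroup.list_prod_mem K fun x hx => by
      obtain ⟨j, rfl⟩ := (List.mem_ofFn' _ _).1 hx
      exact K.zpow_mem (h j) _
  convert h1 using 1
  refine Prod.ext ?_ ?_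
  · rw [← MonoidHom.coe_fst, map_list_prod, List.map_ofFn]
    rfl
  · rw [← MonoidHom.coe_snd, map_list_prod, List.map_ofFn, List.prod_ofFn]
    change Multiplicative.ofAdd k = ∏ j, Multiplicative.ofAdd (Pi.single j (1 : ℤ)) ^ k j
    simp only [← ofAdd_zsmul, ← ofAdd_sum]
    congr 1
    ext i
    simp [Finset.sum_apply, Pi.single_apply]

theorem hasWeight_ncMonomial (k : Fin n → ℤ) : HasWeight (ncMonomial θ k : ncTorus θ) k := by
  let K : Subgroup (unitary (ncTorus θ) × Multiplicative (Fin n → ℤ)) :=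
    { carrier := {p | HasWeight (p.1 : ncTorus θ) p.2.toAdd}
      mul_mem' := fun ha hb => HasWeight.mul ha hb
      one_mem' := HasWeight.one
      inv_mem' := fun ha => HasWeight.adjoint ha }
  exact ncMonomial_mem_of_subgroup K (fun j => hasWeight_ncU j) k

/-- The character `x ↦ e^{i k·x}` of the torus. -/
def torusChar (k : Fin n → ℤ) : C(Torus n, Circle) := ∏ j, coordChar j ^ k j

theorem torusChar_add (k l : Fin n → ℤ) : torusChar (k + l) = torusChar k * torusChar l := by
  simp [torusChar, zpow_add, Finset.prod_mul_distrib]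

theorem torusChar_comp_add (k : Fin n → ℤ) (a : Torus n) :
    (torusChar k).comp ⟨fun x => x + a, by fun_prop⟩ =
      ContinuousMap.const _ (torusChar k a) * torusChar k := by
  ext1 x
  simp only [torusChar, ContinuousMap.comp_apply, ContinuousMap.coe_mk, ContinuousMap.mul_apply,
    ContinuousMap.const_apply, ContinuousMap.coe_prod, Finset.prod_apply, ContinuousMap.coe_zpow,
    Pi.pow_apply, coordChar, Pi.add_apply, AddCircle.toCircle_add]
  rw [← Finset.prod_mul_distrib]
  exact Finset.prod_congr rfl fun j _ => by rw [mul_comm, mul_zpow, mul_comm]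

theorem mulCircle_const (c : Circle) (f : L2Torus n) :
    mulCircleₗᵢ (ContinuousMap.const _ c) f = (c : ℂ) • f := by
  apply Lp.ext
  refine (coeFn_mulCircle _ _).trans ?_
  filter_upwards [Lp.coeFn_smul (c : ℂ) f] with x hx
  rw [hx]; rfl

/-- The translation vector `π θ k`. -/
def shiftVec (θ : Matrix (Fin n) (Fin n) ℝ) (k : Fin n → ℤ) : Torus n :=
  torusPt fun l => ∑ j, Real.pi * θ l j * k j

theorem shiftVec_add (k l : Fin n → ℤ) : shiftVec θ (k + l) = shiftVec θ k + shiftVec θ l := by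
  ext1 i
  simp only [shiftVec, torusPt, Pi.add_apply]
  rw [← AddCircle.coe_add, ← Finset.sum_add_distrib]
  congr 2
  simp [mul_add]

/-- `u` is a multiple of the unitary `f ↦ e^{i k·x} f(x + π θ k)`. -/
def IsPhaseOf (u : BL2 n) (θ : Matrix (Fin n) (Fin n) ℝ) (k : Fin n → ℤ) : Prop :=
  ∃ c : Circle, ∀ f, u f = (c : ℂ) • mulCircleₗᵢ (torusChar k) (translateₗᵢ (shiftVec θ k) f)

/-- Moving the translation of the first factor past the character of the second produces only the
constant `torusChar l (shiftVec θ k)`. -/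
theorem IsPhaseOf.mul {u v : BL2 n} {k l : Fin n → ℤ} (hu : IsPhaseOf u θ k)
    (hv : IsPhaseOf v θ l) : IsPhaseOf (u * v) θ (k + l) := by
  obtain ⟨c, hc⟩ := hu
  obtain ⟨d, hd⟩ := hv
  refine ⟨c * (torusChar l (shiftVec θ k) * d), fun f => ?_⟩
  change u (v f) = _
  rw [hd, map_smul, hc, translate_mulCircle, torusChar_comp_add, translate_translate,
    ← mulCircle_mulCircle, mulCircle_const, map_smul, mulCircle_mulCircle, ← torusChar_add,
    ← shiftVec_add, smul_smul, smul_smul]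
  congr 1
  push_cast
  ring

theorem isPhaseOf_one : IsPhaseOf (1 : BL2 n) θ 0 := by
  refine ⟨1, fun f => ?_⟩
  have h1 : torusChar (0 : Fin n → ℤ) = 1 := by simp [torusChar]
  have h2 : shiftVec θ 0 = 0 := by
    ext1 i; simp [shiftVec, torusPt]
  rw [h1, h2, translate_zero, mulCircle_one]
  simp

theorem isPhaseOf_ncU (j : Fin n) : IsPhaseOf (genU θ j : BL2 n) θ (Pi.single j 1) := by
  refine ⟨1, fun f => ?_⟩
  have h1 : torusChar (Pi.single j (1 : ℤ)) = coordChar j := by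
    rw [torusChar, Finset.prod_eq_single j]
    · simp
    · intro i _ hi; simp [hi]
    · simp
  have h2 : shiftVec θ (Pi.single j 1) = torusPt fun l => Real.pi * θ l j := by
    rw [shiftVec]
    congr 1
    ext l
    rw [Finset.sum_eq_single j]
    · simp
    · intro i _ hi; simp [hi]
    · simp
  rw [h1, h2, genU_apply]
  simp

/-- This identifies products and adjoints of monomials up to a phase, without computing the cocycle.
-/
theorem IsPhaseOf.eq_smul {u v : BL2 n} {k : Fin n → ℤ} (hu : IsPhaseOf u θ k)
    (hv : IsPhaseOf v θ k) : ∃ c : Circle, u = (c : ℂ) • v := by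
  obtain ⟨c, hc⟩ := hu
  obtain ⟨d, hd⟩ := hv
  refine ⟨c * d⁻¹, ?_⟩
  ext1 f
  rw [smul_apply, hc, hd, smul_smul]
  congr 1
  simp

theorem IsPhaseOf.smul {u : BL2 n} {k : Fin n → ℤ} (hu : IsPhaseOf u θ k) (c : Circle) :
    IsPhaseOf ((c : ℂ) • u) θ k := by
  obtain ⟨d, hd⟩ := hu
  exact ⟨c * d, fun f => by rw [smul_apply, hd, smul_smul]; simp⟩

/-- The operator `w` of index -k, multiplied by u, has index 0 and is thus a phase c; so w = c u*.
-/
theorem IsPhaseOf.adjoint {u : unitary (BL2 n)} {k : Fin n → ℤ} (hu : IsPhaseOf (u : BL2 n) θ k) :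
    IsPhaseOf (star (u : BL2 n)) θ (-k) := by
  let w : L2Torus n →L[ℂ] L2Torus n := (mulCircleₗᵢ (torusChar (-k))).toContinuousLinearMap ∘L
    (translateₗᵢ (shiftVec θ (-k))).toContinuousLinearMap
  have hw : IsPhaseOf w θ (-k) := ⟨1, fun f => by simp [w]⟩
  have h := hw.mul hu
  rw [neg_add_cancel] at h
  obtain ⟨c, hc⟩ := h.eq_smul isPhaseOf_one
  have h2 : star (u : BL2 n) = ((c⁻¹ : Circle) : ℂ) • w := by
    have h3 : w = (c : ℂ) • star (u : BL2 n) := by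
      calc w = w * ((u : BL2 n) * star (u : BL2 n)) := by
            rw [Unitary.mul_star_self_of_mem u.2, mul_one]
        _ = (c : ℂ) • star (u : BL2 n) := by
            rw [← mul_assoc, hc, smul_mul_assoc, one_mul]
    rw [h3, smul_smul]
    simp
  rw [h2]
  exact hw.smul _

theorem isPhaseOf_ncMonomial (k : Fin n → ℤ) :
    IsPhaseOf ((ncMonomial θ k : ncTorus θ) : BL2 n) θ k := by
  let K : Subgroup (unitary (ncTorus θ) × Multiplicative (Fin n → ℤ)) :=
    { carrier := {p | IsPhaseOf ((p.1 : ncTorus θ) : BL2 n) θ p.2.toAdd}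
      mul_mem' := fun ha hb => IsPhaseOf.mul ha hb
      one_mem' := isPhaseOf_one
      inv_mem' := fun {p} ha => IsPhaseOf.adjoint
        (u := ⟨((p.1 : ncTorus θ) : BL2 n), Unitary.mem_iff.2
          ⟨congrArg Subtype.val (Unitary.coe_star_mul_self p.1),
            congrArg Subtype.val (Unitary.coe_mul_star_self p.1)⟩⟩) ha }
  exact ncMonomial_mem_of_subgroup K (fun j => isPhaseOf_ncU j) k

theorem ncMonomial_zero : (ncMonomial θ 0 : ncTorus θ) = 1 := by
  simp [ncMonomial]

theorem exists_ncMonomial_mul (k l : Fin n → ℤ) : ∃ c : Circle,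
    (ncMonomial θ k * ncMonomial θ l : ncTorus θ) = (c : ℂ) • (ncMonomial θ (k + l) : ncTorus θ) := by
  obtain ⟨c, hc⟩ := ((isPhaseOf_ncMonomial (θ := θ) k).mul (isPhaseOf_ncMonomial l)).eq_smul
    (isPhaseOf_ncMonomial (k + l))
  exact ⟨c, Subtype.ext hc⟩

theorem exists_star_ncMonomial (k : Fin n → ℤ) : ∃ c : Circle,
    star (ncMonomial θ k : ncTorus θ) = (c : ℂ) • (ncMonomial θ (-k) : ncTorus θ) := by
  obtain ⟨c, hc⟩ := (IsPhaseOf.adjoint (u := ⟨((ncMonomial θ k : ncTorus θ) : BL2 n), Unitary.mem_iff.2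
          ⟨congrArg Subtype.val (Unitary.coe_star_mul_self (ncMonomial θ k)),
            congrArg Subtype.val (Unitary.coe_mul_star_self (ncMonomial θ k))⟩⟩)
    (isPhaseOf_ncMonomial k)).eq_smul (isPhaseOf_ncMonomial (-k))
  exact ⟨c, Subtype.ext hc⟩

theorem ncMonomial_single (j : Fin n) :
    ∃ c : Circle, (ncU θ j : ncTorus θ) = (c : ℂ) • (ncMonomial θ (Pi.single j 1) : ncTorus θ) := by
  obtain ⟨c, hc⟩ := (isPhaseOf_ncU (θ := θ) j).eq_smul (isPhaseOf_ncMonomial (Pi.single j 1))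
  exact ⟨c, Subtype.ext hc⟩

/-- By the phase relations the span of the monomials is closed under products and adjoints. It
contains the generators, hence the star algebra whose closure is A_θ. -/
theorem mem_closure_span_ncMonomial (u : ncTorus θ) :
    u ∈ closure (Submodule.span ℂ (Set.range fun k => (ncMonomial θ k : ncTorus θ)) :
      Set (ncTorus θ)) := by
  set M := Submodule.span ℂ (Set.range fun k => (ncMonomial θ k : ncTorus θ)) with hM
  have hmon : ∀ k, (ncMonomial θ k : ncTorus θ) ∈ M := fun k => Submodule.subset_span ⟨k, rfl⟩
  have hmul : ∀ a ∈ M, ∀ b ∈ M, a * b ∈ M := by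
    have : M * M ≤ M := by
      rw [hM, Submodule.span_mul_span, Submodule.span_le]
      rintro _ ⟨_, ⟨k, rfl⟩, _, ⟨l, rfl⟩, rfl⟩
      obtain ⟨c, hc⟩ := exists_ncMonomial_mul (θ := θ) k l
      change (ncMonomial θ k * ncMonomial θ l : ncTorus θ) ∈ M
      rw [hc]
      exact M.smul_mem _ (hmon _)
    exact fun a ha b hb => this (Submodule.mul_mem_mul ha hb)
  have hstar : ∀ a ∈ M, star a ∈ M := by
    intro a ha
    induction ha using Submodule.span_induction with
    | mem x hx =>
      obtain ⟨k, rfl⟩ := hx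
      obtain ⟨c, hc⟩ := exists_star_ncMonomial (θ := θ) k
      change star (ncMonomial θ k : ncTorus θ) ∈ M
      rw [hc]
      exact M.smul_mem _ (hmon _)
    | zero => rw [star_zero]; exact M.zero_mem
    | add x y _ _ hx hy => rw [star_add]; exact M.add_mem hx hy
    | smul c x _ hx => rw [star_smul]; exact M.smul_mem _ hx
  have hadj : ∀ x ∈ StarAlgebra.adjoin ℂ (Set.range fun j => (genU θ j : BL2 n)),
      ∃ v ∈ M, (v : BL2 n) = x := by
    intro x hx
    induction hx using StarAlgebra.adjoin_induction with
    | mem x hx =>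
      obtain ⟨j, rfl⟩ := hx
      refine ⟨ncU θ j, ?_, rfl⟩
      obtain ⟨c, hc⟩ := ncMonomial_single (θ := θ) j
      rw [hc]
      exact M.smul_mem _ (hmon _)
    | algebraMap r =>
      refine ⟨algebraMap ℂ (ncTorus θ) r, ?_, rfl⟩
      rw [Algebra.algebraMap_eq_smul_one, ← ncMonomial_zero]
      exact M.smul_mem _ (hmon _)
    | add x y _ _ hx hy =>
      obtain ⟨v, hv, rfl⟩ := hx
      obtain ⟨w, hw, rfl⟩ := hy
      exact ⟨v + w, M.add_mem hv hw, rfl⟩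
    | mul x y _ _ hx hy =>
      obtain ⟨v, hv, rfl⟩ := hx
      obtain ⟨w, hw, rfl⟩ := hy
      exact ⟨v * w, hmul v hv w hw, rfl⟩
    | star x _ hx =>
      obtain ⟨v, hv, rfl⟩ := hx
      exact ⟨star v, hstar v hv, rfl⟩
  rw [closure_subtype]
  have hu : (u : BL2 n) ∈ closure
      (StarAlgebra.adjoin ℂ (Set.range fun j => (genU θ j : BL2 n)) : Set (BL2 n)) := by
    rw [← StarSubalgebra.topologicalClosure_coe]; exact u.2
  refine closure_mono ?_ hu
  intro x hx
  obtain ⟨v, hv, rfl⟩ := hadj x hx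
  exact ⟨v, hv, rfl⟩

end Structure

/-! ### The trace, the basis (U^k) and Fourier expansions in L² -/

section HilbertSpace

open Filter Topology ComplexConjugate

variable {n : ℕ} {θ : Matrix (Fin n) (Fin n) ℝ}

theorem norm_const_one : ‖(Lp.const 2 (torusMeasure n) (1 : ℂ) : L2Torus n)‖ = 1 := by
  rw [Lp.norm_const] <;> simp

theorem norm_ncTrace_le (u : ncTorus θ) : ‖ncTrace θ u‖ ≤ ‖u‖ := by
  refine (norm_inner_le_norm _ _).trans ?_
  rw [norm_const_one, one_mul]
  refine ((u : BL2 n).le_opNorm _).trans ?_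
  rw [norm_const_one, mul_one]
  rfl

theorem ncTrace_smul (c : ℂ) (u : ncTorus θ) : ncTrace θ (c • u) = c * ncTrace θ u := by
  unfold ncTrace
  rw [← inner_smul_right]
  rfl

theorem ncTrace_one : ncTrace θ 1 = 1 := by
  rw [ncTrace]
  change inner ℂ (Lp.const 2 (torusMeasure n) (1 : ℂ)) (Lp.const 2 (torusMeasure n) (1 : ℂ)) = _
  rw [inner_self_eq_norm_sq_to_K, norm_const_one]
  simp

/-- The constant function 1 is fixed by V_s and by its adjoint. -/
theorem ncTrace_action (s : EuclideanSpace ℝ (Fin n)) (u : ncTorus θ) :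
    ncTrace θ (actionHom θ s u) = ncTrace θ u := by
  set o : L2Torus n := Lp.const 2 (torusMeasure n) (1 : ℂ) with ho
  have h1 : (transV s : BL2 n) o = o := by
    rw [transV_apply]
    apply Lp.ext
    have h0 := Lp.coeFn_const (p := 2) (μ := torusMeasure n) (1 : ℂ)
    filter_upwards [coeFn_translate (torusPt s) o, ae_translate (torusPt s) h0, h0] with x hx h2 h3
    rw [hx, h2, h3]; rfl
  have h2 : star (transV s : BL2 n) o = o := by
    conv_lhs => rw [← h1]
    change (star (transV s : BL2 n) * (transV s : BL2 n)) o = o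
    rw [Unitary.star_mul_self_of_mem (transV s).2]; rfl
  change inner ℂ o ((transV s : BL2 n) ((u : BL2 n) (star (transV s : BL2 n) o))) =
    inner ℂ o ((u : BL2 n) o)
  rw [h2, ← ContinuousLinearMap.adjoint_inner_left, ← ContinuousLinearMap.star_eq_adjoint, h2]

/-- Invariance gives τ(u) = e^{is·k} τ(u), and some s makes the phase different from 1. -/
theorem HasWeight.ncTrace_eq_zero {u : ncTorus θ} {k : Fin n → ℤ} (hu : HasWeight u k)
    (hk : k ≠ 0) : ncTrace θ u = 0 := by
  obtain ⟨s, hs⟩ := exists_phase_ne_one hk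
  have h := ncTrace_action s u
  rw [hu s, ncTrace_smul] at h
  have : (phase s k - 1) * ncTrace θ u = 0 := by rw [sub_mul, h, one_mul, sub_self]
  exact (mul_eq_zero.1 this).resolve_left (sub_ne_zero.2 hs)

theorem inner_toL2 (u v : ncTorus θ) : inner ℂ (toL2 θ u) (toL2 θ v) = ncTrace θ (v * star u) :=
  UniformSpace.Completion.inner_coe _ _

theorem norm_toL2_le (u : ncTorus θ) : ‖toL2 θ u‖ ≤ ‖u‖ := by
  have h : ‖toL2 θ u‖ ^ 2 ≤ ‖u‖ ^ 2 := by
    have h1 : ((‖toL2 θ u‖ ^ 2 : ℝ) : ℂ) = ncTrace θ (u * star u) := by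
      rw [← inner_toL2, inner_self_eq_norm_sq_to_K]; push_cast; rfl
    calc ‖toL2 θ u‖ ^ 2 = ‖((‖toL2 θ u‖ ^ 2 : ℝ) : ℂ)‖ := by
          rw [Complex.norm_real, Real.norm_of_nonneg (by positivity)]
      _ ≤ ‖u * star u‖ := by rw [h1]; exact norm_ncTrace_le _
      _ ≤ ‖u‖ * ‖star u‖ := norm_mul_le _ _
      _ = ‖u‖ ^ 2 := by
          have : ‖star u‖ = ‖u‖ := norm_star (u : BL2 n)
          rw [this, sq]
  exact le_of_sq_le_sq h (norm_nonneg _)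

/-- The canonical map `A_θ → L²(𝕋ⁿ_θ)` as a linear map. -/
def toL2LM (θ : Matrix (Fin n) (Fin n) ℝ) : ncTorus θ →ₗ[ℂ] L2NCTorus θ where
  toFun := toL2 θ
  map_add' u v := UniformSpace.Completion.coe_add (toPreHilbert θ u) (toPreHilbert θ v)
  map_smul' c u := UniformSpace.Completion.coe_smul c (toPreHilbert θ u)

/-- The canonical bounded linear map `A_θ → L²(𝕋ⁿ_θ)`. -/
def toL2CLM (θ : Matrix (Fin n) (Fin n) ℝ) : ncTorus θ →L[ℂ] L2NCTorus θ :=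
  (toL2LM θ).mkContinuous 1 fun u => (norm_toL2_le u).trans_eq (one_mul ‖u‖).symm

theorem ncMonomial_mul_star (k : Fin n → ℤ) :
    (ncMonomial θ k : ncTorus θ) * star (ncMonomial θ k : ncTorus θ) = 1 :=
  Unitary.mul_star_self_of_mem (ncMonomial θ k).2

/-- The case m = 0 gives the Hilbert basis; general m is what makes `leftMonomial` an isometry. -/
theorem orthonormal_toL2_ncMonomial (θ : Matrix (Fin n) (Fin n) ℝ) (m : Fin n → ℤ) :
    Orthonormal ℂ fun k => toL2 θ ((ncMonomial θ m : ncTorus θ) * (ncMonomial θ k : ncTorus θ)) := by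
  classical
  rw [orthonormal_iff_ite]
  intro k l
  rw [inner_toL2]
  split_ifs with h
  · subst h
    rw [star_mul, mul_assoc, ← mul_assoc (ncMonomial θ k : ncTorus θ), ncMonomial_mul_star, one_mul,
      ncMonomial_mul_star, ncTrace_one]
  · refine HasWeight.ncTrace_eq_zero (((hasWeight_ncMonomial m).mul (hasWeight_ncMonomial l)).mul
      ((hasWeight_ncMonomial m).mul (hasWeight_ncMonomial k)).adjoint) ?_
    intro h0
    apply h
    have : m + l = m + k := by rwa [add_neg_eq_zero] at h0
    exact (add_left_cancel this).symm

/-- The Hilbert basis `(U^k)` of `L²(𝕋ⁿ_θ)`. -/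
def monomialBasis (θ : Matrix (Fin n) (Fin n) ℝ) : HilbertBasis (Fin n → ℤ) ℂ (L2NCTorus θ) :=
  HilbertBasis.mk (v := fun k => toL2 θ (ncMonomial θ k : ncTorus θ))
    (by simpa [ncMonomial_zero] using orthonormal_toL2_ncMonomial θ 0) (by
      rintro x -
      -- The span of the monomials is norm dense in A_θ, the map from A_θ to L² is continuous, and
      -- its range is dense in the completion.
      have hcl : ∀ u : ncTorus θ, toL2 θ u ∈ (Submodule.span ℂ (Set.range
          fun k => toL2 θ (ncMonomial θ k : ncTorus θ))).topologicalClosure := by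
        intro u
        have h1 : Set.MapsTo (toL2CLM θ)
            (Submodule.span ℂ (Set.range fun k => (ncMonomial θ k : ncTorus θ)) : Set (ncTorus θ))
            (Submodule.span ℂ (Set.range fun k => toL2 θ (ncMonomial θ k : ncTorus θ)) :
              Set (L2NCTorus θ)) := by
          intro v hv
          have := Submodule.mem_map_of_mem (f := (toL2CLM θ : ncTorus θ →ₗ[ℂ] L2NCTorus θ)) hv
          rw [Submodule.map_span, ← Set.range_comp] at this
          exact this
        exact h1.closure (toL2CLM θ).continuous (mem_closure_span_ncMonomial u)
      refine UniformSpace.Completion.induction_on x ?_ fun a => ?_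
      · exact Submodule.isClosed_topologicalClosure _
      · exact hcl ((toPreHilbert θ).symm a))

theorem monomialBasis_apply (k : Fin n → ℤ) :
    monomialBasis θ k = toL2 θ (ncMonomial θ k : ncTorus θ) := by
  rw [monomialBasis, HilbertBasis.coe_mk]

theorem inner_monomialBasis (k : Fin n → ℤ) (u : ncTorus θ) :
    inner ℂ (monomialBasis θ k) (toL2 θ u) = fourierCoeff u k := by
  rw [monomialBasis_apply, inner_toL2, fourierCoeff]

theorem hasSum_fourierCoeff (u : ncTorus θ) :
    HasSum (fun k => fourierCoeff u k • toL2 θ (ncMonomial θ k : ncTorus θ)) (toL2 θ u) := by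
  have h := (monomialBasis θ).hasSum_repr (toL2 θ u)
  simp only [HilbertBasis.repr_apply_apply, inner_monomialBasis] at h
  simpa only [monomialBasis_apply] using h

theorem toL2_smul (c : ℂ) (u : ncTorus θ) : toL2 θ (c • u) = c • toL2 θ u :=
  (toL2LM θ).map_smul c u

/-- Since U^k is unitary, u(U^m)* = uU^k(U^mU^k)*: right multiplication by U^k shifts the
coefficients by k, up to the phase c. -/
theorem fourierCoeff_mul_ncMonomial (u : ncTorus θ) {m k : Fin n → ℤ} {c : ℂ}
    (hc : (ncMonomial θ m : ncTorus θ) * (ncMonomial θ k : ncTorus θ) =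
      c • (ncMonomial θ (m + k) : ncTorus θ)) :
    conj c * fourierCoeff (u * (ncMonomial θ k : ncTorus θ)) (m + k) = fourierCoeff u m := by
  have h2 : u * star (ncMonomial θ m : ncTorus θ) = u * (ncMonomial θ k : ncTorus θ) *
      star ((ncMonomial θ m : ncTorus θ) * (ncMonomial θ k : ncTorus θ)) := by
    rw [star_mul, mul_assoc, ← mul_assoc (ncMonomial θ k : ncTorus θ), ncMonomial_mul_star, one_mul]
  rw [fourierCoeff, fourierCoeff, h2, hc, star_smul, mul_smul_comm, ncTrace_smul]
  rfl

/-- The Fourier expansion of `u`, multiplied by `U^k` from the right. -/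
theorem hasSum_fourierCoeff_mul (u : ncTorus θ) (k : Fin n → ℤ) :
    HasSum (fun m => fourierCoeff u m •
      toL2 θ ((ncMonomial θ m : ncTorus θ) * (ncMonomial θ k : ncTorus θ)))
      (toL2 θ (u * (ncMonomial θ k : ncTorus θ))) := by
  have h := (Equiv.addRight k).hasSum_iff.2
    (hasSum_fourierCoeff (u * (ncMonomial θ k : ncTorus θ)))
  convert h using 2 with m
  simp only [Function.comp_apply, Equiv.coe_addRight]
  obtain ⟨c, hc⟩ := exists_ncMonomial_mul (θ := θ) m k
  have hcc : (c : ℂ) * conj (c : ℂ) = 1 := by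
    rw [Complex.mul_conj, Complex.normSq_eq_norm_sq, Circle.norm_coe]; simp
  rw [← fourierCoeff_mul_ncMonomial u hc, hc, toL2_smul, smul_smul, mul_right_comm,
    mul_comm (conj _), hcc, one_mul]

/-- Left multiplication by `U^m` on `L²(𝕋ⁿ_θ)`. -/
def leftMonomial (θ : Matrix (Fin n) (Fin n) ℝ) (m : Fin n → ℤ) :
    L2NCTorus θ →L[ℂ] L2NCTorus θ :=
  (orthonormal_toL2_ncMonomial θ m).orthogonalFamily.linearIsometry.toContinuousLinearMap ∘L
    ((monomialBasis θ).repr : L2NCTorus θ →L[ℂ] _)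

theorem leftMonomial_apply (m k : Fin n → ℤ) :
    leftMonomial θ m (toL2 θ (ncMonomial θ k : ncTorus θ)) =
      toL2 θ ((ncMonomial θ m : ncTorus θ) * (ncMonomial θ k : ncTorus θ)) := by
  classical
  rw [← monomialBasis_apply]
  change (orthonormal_toL2_ncMonomial θ m).orthogonalFamily.linearIsometry
    ((monomialBasis θ).repr (monomialBasis θ k)) = _
  rw [HilbertBasis.repr_self, OrthogonalFamily.linearIsometry_apply_single]
  simp

theorem norm_leftMonomial_le (m : Fin n → ℤ) : ‖leftMonomial θ m‖ ≤ 1 := by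
  refine ContinuousLinearMap.opNorm_le_bound _ zero_le_one fun x => ?_
  rw [one_mul]
  change ‖(orthonormal_toL2_ncMonomial θ m).orthogonalFamily.linearIsometry
    ((monomialBasis θ).repr x)‖ ≤ _
  rw [LinearIsometry.norm_map, LinearIsometryEquiv.norm_map]

theorem leftMonomial_zero : leftMonomial θ 0 = 1 := by
  refine clm_ext_hilbertBasis (monomialBasis θ) fun k => ?_
  rw [monomialBasis_apply, leftMonomial_apply, ncMonomial_zero, one_mul]; rfl

theorem ncMonomial_mem_smoothTorus (k : Fin n → ℤ) :
    (ncMonomial θ k : ncTorus θ) ∈ smoothTorus θ := by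
  change ContDiff ℝ (⊤ : ℕ∞) fun s => torusAction θ s (ncMonomial θ k : ncTorus θ)
  have : (fun s => torusAction θ s (ncMonomial θ k : ncTorus θ)) =
      fun s => phase s k • (ncMonomial θ k : ncTorus θ) := funext fun s => hasWeight_ncMonomial k s
  rw [this]
  have h1 : ContDiff ℝ (⊤ : ℕ∞) fun s : EuclideanSpace ℝ (Fin n) => (∑ j, s j * k j : ℝ) := by
    fun_prop
  have h2 : ContDiff ℝ (⊤ : ℕ∞) fun s : EuclideanSpace ℝ (Fin n) => phase s k :=
    (contDiff_const.mul (Complex.ofRealCLM.contDiff.comp h1)).cexp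
  exact h2.smul contDiff_const

theorem boundedExtension_unique {P : smoothTorus θ →ₗ[ℂ] smoothTorus θ}
    {S T : L2NCTorus θ →L[ℂ] L2NCTorus θ} (hS : IsBoundedExtension P S)
    (hT : IsBoundedExtension P T) : S = T := by
  refine clm_ext_hilbertBasis (monomialBasis θ) fun k => ?_
  rw [monomialBasis_apply]
  exact (hS ⟨_, ncMonomial_mem_smoothTorus k⟩).trans (hT ⟨_, ncMonomial_mem_smoothTorus k⟩).symm

theorem fourierCoeff_ncMonomial (k l : Fin n → ℤ) :
    fourierCoeff (ncMonomial θ k : ncTorus θ) l = if k = l then 1 else 0 := by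
  classical
  rw [← inner_monomialBasis, ← monomialBasis_apply,
    orthonormal_iff_ite.1 (monomialBasis θ).orthonormal]
  simp only [eq_comm]

/-- `P U^k = ρ(k) U^k`. -/
theorem IsPsiDOWithSymbol.apply_ncMonomial {ρ : EuclideanSpace ℝ (Fin n) → smoothTorus θ}
    {P : smoothTorus θ →ₗ[ℂ] smoothTorus θ} (hP : IsPsiDOWithSymbol ρ P) (k : Fin n → ℤ) :
    (P ⟨_, ncMonomial_mem_smoothTorus k⟩ : ncTorus θ) =
      (ρ (latticePt k) : ncTorus θ) * (ncMonomial θ k : ncTorus θ) := by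
  have h := hP ⟨_, ncMonomial_mem_smoothTorus k⟩
  refine h.unique ?_
  simp only [fourierCoeff_ncMonomial]
  have h1 := hasSum_single (f := fun l => (if k = l then (1 : ℂ) else 0) •
    ((ρ (latticePt l) : ncTorus θ) * (ncMonomial θ l : ncTorus θ))) k fun l hl => by
      rw [if_neg hl.symm, zero_smul]
  rwa [if_pos rfl, one_smul] at h1

/-- The right-hand side does not involve the symbol: two symbols of the same operator have equal
traces at lattice points. The invariance of the residue rests on this. -/
theorem ncTrace_symbol {ρ : EuclideanSpace ℝ (Fin n) → smoothTorus θ}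
    {P : smoothTorus θ →ₗ[ℂ] smoothTorus θ} (hP : IsPsiDOWithSymbol ρ P) (k : Fin n → ℤ) :
    ncTrace θ (ρ (latticePt k) : ncTorus θ) =
      ncTrace θ ((P ⟨_, ncMonomial_mem_smoothTorus k⟩ : ncTorus θ) *
        star (ncMonomial θ k : ncTorus θ)) := by
  rw [hP.apply_ncMonomial, mul_assoc, ncMonomial_mul_star, mul_one]

end HilbertSpace

/-! ### Decay of the Fourier coefficients of a symbol -/

section SymbolDecay

open Filter Topology ComplexConjugate

variable {n : ℕ} {θ : Matrix (Fin n) (Fin n) ℝ}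

/-- The Fourier coefficient of index `m` as a bounded linear form. -/
def fourierCLM (θ : Matrix (Fin n) (Fin n) ℝ) (m : Fin n → ℤ) : ncTorus θ →L[ℂ] ℂ :=
  innerSL ℂ (monomialBasis θ m) ∘L toL2CLM θ

theorem fourierCLM_apply (m : Fin n → ℤ) (u : ncTorus θ) : fourierCLM θ m u = fourierCoeff u m :=
  inner_monomialBasis m u

theorem norm_fourierCoeff_le (u : ncTorus θ) (m : Fin n → ℤ) : ‖fourierCoeff u m‖ ≤ ‖u‖ := by
  rw [← inner_monomialBasis]
  refine (norm_inner_le_norm _ _).trans ?_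
  rw [(monomialBasis θ).orthonormal.1, one_mul]
  exact norm_toL2_le u

theorem fourierCoeff_zero (u : ncTorus θ) : fourierCoeff u 0 = ncTrace θ u := by
  rw [fourierCoeff, ncMonomial_zero, star_one, mul_one]

theorem fourierCoeff_action (s : EuclideanSpace ℝ (Fin n)) (u : ncTorus θ) (m : Fin n → ℤ) :
    fourierCoeff (torusAction θ s u) m = phase s m * fourierCoeff u m := by
  have h1 : ncTrace θ (torusAction θ s u * star (ncMonomial θ m : ncTorus θ)) =
      phase s m * (conj (phase s m) *
        ncTrace θ (torusAction θ s u * star (ncMonomial θ m : ncTorus θ))) := by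
    rw [← mul_assoc, Complex.mul_conj, Complex.normSq_eq_norm_sq, norm_phase]; simp
  rw [fourierCoeff, fourierCoeff, h1, ← ncTrace_action s (u * star (ncMonomial θ m : ncTorus θ)),
    map_mul, (hasWeight_ncMonomial m).adjoint s, mul_smul_comm, ncTrace_smul, phase_neg,
    actionHom_apply]

theorem iteratedFDeriv_cexp_clm {E : Type*} [NormedAddCommGroup E] [NormedSpace ℝ E]
    (ℓ : E →L[ℝ] ℂ) (c : ℂ) (k : ℕ) (x : E) (v : Fin k → E) :
    iteratedFDeriv ℝ k (fun s => Complex.exp (ℓ s) * c) x v =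
      (∏ i, ℓ (v i)) * (Complex.exp (ℓ x) * c) := by
  induction k generalizing x with
  | zero => simp
  | succ k ih =>
    have hsm : ContDiff ℝ (⊤ : ℕ∞) fun s => Complex.exp (ℓ s) * c :=
      ℓ.contDiff.cexp.mul contDiff_const
    have hd : Differentiable ℝ (iteratedFDeriv ℝ k fun s => Complex.exp (ℓ s) * c) :=
      hsm.differentiable_iteratedFDeriv (by exact_mod_cast WithTop.coe_lt_top _)
    rw [iteratedFDeriv_succ_apply_left]
    let ev : ContinuousMultilinearMap ℝ (fun _ : Fin k => E) ℂ →L[ℝ] ℂ :=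
      ContinuousMultilinearMap.apply ℝ (fun _ : Fin k => E) ℂ (Fin.tail v)
    have h1 : HasFDerivAt (fun y => ev (iteratedFDeriv ℝ k (fun s => Complex.exp (ℓ s) * c) y))
        (ev ∘L fderiv ℝ (iteratedFDeriv ℝ k fun s => Complex.exp (ℓ s) * c) x) x :=
      ev.hasFDerivAt.comp x (hd x).hasFDerivAt
    have h2 : (fun y => ev (iteratedFDeriv ℝ k (fun s => Complex.exp (ℓ s) * c) y)) =
        fun y => (∏ i, ℓ (Fin.tail v i)) * (Complex.exp (ℓ y) * c) :=
      funext fun y => ih y (Fin.tail v)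
    rw [h2] at h1
    have h3 := ((ℓ.hasFDerivAt (x := x)).cexp.mul_const c).const_mul (∏ i, ℓ (Fin.tail v i))
    have h4 := congrArg (fun L : E →L[ℝ] ℂ => L (v 0)) (h1.unique h3)
    change ev (fderiv ℝ (iteratedFDeriv ℝ k fun s => Complex.exp (ℓ s) * c) x (v 0)) = _
    refine Eq.trans h4 ?_
    rw [Fin.prod_univ_succ]
    simp [Fin.tail]
    ring

/-- The continuous form u ↦ u_m turns s ↦ α_s(u) into e^{is·m} u_m. Each factor i from
differentiating the exponential cancels a factor -i in δ. -/
theorem fourierCoeff_ncDeriv {k : ℕ} (J : Fin k → Fin n) (u : smoothTorus θ) (m : Fin n → ℤ) :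
    fourierCoeff (ncDeriv J u) m = (∏ i, (m (J i) : ℂ)) * fourierCoeff (u : ncTorus θ) m := by
  let ℓ : EuclideanSpace ℝ (Fin n) →L[ℝ] ℂ :=
    Complex.I • (Complex.ofRealCLM ∘L
      ∑ j, (m j : ℝ) • (EuclideanSpace.proj j : EuclideanSpace ℝ (Fin n) →L[ℝ] ℝ))
  have hℓ : ∀ s, Complex.exp (ℓ s) = phase s m := fun s => by
    simp [ℓ, phase, sum_apply, mul_comm]
  have hℓe : ∀ j, ℓ (EuclideanSpace.single j 1) = Complex.I * m j := fun j => by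
    simp [ℓ, sum_apply]
  let L : ncTorus θ →L[ℝ] ℂ := (fourierCLM θ m).restrictScalars ℝ
  have hu : ContDiff ℝ (⊤ : ℕ∞) fun s => torusAction θ s (u : ncTorus θ) := u.2
  have h1 := L.iteratedFDeriv_comp_left (x := 0) hu.contDiffAt (i := k)
    (by exact_mod_cast le_top)
  have h2 : (L ∘ fun s => torusAction θ s (u : ncTorus θ)) =
      fun s => Complex.exp (ℓ s) * fourierCoeff (u : ncTorus θ) m := by
    funext s
    change fourierCLM θ m (torusAction θ s (u : ncTorus θ)) = _
    rw [fourierCLM_apply, fourierCoeff_action, hℓ]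
  rw [h2] at h1
  have h3 := congrArg (fun M : ContinuousMultilinearMap ℝ
    (fun _ : Fin k => EuclideanSpace ℝ (Fin n)) ℂ => M fun i => EuclideanSpace.single (J i) 1) h1
  simp only [iteratedFDeriv_cexp_clm, ContinuousLinearMap.compContinuousMultilinearMap_coe,
    Function.comp_apply] at h3
  rw [ncDeriv, ← fourierCLM_apply, map_smul]
  change (-Complex.I) ^ k • L _ = _
  rw [← h3]
  simp only [hℓe, Finset.prod_mul_distrib, Finset.prod_const, Finset.card_univ, Fintype.card_fin,
    map_zero, Complex.exp_zero, one_mul, smul_eq_mul]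
  rw [← mul_assoc, ← mul_assoc, ← mul_pow]
  simp

theorem fourierCoeff_ncDeriv_elim0 (u : smoothTorus θ) (m : Fin n → ℤ) :
    fourierCoeff (ncDeriv (Fin.elim0 : Fin 0 → Fin n) u) m = fourierCoeff (u : ncTorus θ) m := by
  rw [fourierCoeff_ncDeriv]; simp

theorem latticePt_zero : latticePt (0 : Fin n → ℤ) = 0 := by
  ext j; simp [latticePt]

theorem one_le_norm_latticePt {k : Fin n → ℤ} (hk : k ≠ 0) : 1 ≤ ‖latticePt k‖ := by
  obtain ⟨j, hj⟩ := Function.ne_iff.1 hk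
  refine le_trans ?_ (PiLp.norm_apply_le (latticePt k) j)
  have : (1 : ℤ) ≤ |k j| := Int.one_le_abs hj
  have h2 : ‖latticePt k j‖ = ((|k j| : ℤ) : ℝ) := by simp [latticePt]
  rw [h2]
  exact_mod_cast this

theorem latticePt_ne_zero {k : Fin n → ℤ} (hk : k ≠ 0) : latticePt k ≠ 0 := by
  have := one_le_norm_latticePt hk
  rw [← norm_pos_iff]
  linarith

/-- The weight `|k|⁻ⁿ` on the lattice, with value `1` at the origin. -/
def latticeWeight (k : Fin n → ℤ) : ℝ := if k = 0 then 1 else (‖latticePt k‖ ^ n)⁻¹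

theorem latticeWeight_of_ne {k : Fin n → ℤ} (hk : k ≠ 0) :
    latticeWeight k = (‖latticePt k‖ ^ n)⁻¹ := if_neg hk

theorem latticeWeight_pos (k : Fin n → ℤ) : 0 < latticeWeight k := by
  unfold latticeWeight
  split_ifs with h
  · exact one_pos
  · have := one_le_norm_latticePt h
    positivity

/-- Sorted by |k|⁻ⁿ, the products (rank + 1)|k|⁻ⁿ converge and are thus bounded. The term `r 0 + 1`
in the maximum covers the origin, where the weight is 1. -/
theorem exists_latticeWeight_le (hn : n ≠ 0) : ∃ (r : (Fin n → ℤ) ≃ ℕ) (C : ℝ), 0 ≤ C ∧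
    ∀ k, latticeWeight k ≤ C / (r k + 1) := by
  obtain ⟨r, hr⟩ := exists_lattice_enumeration hn (g := fun x => (‖x‖ ^ n)⁻¹)
    (ContinuousOn.inv₀ (by fun_prop) fun x hx => pow_ne_zero _ (norm_ne_zero_iff.2 hx))
    (fun x t ht _ => by rw [norm_smul, Real.norm_of_nonneg ht.le, mul_pow, mul_inv])
    (fun x hx => by have := norm_pos_iff.2 hx; positivity)
  obtain ⟨C, hC⟩ := hr.bddAbove_range_of_cofinite
  have hC' : ∀ k, ((r k : ℝ) + 1) * (‖latticePt k‖ ^ n)⁻¹ ≤ C := fun k => hC ⟨k, rfl⟩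
  refine ⟨r, max C (r 0 + 1), (by positivity : (0 : ℝ) ≤ r 0 + 1).trans (le_max_right _ _),
    fun k => ?_⟩
  rw [le_div_iff₀ (by positivity), mul_comm]
  by_cases hk : k = 0
  · subst hk
    rw [latticeWeight, if_pos rfl, mul_one]
    exact le_max_right _ _
  · rw [latticeWeight_of_ne hk]
    exact (hC' k).trans (le_max_left _ _)

/-- The exponent n + 1 exceeds the rank n of the lattice. It dictates how many derivations of the
symbol are used. -/
theorem summable_inv_one_add_norm_pow (n : ℕ) :
    Summable fun m : Fin n → ℤ => (1 + ‖m‖ ^ (n + 1))⁻¹ := by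
  let L := Submodule.span ℤ (Set.range (Pi.basisFun ℝ (Fin n)))
  have hrank : Module.finrank ℤ L = n := by
    rw [ZLattice.rank ℝ L]; simp
  have h := ZLattice.summable_norm_pow_inv L (n + 1) (by rw [hrank]; exact Nat.lt_succ_self n)
  have hmem : ∀ m : Fin n → ℤ, (fun j => (m j : ℝ)) ∈ L := fun m => by
    rw [(Pi.basisFun ℝ (Fin n)).mem_span_iff_repr_mem ℤ]
    exact fun i => ⟨m i, by simp⟩
  let e : (Fin n → ℤ) → L := fun m => ⟨fun j => (m j : ℝ), hmem m⟩
  have he : Function.Injective e := fun m m' h => funext fun j => by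
    have h1 : ((m j : ℤ) : ℝ) = m' j := congrFun (congrArg Subtype.val h) j
    exact_mod_cast h1
  have h2 := h.comp_injective he
  have hnorm : ∀ m, ‖e m‖ = ‖m‖ := fun m => by
    change ‖fun j => (m j : ℝ)‖ = ‖m‖
    simp only [Pi.norm_def]
    congr 2
  refine Summable.of_norm_bounded_eventually h2 ?_
  filter_upwards [(Set.finite_singleton (0 : Fin n → ℤ)).compl_mem_cofinite] with m hm
  have hm0 : 0 < ‖m‖ := norm_pos_iff.2 hm
  rw [Real.norm_of_nonneg (by positivity)]
  simp only [Function.comp_apply, hnorm, inv_pow]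
  exact inv_anti₀ (by positivity) (by linarith)

variable {ρ : EuclideanSpace ℝ (Fin n) → smoothTorus θ}
  {ρh : ℕ → EuclideanSpace ℝ (Fin n) → smoothTorus θ}

/-- This is the expansion with no terms subtracted and no derivative in ξ. It applies at all nonzero
lattice points, as their norm is at least 1; the maximum covers the origin. -/
theorem IsClassicalSymbol.exists_norm_ncDeriv_le (hρ : IsClassicalSymbol (-(n : ℂ)) ρ ρh) {p : ℕ}
    (J : Fin p → Fin n) :
    ∃ C, ∀ k : Fin n → ℤ, ‖ncDeriv J (ρ (latticePt k))‖ ≤ C * latticeWeight k := by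
  obtain ⟨C, hC⟩ := hρ.expansion 0 p 0 J
  refine ⟨max C ‖ncDeriv J (ρ 0)‖, fun k => ?_⟩
  by_cases hk : k = 0
  · subst hk
    rw [latticeWeight, if_pos rfl, mul_one, latticePt_zero]
    exact le_max_right _ _
  · have h := hC _ (one_le_norm_latticePt hk)
    simp only [Finset.range_zero, Finset.sum_empty, sub_zero, norm_iteratedFDeriv_zero,
      Complex.neg_re, Complex.natCast_re, Nat.cast_zero] at h
    rw [Real.rpow_neg (norm_nonneg _), Real.rpow_natCast] at h
    rw [latticeWeight_of_ne hk]
    refine h.trans ?_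
    gcongr
    exact le_max_left _ _

/-- The Fourier coefficients of the values of a symbol of order `-n` decay rapidly. -/
theorem IsClassicalSymbol.exists_norm_fourierCoeff_le (hρ : IsClassicalSymbol (-(n : ℂ)) ρ ρh) :
    ∃ C, 0 ≤ C ∧ ∀ k m : Fin n → ℤ, ‖fourierCoeff (ρ (latticePt k) : ncTorus θ) m‖ ≤
      C * (1 + ‖m‖ ^ (n + 1))⁻¹ * latticeWeight k := by
  obtain ⟨C₀, hC₀⟩ := hρ.exists_norm_ncDeriv_le (Fin.elim0 : Fin 0 → Fin n)
  -- Applying the derivation in the direction j n + 1 times multiplies the coefficient of index m by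
  -- m_j^(n+1).
  choose C hC using fun j : Fin n => hρ.exists_norm_ncDeriv_le (fun _ : Fin (n + 1) => j)
  have h0 : ∀ k m : Fin n → ℤ, ‖fourierCoeff (ρ (latticePt k) : ncTorus θ) m‖ ≤
      C₀ * latticeWeight k := fun k m => by
    rw [← fourierCoeff_ncDeriv_elim0]
    exact (norm_fourierCoeff_le _ _).trans (hC₀ k)
  have h1 : ∀ (j : Fin n) (k m : Fin n → ℤ),
      ‖m j‖ ^ (n + 1) * ‖fourierCoeff (ρ (latticePt k) : ncTorus θ) m‖ ≤ C j * latticeWeight k := by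
    intro j k m
    refine le_trans (le_of_eq ?_) ((norm_fourierCoeff_le _ m).trans (hC j k))
    rw [fourierCoeff_ncDeriv, norm_mul]
    simp [Int.norm_eq_abs]
  have hC0 : ∀ j, 0 ≤ C j := fun j => by
    have := (norm_nonneg _).trans (hC j 0)
    exact nonneg_of_mul_nonneg_left this (latticeWeight_pos 0)
  have hC₀0 : 0 ≤ C₀ := nonneg_of_mul_nonneg_left ((norm_nonneg _).trans (hC₀ 0)) (latticeWeight_pos 0)
  refine ⟨C₀ + ∑ j, C j, add_nonneg hC₀0 (Finset.sum_nonneg fun j _ => hC0 j), fun k m => ?_⟩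
  have hpos : 0 < 1 + ‖m‖ ^ (n + 1) := by positivity
  rw [mul_right_comm, ← div_eq_mul_inv, le_div_iff₀ hpos, mul_add, mul_one, add_mul]
  refine add_le_add (h0 k m) ?_
  rcases isEmpty_or_nonempty (Fin n) with hE | hE
  · have : ‖m‖ = 0 := by rw [Subsingleton.elim m 0, norm_zero]
    rw [this, zero_pow (Nat.succ_ne_zero n), mul_zero]
    exact mul_nonneg (Finset.sum_nonneg fun j _ => hC0 j) (latticeWeight_pos k).le
  -- The norm of m is the supremum norm, attained at some coordinate, and the bound for that
  -- direction applies.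
  · obtain ⟨j, hj⟩ : ∃ j, ‖m‖ = ‖m j‖ := by
      obtain ⟨j, -, hj⟩ := Finset.exists_mem_eq_sup Finset.univ Finset.univ_nonempty fun j => ‖m j‖₊
      exact ⟨j, by rw [Pi.norm_def, hj]; rfl⟩
    rw [hj, mul_comm]
    refine (h1 j k m).trans ?_
    gcongr
    · exact (latticeWeight_pos k).le
    · exact Finset.single_le_sum (fun i _ => hC0 i) (Finset.mem_univ j)

end SymbolDecay

/-! ### Reduction of the trace of P to a diagonal operator -/

section Reduction

open Filter Topology ComplexConjugate

variable {n : ℕ} {θ : Matrix (Fin n) (Fin n) ℝ}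
  {ρ : EuclideanSpace ℝ (Fin n) → smoothTorus θ}
  {ρh : ℕ → EuclideanSpace ℝ (Fin n) → smoothTorus θ}

theorem latticeWeight_isDiagonal_pos {H : Type*} [NormedAddCommGroup H] [InnerProductSpace ℂ H]
    {b : HilbertBasis (Fin n → ℤ) ℂ H} {Λ : H →L[ℂ] H}
    (hΛ : IsDiagonal b (fun k => (latticeWeight k : ℂ)) Λ) : Λ.IsPositive :=
  hΛ.isPositive fun k => (latticeWeight_pos k).le

theorem exists_weakTraceClass_of_le_latticeWeight {H : Type*} [NormedAddCommGroup H]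
    [InnerProductSpace ℂ H] [CompleteSpace H] (hn : n ≠ 0) (b : HilbertBasis (Fin n → ℤ) ℂ H)
    {f : (Fin n → ℤ) → ℂ} {C : ℝ} (hf : ∀ k, ‖f k‖ ≤ C * latticeWeight k) :
    ∃ T : weakTraceClass H, IsDiagonal b f (T : H →L[ℂ] H) := by
  obtain ⟨r, D, hD, hr⟩ := exists_latticeWeight_le hn
  have hC : 0 ≤ C := nonneg_of_mul_nonneg_left ((norm_nonneg _).trans (hf 0)) (latticeWeight_pos 0)
  refine exists_mem_weakTraceClass b r.injective (C := C * D) (by positivity) fun k => ?_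
  rw [mul_div_assoc]
  exact (hf k).trans (by gcongr; exact hr k)

/-- `U^m D`, `D` diagonal, is multiplied by a phase under conjugation by the translations. -/
theorem IsNormalizedPositiveTrace.map_leftMonomial_mul_eq_zero
    {φ : weakTraceClass (L2NCTorus θ) →ₗ[ℂ] ℂ} (hφ : IsNormalizedPositiveTrace φ)
    {m : Fin n → ℤ} (hm : m ≠ 0) {f : (Fin n → ℤ) → ℂ} {D : L2NCTorus θ →L[ℂ] L2NCTorus θ}
    (hD : IsDiagonal (monomialBasis θ) f D) {X : weakTraceClass (L2NCTorus θ)}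
    (hX : (X : L2NCTorus θ →L[ℂ] L2NCTorus θ) = leftMonomial θ m * D) : φ X = 0 := by
  obtain ⟨s, hs⟩ := exists_phase_ne_one hm
  obtain ⟨V, hV⟩ := exists_isDiagonal (monomialBasis θ) (f := phase s) (C := 1)
    fun k => (norm_phase s k).le
  obtain ⟨V', hV'⟩ := exists_isDiagonal (monomialBasis θ) (f := fun k => phase s (-k)) (C := 1)
    fun k => (norm_phase s (-k)).le
  have hone : V' * V = 1 := by
    refine clm_ext_hilbertBasis (monomialBasis θ) fun k => ?_
    rw [(hV'.mul hV) k]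
    beta_reduce
    rw [← phase_add, neg_add_cancel, phase_zero, one_smul]
    rfl
  have hconj : ((phase s m • X : weakTraceClass (L2NCTorus θ)) :
      L2NCTorus θ →L[ℂ] L2NCTorus θ) = V * X * V' := by
    refine clm_ext_hilbertBasis (monomialBasis θ) fun k => ?_
    obtain ⟨c, hc⟩ := exists_ncMonomial_mul (θ := θ) m k
    have h1 : leftMonomial θ m (monomialBasis θ k) = (c : ℂ) • monomialBasis θ (m + k) := by
      rw [monomialBasis_apply, leftMonomial_apply, hc, toL2_smul, monomialBasis_apply]
    change phase s m • (X : L2NCTorus θ →L[ℂ] L2NCTorus θ) (monomialBasis θ k) =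
      V ((X : L2NCTorus θ →L[ℂ] L2NCTorus θ) (V' (monomialBasis θ k)))
    rw [hV' k, hX]
    change phase s m • leftMonomial θ m (D (monomialBasis θ k)) =
      V (leftMonomial θ m (D (phase s (-k) • monomialBasis θ k)))
    rw [map_smul, map_smul, hD k, map_smul, h1, map_smul, map_smul, map_smul, hV (m + k)]
    simp only [smul_smul]
    congr 1
    have : phase s (m + k) * phase s (-k) = phase s m := by rw [← phase_add, add_neg_cancel_right]
    rw [← this]
    ring
  have h := hφ.map_conj hone hconj
  rw [map_smul, smul_eq_mul] at h
  have h2 : (phase s m - 1) * φ X = 0 := by rw [sub_mul, h, one_mul, sub_self]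
  exact (mul_eq_zero.1 h2).resolve_left (sub_ne_zero.2 hs)

/-- The operator with symbol `ρ` of order `-n` is in the weak trace class, and its traces are those
of the diagonal operator with entries `τ(ρ(k))`. -/
theorem IsClassicalSymbol.exists_weakTraceClass (hn : n ≠ 0)
    (hρ : IsClassicalSymbol (-(n : ℂ)) ρ ρh) :
    ∃ T D : weakTraceClass (L2NCTorus θ),
      (∀ k, (T : L2NCTorus θ →L[ℂ] L2NCTorus θ) (toL2 θ (ncMonomial θ k : ncTorus θ)) =
        toL2 θ ((ρ (latticePt k) : ncTorus θ) * (ncMonomial θ k : ncTorus θ))) ∧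
      IsDiagonal (monomialBasis θ) (fun k => ncTrace θ (ρ (latticePt k) : ncTorus θ))
        (D : L2NCTorus θ →L[ℂ] L2NCTorus θ) ∧
      ∀ φ : weakTraceClass (L2NCTorus θ) →ₗ[ℂ] ℂ, IsNormalizedPositiveTrace φ → φ T = φ D := by
  obtain ⟨C, hC0, hC⟩ := hρ.exists_norm_fourierCoeff_le
  obtain ⟨Λ, hΛ⟩ := exists_weakTraceClass_of_le_latticeWeight hn (monomialBasis θ)
    (f := fun k => (latticeWeight k : ℂ)) (C := 1) fun k => by
      rw [Complex.norm_real, Real.norm_of_nonneg (latticeWeight_pos k).le, one_mul]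
  have hw : ∀ k : Fin n → ℤ, (latticeWeight k : ℂ) ≠ 0 := fun k => by
    exact_mod_cast (latticeWeight_pos k).ne'
  -- Dividing by the weight splits off Λ. The quotients are bounded uniformly in k and summably in
  -- m, so ∑_m L_m E_m converges in operator norm.
  have hbd : ∀ m k : Fin n → ℤ,
      ‖fourierCoeff (ρ (latticePt k) : ncTorus θ) m / (latticeWeight k : ℂ)‖ ≤
        C * (1 + ‖m‖ ^ (n + 1))⁻¹ := fun m k => by
    rw [norm_div, Complex.norm_real, Real.norm_of_nonneg (latticeWeight_pos k).le,
      div_le_iff₀ (latticeWeight_pos k)]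
    exact hC k m
  choose E hE using fun m => exists_isDiagonal (monomialBasis θ) (hbd m)
  have hEn : ∀ m, ‖leftMonomial θ m * E m‖ ≤ C * (1 + ‖m‖ ^ (n + 1))⁻¹ := fun m => by
    refine (norm_mul_le _ _).trans ?_
    refine (mul_le_mul (norm_leftMonomial_le m) ((hE m).norm_le (by positivity) (hbd m))
      (norm_nonneg _) zero_le_one).trans_eq (one_mul _)
  have hsum : Summable fun m => leftMonomial θ m * E m :=
    Summable.of_norm_bounded ((summable_inv_one_add_norm_pow n).mul_left C) hEn
  obtain ⟨B, hB⟩ := hsum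
  have hD : ∀ m, IsDiagonal (monomialBasis θ)
      (fun k => fourierCoeff (ρ (latticePt k) : ncTorus θ) m)
      (E m * (Λ : L2NCTorus θ →L[ℂ] L2NCTorus θ)) := fun m => by
    have := (hE m).mul hΛ
    simpa only [div_mul_cancel₀ _ (hw _)] using this
  refine ⟨⟨B * Λ, mul_mem_weakTraceClass_left B Λ.2⟩,
    ⟨E 0 * Λ, mul_mem_weakTraceClass_left (E 0) Λ.2⟩, fun k => ?_, ?_, fun φ hφ => ?_⟩
  · have hB' : HasSum (fun m => leftMonomial θ m * (E m * (Λ : L2NCTorus θ →L[ℂ] L2NCTorus θ)))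
        (B * (Λ : L2NCTorus θ →L[ℂ] L2NCTorus θ)) := by
      simpa only [mul_assoc] using hB.mul_right (Λ : L2NCTorus θ →L[ℂ] L2NCTorus θ)
    have h1 := hB'.mapL (ContinuousLinearMap.apply ℂ (L2NCTorus θ)
      (toL2 θ (ncMonomial θ k : ncTorus θ)))
    refine h1.unique ?_
    convert hasSum_fourierCoeff_mul (ρ (latticePt k) : ncTorus θ) k using 2 with m
    change leftMonomial θ m ((E m * (Λ : L2NCTorus θ →L[ℂ] L2NCTorus θ))
      (toL2 θ (ncMonomial θ k : ncTorus θ))) = _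
    rw [← monomialBasis_apply, hD m k, map_smul, monomialBasis_apply, leftMonomial_apply]
  · simpa only [fourierCoeff_zero] using hD 0
  -- No continuity of φ is given, but A ↦ φ(AΛ) is norm continuous and passes through the sum; only
  -- m = 0 survives.
  · obtain ⟨ψ, hψ⟩ := hφ.exists_clm (latticeWeight_isDiagonal_pos hΛ)
    have h1 := hB.mapL ψ
    have h2 := hasSum_single (f := fun m => ψ (leftMonomial θ m * E m)) 0 fun m hm => by
      rw [hψ]
      exact hφ.map_leftMonomial_mul_eq_zero hm (hD m) (mul_assoc _ _ _)
    have h3 := h1.unique h2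
    rw [leftMonomial_zero, one_mul, hψ, hψ] at h3
    exact h3

/-- The series defining P u converges in A_θ, hence in L², and T applied to the Fourier series of u
gives the same terms. -/
theorem isBoundedExtension_of_apply_ncMonomial {P : smoothTorus θ →ₗ[ℂ] smoothTorus θ}
    (hP : IsPsiDOWithSymbol ρ P) {T : L2NCTorus θ →L[ℂ] L2NCTorus θ}
    (hT : ∀ k, T (toL2 θ (ncMonomial θ k : ncTorus θ)) =
      toL2 θ ((ρ (latticePt k) : ncTorus θ) * (ncMonomial θ k : ncTorus θ))) :
    IsBoundedExtension P T := by
  intro u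
  have h1 : HasSum _ (toL2 θ (P u : ncTorus θ)) := (hP u).mapL (toL2CLM θ)
  have h2 := (hasSum_fourierCoeff (u : ncTorus θ)).mapL T
  refine h2.unique ?_
  convert h1 using 2 with k
  rw [map_smul, map_smul, hT]
  rfl

end Reduction

/-! ### Traces of diagonal operators with homogeneous entries -/

section DiagonalTrace

open Filter Topology ComplexConjugate

variable {n : ℕ}

theorem integrable_sphere {E F : Type*} [NormedAddCommGroup E] [NormedSpace ℝ E]
    [FiniteDimensional ℝ E] [MeasurableSpace E] [BorelSpace E] [NormedAddCommGroup F] {g : E → F}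
    {μ : Measure (Metric.sphere (0 : E) 1)} [IsFiniteMeasure μ] (hg : ContinuousOn g {0}ᶜ) :
    Integrable (fun ω : Metric.sphere (0 : E) 1 => g ω) μ := by
  have hc : Continuous fun ω : Metric.sphere (0 : E) 1 => g ω :=
    hg.comp_continuous continuous_subtype_val fun ω => ne_zero_of_mem_unit_sphere ω
  exact hc.integrable_of_hasCompactSupport (HasCompactSupport.of_compactSpace _)

theorem exists_norm_le_of_homogeneous_neg {E F : Type*} [NormedAddCommGroup E] [NormedSpace ℝ E]
    [FiniteDimensional ℝ E] [NormedAddCommGroup F] [NormedSpace ℝ F] {g : E → F}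
    (hc : ContinuousOn g {0}ᶜ)
    (hg : ∀ (x : E) (r : ℝ), 0 < r → x ≠ 0 → g (r • x) = (r ^ n)⁻¹ • g x) :
    ∃ M, 0 ≤ M ∧ ∀ x, x ≠ 0 → ‖g x‖ ≤ M * (‖x‖ ^ n)⁻¹ := by
  obtain ⟨M, hM⟩ := (isCompact_sphere (0 : E) 1).exists_bound_of_continuousOn
    (hc.mono fun x hx => by rintro rfl; simp at hx)
  refine ⟨max M 0, le_max_right _ _, fun x hx => ?_⟩
  have hn : 0 < ‖x‖ := norm_pos_iff.2 hx
  have hx' : ‖x‖⁻¹ • x ≠ 0 := smul_ne_zero (inv_ne_zero hn.ne') hx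
  have h1 : g x = (‖x‖ ^ n)⁻¹ • g (‖x‖⁻¹ • x) := by
    rw [← hg _ _ hn hx', smul_inv_smul₀ hn.ne']
  rw [h1, norm_smul, Real.norm_of_nonneg (by positivity), mul_comm]
  gcongr
  exact (hM _ (by simp [norm_smul, hn.ne'])).trans (le_max_left _ _)

variable {H : Type*} [NormedAddCommGroup H] [InnerProductSpace ℂ H] [CompleteSpace H]
  {φ : weakTraceClass H →ₗ[ℂ] ℂ}

namespace IsNormalizedPositiveTrace

theorem map_lattice_of_pos (hφ : IsNormalizedPositiveTrace φ) (hn : n ≠ 0)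
    {b : HilbertBasis (Fin n → ℤ) ℂ H} {g : EuclideanSpace ℝ (Fin n) → ℝ}
    (hc : ContinuousOn g {0}ᶜ)
    (hg : ∀ (x : EuclideanSpace ℝ (Fin n)) (r : ℝ), 0 < r → x ≠ 0 → g (r • x) = (r ^ n)⁻¹ * g x)
    (hpos : ∀ x, x ≠ 0 → 0 < g x) {f : (Fin n → ℤ) → ℂ}
    (hf : ∀ k, k ≠ 0 → f k = g (latticePt k)) {D : weakTraceClass H}
    (hD : IsDiagonal b f (D : H →L[ℂ] H)) :
    φ D = (((1 / (n : ℝ)) * ∫ ω : Metric.sphere (0 : EuclideanSpace ℝ (Fin n)) 1, g ω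
        ∂(volume.toSphere) : ℝ) : ℂ) := by
  obtain ⟨r, hr⟩ := exists_lattice_enumeration hn hc hg hpos
  refine hφ.map_eq_of_tendsto hD r ?_
  refine ((Complex.continuous_ofReal.tendsto _).comp hr).congr' ?_
  filter_upwards [(Set.finite_singleton (0 : Fin n → ℤ)).compl_mem_cofinite] with k hk
  rw [hf k hk]
  simp

/-- Adding (M + 1)|x|⁻ⁿ, which dominates |g|, leads to the positive case; both sides are additive,
so the added term cancels. -/
theorem map_lattice_of_real (hφ : IsNormalizedPositiveTrace φ) (hn : n ≠ 0)
    {b : HilbertBasis (Fin n → ℤ) ℂ H} {g : EuclideanSpace ℝ (Fin n) → ℝ}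
    (hc : ContinuousOn g {0}ᶜ)
    (hg : ∀ (x : EuclideanSpace ℝ (Fin n)) (r : ℝ), 0 < r → x ≠ 0 → g (r • x) = (r ^ n)⁻¹ * g x)
    {f : (Fin n → ℤ) → ℂ} (hf : ∀ k, k ≠ 0 → f k = g (latticePt k)) {D : weakTraceClass H}
    (hD : IsDiagonal b f (D : H →L[ℂ] H)) :
    φ D = (((1 / (n : ℝ)) * ∫ ω : Metric.sphere (0 : EuclideanSpace ℝ (Fin n)) 1, g ω
        ∂(volume.toSphere) : ℝ) : ℂ) := by
  obtain ⟨M, hM0, hM⟩ := exists_norm_le_of_homogeneous_neg hc hg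
  let h : EuclideanSpace ℝ (Fin n) → ℝ := fun x => (M + 1) * (‖x‖ ^ n)⁻¹
  have hhpos : ∀ x, x ≠ 0 → 0 < h x := fun x hx => by
    have := norm_pos_iff.2 hx
    positivity
  have hhc : ContinuousOn h {0}ᶜ := continuousOn_const.mul
    (ContinuousOn.inv₀ (by fun_prop) fun x hx => pow_ne_zero _ (norm_ne_zero_iff.2 hx))
  have hhg : ∀ (x : EuclideanSpace ℝ (Fin n)) (r : ℝ), 0 < r → x ≠ 0 →
      h (r • x) = (r ^ n)⁻¹ * h x := fun x r hr _ => by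
    simp only [h]
    rw [norm_smul, Real.norm_of_nonneg hr.le, mul_pow, mul_inv]
    ring
  obtain ⟨Λ, hΛ⟩ := exists_weakTraceClass_of_le_latticeWeight hn b
    (f := fun k => (((M + 1) * latticeWeight k : ℝ) : ℂ)) (C := M + 1) fun k => by
      rw [Complex.norm_real, Real.norm_of_nonneg (mul_nonneg (by positivity) (latticeWeight_pos k).le)]
  have hfΛ : ∀ k, k ≠ 0 → (((M + 1) * latticeWeight k : ℝ) : ℂ) = h (latticePt k) := fun k hk => by
    rw [latticeWeight_of_ne hk]
  have h1 := hφ.map_lattice_of_pos hn hhc hhg hhpos hfΛ hΛ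
  have h2 := hφ.map_lattice_of_pos hn (g := fun x => g x + h x) (hc.add hhc)
    (fun x r hr hx => by rw [hg x r hr hx, hhg x r hr hx, mul_add])
    (fun x hx => by
      have h3 := hM x hx
      have h4 := norm_pos_iff.2 hx
      have h5 : 0 < (‖x‖ ^ n)⁻¹ := by positivity
      have h6 := neg_le_of_abs_le h3
      simp only [h]
      linarith) (f := fun k => f k + (((M + 1) * latticeWeight k : ℝ) : ℂ))
    (fun k hk => by rw [hf k hk, hfΛ k hk, Complex.ofReal_add]) (D := D + Λ) (hD.add hΛ)
  rw [integral_add (integrable_sphere hc) (integrable_sphere hhc), mul_add, Complex.ofReal_add,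
    map_add, h1] at h2
  exact add_right_cancel h2

theorem map_lattice_of_homogeneous (hφ : IsNormalizedPositiveTrace φ) (hn : n ≠ 0)
    {b : HilbertBasis (Fin n → ℤ) ℂ H} {g : EuclideanSpace ℝ (Fin n) → ℂ}
    (hc : ContinuousOn g {0}ᶜ)
    (hg : ∀ (x : EuclideanSpace ℝ (Fin n)) (r : ℝ), 0 < r → x ≠ 0 → g (r • x) = (r ^ n)⁻¹ • g x)
    {f : (Fin n → ℤ) → ℂ} (hf : ∀ k, k ≠ 0 → f k = g (latticePt k)) {D : weakTraceClass H}
    (hD : IsDiagonal b f (D : H →L[ℂ] H)) :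
    φ D = (1 / (n : ℂ)) * ∫ ω : Metric.sphere (0 : EuclideanSpace ℝ (Fin n)) 1, g ω
        ∂(volume.toSphere) := by
  obtain ⟨M, hM0, hM⟩ := exists_norm_le_of_homogeneous_neg hc hg
  have hbd : ∀ k, ‖f k‖ ≤ max M ‖f 0‖ * latticeWeight k := fun k => by
    by_cases hk : k = 0
    · subst hk
      rw [latticeWeight, if_pos rfl, mul_one]
      exact le_max_right _ _
    · rw [hf k hk, latticeWeight_of_ne hk]
      refine (hM _ (latticePt_ne_zero hk)).trans ?_
      gcongr
      exact le_max_left _ _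
  obtain ⟨A, hA⟩ := exists_weakTraceClass_of_le_latticeWeight hn b
    (f := fun k => ((f k).re : ℂ)) fun k => by
      rw [Complex.norm_real]; exact (Complex.abs_re_le_norm _).trans (hbd k)
  obtain ⟨B, hB⟩ := exists_weakTraceClass_of_le_latticeWeight hn b
    (f := fun k => ((f k).im : ℂ)) fun k => by
      rw [Complex.norm_real]; exact (Complex.abs_im_le_norm _).trans (hbd k)
  have hAB : D = A + Complex.I • B := Subtype.ext (hD.unique (by
    have : IsDiagonal b _ ((A + Complex.I • B : weakTraceClass H) : H →L[ℂ] H) :=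
      hA.add (hB.smul Complex.I)
    convert this using 2 with j
    rw [mul_comm]; exact (Complex.re_add_im _).symm))
  have h1 := hφ.map_lattice_of_real hn (g := fun x => (g x).re)
    (Complex.continuous_re.comp_continuousOn hc)
    (fun x r hr hx => by rw [hg x r hr hx, Complex.real_smul, Complex.re_ofReal_mul])
    (fun k hk => by rw [hf k hk]) hA
  have h2 := hφ.map_lattice_of_real hn (g := fun x => (g x).im)
    (Complex.continuous_im.comp_continuousOn hc)
    (fun x r hr hx => by rw [hg x r hr hx, Complex.real_smul, Complex.im_ofReal_mul])
    (fun k hk => by rw [hf k hk]) hB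
  have h3 := integral_re_add_im (𝕜 := ℂ) (integrable_sphere
    (μ := (volume : Measure (EuclideanSpace ℝ (Fin n))).toSphere) hc)
  rw [hAB, map_add, map_smul, h1, h2, ← h3]
  simp only [RCLike.re_to_complex, RCLike.im_to_complex, smul_eq_mul]
  push_cast
  simp only [RCLike.I_to_complex, Complex.coe_algebraMap]
  ring

/-- As rank + 1 is O(|k|ⁿ), entries of size O(|k|^(-n-1)) multiplied by it tend to 0, and the trace
does not see them. -/
theorem map_lattice_of_asymptotic (hφ : IsNormalizedPositiveTrace φ) (hn : n ≠ 0)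
    {b : HilbertBasis (Fin n → ℤ) ℂ H} {g : EuclideanSpace ℝ (Fin n) → ℂ}
    (hc : ContinuousOn g {0}ᶜ)
    (hg : ∀ (x : EuclideanSpace ℝ (Fin n)) (r : ℝ), 0 < r → x ≠ 0 → g (r • x) = (r ^ n)⁻¹ • g x)
    {f : (Fin n → ℤ) → ℂ} {C : ℝ}
    (hf : ∀ k, k ≠ 0 → ‖f k - g (latticePt k)‖ ≤ C * (‖latticePt k‖ ^ (n + 1))⁻¹)
    {D : weakTraceClass H} (hD : IsDiagonal b f (D : H →L[ℂ] H)) :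
    φ D = (1 / (n : ℂ)) * ∫ ω : Metric.sphere (0 : EuclideanSpace ℝ (Fin n)) 1, g ω
        ∂(volume.toSphere) := by
  obtain ⟨M, hM0, hM⟩ := exists_norm_le_of_homogeneous_neg hc hg
  obtain ⟨A, hA⟩ := exists_weakTraceClass_of_le_latticeWeight hn b
    (f := fun k => if k = 0 then 0 else g (latticePt k)) (C := M) fun k => by
      by_cases hk : k = 0
      · rw [if_pos hk, norm_zero]; exact mul_nonneg hM0 (latticeWeight_pos k).le
      · rw [if_neg hk, latticeWeight_of_ne hk]; exact hM _ (latticePt_ne_zero hk)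
  rw [← hφ.map_lattice_of_homogeneous hn hc hg (fun k hk => if_neg hk) hA, ← sub_eq_zero, ← map_sub]
  obtain ⟨r, K, hK, hr⟩ := exists_latticeWeight_le hn
  refine hφ.map_eq_of_tendsto (T := D - A) (hD.sub hA) r ?_
  have hlim : Tendsto (fun k : Fin n → ℤ => ‖latticePt k‖) cofinite atTop := by
    refine tendsto_atTop.2 fun c => ?_
    have hfin := finite_lattice_sublevel hn (F := fun x => ‖x‖ ^ n) (by fun_prop)
      (fun x t ht => by rw [norm_smul, Real.norm_of_nonneg ht, mul_pow])
      (fun x hx => by have := norm_pos_iff.2 hx; positivity) (c ^ n)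
    refine hfin.subset fun k hk => ?_
    have hk' : ¬ c ≤ ‖latticePt k‖ := hk
    exact pow_le_pow_left₀ (norm_nonneg _) (not_le.1 hk').le n
  have hz : Tendsto (fun k : Fin n → ℤ => K * C * ‖latticePt k‖⁻¹) cofinite (𝓝 0) := by
    simpa using hlim.inv_tendsto_atTop.const_mul (K * C)
  refine squeeze_zero_norm' ?_ hz
  filter_upwards [(Set.finite_singleton (0 : Fin n → ℤ)).compl_mem_cofinite] with k hk
  have hk0 : k ≠ 0 := hk
  have h1 : ‖(r k : ℂ) + 1‖ = (r k : ℝ) + 1 := by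
    rw [← Nat.cast_succ, Complex.norm_natCast, Nat.cast_succ]
  have h2 := hr k
  rw [le_div_iff₀ (by positivity), latticeWeight_of_ne hk0] at h2
  rw [if_neg hk0, norm_mul, h1]
  have hC : 0 ≤ C * ‖latticePt k‖⁻¹ := by
    have h3 := (norm_nonneg _).trans (hf k hk0)
    have h4 : 0 < (‖latticePt k‖ ^ (n + 1))⁻¹ := by
      have := norm_pos_iff.2 (latticePt_ne_zero hk0)
      positivity
    exact mul_nonneg (nonneg_of_mul_nonneg_left h3 h4) (by positivity)
  calc ((r k : ℝ) + 1) * ‖f k - g (latticePt k)‖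
      ≤ ((r k : ℝ) + 1) * (C * (‖latticePt k‖ ^ (n + 1))⁻¹) := by gcongr; exact hf k hk0
    _ = ((‖latticePt k‖ ^ n)⁻¹ * ((r k : ℝ) + 1)) * (C * ‖latticePt k‖⁻¹) := by
        rw [pow_succ, mul_inv]; ring
    _ ≤ K * (C * ‖latticePt k‖⁻¹) := by gcongr
    _ = K * C * ‖latticePt k‖⁻¹ := by ring

end IsNormalizedPositiveTrace

end DiagonalTrace

/-! ### Independence of the residue from the symbol -/

section Residue

open Filter Topology

variable {n : ℕ} {θ : Matrix (Fin n) (Fin n) ℝ}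
  {ρ : EuclideanSpace ℝ (Fin n) → smoothTorus θ} {ρh : ℕ → EuclideanSpace ℝ (Fin n) → smoothTorus θ}

theorem IsHomogeneousSymbol.ncTrace_smul_apply {q : ℤ} (hρ : IsHomogeneousSymbol (q : ℂ) ρ)
    {t : ℝ} (ht : 0 < t) {ξ : EuclideanSpace ℝ (Fin n)} (hξ : ξ ≠ 0) :
    ncTrace θ (ρ (t • ξ) : ncTorus θ) = (t ^ q : ℝ) • ncTrace θ (ρ ξ : ncTorus θ) := by
  rw [hρ.homogeneous t ξ ht hξ, Complex.cpow_intCast]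
  change ncTrace θ ((t : ℂ) ^ q • (ρ ξ : ncTorus θ)) = _
  rw [ncTrace_smul, Complex.real_smul, Complex.ofReal_zpow]

theorem IsHomogeneousSymbol.continuousOn_ncTrace {q : ℂ} (hρ : IsHomogeneousSymbol q ρ) :
    ContinuousOn (fun ξ => ncTrace θ (ρ ξ : ncTorus θ)) {0}ᶜ := by
  have h := (fourierCLM θ 0).continuous.comp_continuousOn (hρ.smooth 0 Fin.elim0).continuousOn
  refine h.congr fun ξ _ => ?_
  change _ = fourierCLM θ 0 _
  rw [fourierCLM_apply, fourierCoeff_ncDeriv_elim0, fourierCoeff_zero]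

theorem ncTrace_sub_sum (u : smoothTorus θ) (N : ℕ) (v : ℕ → smoothTorus θ) :
    ncTrace θ ((u - ∑ j ∈ Finset.range N, v j : smoothTorus θ) : ncTorus θ) =
      ncTrace θ (u : ncTorus θ) - ∑ j ∈ Finset.range N, ncTrace θ (v j : ncTorus θ) := by
  have h : ∀ w : smoothTorus θ, ncTrace θ (w : ncTorus θ) =
      ((fourierCLM θ 0 : ncTorus θ →ₗ[ℂ] ℂ) ∘ₗ (smoothTorus θ).val.toLinearMap) w := fun w => by
    rw [← fourierCoeff_zero, ← fourierCLM_apply]; rfl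
  simp only [h, map_sub, map_sum]

theorem IsClassicalSymbol.exists_norm_ncTrace_sub_le {q : ℤ}
    (hρ : IsClassicalSymbol (q : ℂ) ρ ρh) (N : ℕ) :
    ∃ C : ℝ, ∀ ξ, 1 ≤ ‖ξ‖ → ‖ncTrace θ (ρ ξ : ncTorus θ) -
      ∑ j ∈ Finset.range N, ncTrace θ (ρh j ξ : ncTorus θ)‖ ≤ C * ‖ξ‖ ^ (q - N : ℤ) := by
  obtain ⟨C, hC⟩ := hρ.expansion N 0 0 Fin.elim0
  refine ⟨C, fun ξ hξ => ?_⟩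
  have h := hC ξ hξ
  rw [norm_iteratedFDeriv_zero] at h
  rw [← ncTrace_sub_sum, ← fourierCoeff_zero, ← fourierCoeff_ncDeriv_elim0]
  refine (norm_fourierCoeff_le _ _).trans (h.trans_eq ?_)
  rw [← Real.rpow_intCast]
  simp

/-- A polynomial that tends to zero along the natural numbers has constant coefficient zero. -/
theorem coeff_zero_eq_zero_of_tendsto {p : Polynomial ℂ}
    (hp : Tendsto (fun t : ℕ => p.eval (t : ℂ)) atTop (𝓝 0)) : p.coeff 0 = 0 := by
  by_cases hd : 0 < p.degree
  · have h1 := p.tendsto_norm_atTop hd (z := fun t : ℕ => (t : ℂ))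
      (by simpa using tendsto_natCast_atTop_atTop (R := ℝ))
    exact absurd hp.norm (not_tendsto_nhds_of_tendsto_atTop h1 _)
  · have h1 := Polynomial.eq_C_of_degree_le_zero (not_lt.1 hd)
    rw [h1] at hp
    simp only [Polynomial.eval_C] at hp
    exact tendsto_nhds_unique tendsto_const_nhds hp

/-- Multiplied by tⁿ, the expression in the norm becomes a polynomial in t of size O(1/t). Its
constant coefficient is the difference of the two sides, and must vanish. -/
theorem eq_of_norm_sum_sub_le {c : ℕ → ℂ} {d : ℂ} {q : ℤ} {C : ℝ}
    (h : ∀ t : ℕ, 1 ≤ t → ‖∑ j ∈ Finset.range (q + n + 1).toNat, ((t : ℝ) ^ (q - j : ℤ)) • c j -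
      ((t : ℝ) ^ (-n : ℤ)) • d‖ ≤ C * (t : ℝ) ^ (-n - 1 : ℤ)) :
    (if 0 ≤ q + n then c (q + n).toNat else 0) = d := by
  -- With N terms the last degree is q - (N - 1) = -n. If q < -n, then `toNat` gives N = 0 and the
  -- sum is empty.
  set N := (q + n + 1).toNat with hN
  let p : Polynomial ℂ := ∑ j ∈ Finset.range N, Polynomial.C (c j) * Polynomial.X ^ (N - 1 - j) -
    Polynomial.C d
  have hp : ∀ t : ℕ, 1 ≤ t → ‖p.eval (t : ℂ)‖ ≤ C * (t : ℝ)⁻¹ := fun t ht => by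
    have ht0 : (t : ℝ) ≠ 0 := by positivity
    have h1 : p.eval (t : ℂ) = ((t : ℝ) ^ (n : ℤ)) •
        (∑ j ∈ Finset.range N, ((t : ℝ) ^ (q - j : ℤ)) • c j - ((t : ℝ) ^ (-n : ℤ)) • d) := by
      rw [smul_sub, Finset.smul_sum, smul_smul, ← zpow_add₀ ht0]
      simp only [p, Polynomial.eval_sub, Polynomial.eval_finsetSum, Polynomial.eval_mul,
        Polynomial.eval_C, Polynomial.eval_pow, Polynomial.eval_X]
      congr 1
      · refine Finset.sum_congr rfl fun j hj => ?_
        rw [Finset.mem_range] at hj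
        have h2 : (n : ℤ) + (q - j) = (N - 1 - j : ℕ) := by omega
        rw [smul_smul, ← zpow_add₀ ht0, h2, zpow_natCast, Complex.real_smul]
        push_cast
        ring
      · simp
    rw [h1, norm_smul, Real.norm_of_nonneg (by positivity)]
    refine (mul_le_mul_of_nonneg_left (h t ht) (by positivity)).trans_eq ?_
    rw [mul_left_comm, ← zpow_add₀ ht0, add_sub_assoc', add_neg_cancel, zero_sub, zpow_neg_one]
  have hlim : Tendsto (fun t : ℕ => p.eval (t : ℂ)) atTop (𝓝 0) := by
    refine squeeze_zero_norm' (eventually_atTop.2 ⟨1, hp⟩) ?_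
    simpa using (tendsto_inv_atTop_nhds_zero_nat (𝕜 := ℝ)).const_mul C
  have h0 := coeff_zero_eq_zero_of_tendsto hlim
  rw [Polynomial.coeff_sub, Polynomial.finsetSum_coeff, Polynomial.coeff_C_zero, sub_eq_zero] at h0
  rw [← h0]
  simp only [Polynomial.coeff_C_mul, Polynomial.coeff_X_pow]
  split_ifs with hq
  · rw [Finset.sum_eq_single (q + n).toNat]
    · rw [if_pos (by omega), mul_one]
    · intro j hj hne
      rw [Finset.mem_range] at hj
      rw [if_neg (by omega), mul_zero]
    · intro hmem
      rw [Finset.mem_range] at hmem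
      omega
  · have : N = 0 := by omega
    rw [this, Finset.sum_range_zero]

/-- Rounding down costs at most 1/t in each coordinate, so positive multiples of lattice points
approach every ξ. -/
theorem tendsto_inv_smul_latticePt_floor (ξ : EuclideanSpace ℝ (Fin n)) :
    Tendsto (fun t : ℕ => (t : ℝ)⁻¹ • latticePt fun j => ⌊(t : ℝ) * ξ j⌋) atTop (𝓝 ξ) := by
  have h : Tendsto (fun t : ℕ => fun j => (t : ℝ)⁻¹ * (⌊(t : ℝ) * ξ j⌋ : ℝ)) atTop
      (𝓝 fun j => ξ j) := by
    rw [tendsto_pi_nhds]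
    intro j
    have h1 : Tendsto (fun t : ℕ => ξ j - (t : ℝ)⁻¹) atTop (𝓝 (ξ j)) := by
      simpa using (tendsto_inv_atTop_nhds_zero_nat (𝕜 := ℝ)).const_sub (ξ j)
    refine tendsto_of_tendsto_of_tendsto_of_le_of_le' h1 tendsto_const_nhds ?_ ?_
    all_goals
      filter_upwards [eventually_ge_atTop 1] with t ht
      have ht0 : (0 : ℝ) < t := by positivity
      rw [inv_mul_eq_div]
    · rw [le_div_iff₀ ht0, sub_mul, inv_mul_cancel₀ ht0.ne', mul_comm]
      exact (Int.sub_one_lt_floor _).le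
    · rw [div_le_iff₀ ht0, mul_comm]
      exact Int.floor_le _
  exact ((PiLp.continuous_toLp 2 fun _ : Fin n => ℝ).tendsto _).comp h

/-- Two continuous homogeneous functions on `ℝⁿ ∖ 0` that agree on the lattice are equal. -/
theorem eqOn_of_eq_latticePt {F G : EuclideanSpace ℝ (Fin n) → ℂ} {q : ℤ}
    (hF : ContinuousOn F {0}ᶜ) (hG : ContinuousOn G {0}ᶜ)
    (hFh : ∀ (t : ℝ) ξ, 0 < t → ξ ≠ 0 → F (t • ξ) = (t ^ q : ℝ) • F ξ)
    (hGh : ∀ (t : ℝ) ξ, 0 < t → ξ ≠ 0 → G (t • ξ) = (t ^ q : ℝ) • G ξ)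
    (h : ∀ k, k ≠ 0 → F (latticePt k) = G (latticePt k)) {ξ : EuclideanSpace ℝ (Fin n)}
    (hξ : ξ ≠ 0) : F ξ = G ξ := by
  have hlim := tendsto_inv_smul_latticePt_floor ξ
  have hnhds : ({0}ᶜ : Set (EuclideanSpace ℝ (Fin n))) ∈ 𝓝 ξ :=
    isOpen_compl_singleton.mem_nhds hξ
  refine tendsto_nhds_unique_of_eventuallyEq ((hF.continuousAt hnhds).tendsto.comp hlim)
    ((hG.continuousAt hnhds).tendsto.comp hlim) ?_
  filter_upwards [eventually_ge_atTop 1, hlim hnhds] with t ht hne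
  have ht0 : (0 : ℝ) < (t : ℝ)⁻¹ := by positivity
  have hk : (fun j => ⌊(t : ℝ) * ξ j⌋) ≠ 0 := fun hk => hne (by
    change (t : ℝ)⁻¹ • latticePt (fun j => ⌊(t : ℝ) * ξ j⌋) = 0
    rw [hk, latticePt_zero, smul_zero])
  rw [Function.comp_apply, Function.comp_apply, hFh _ _ ht0 (latticePt_ne_zero hk),
    hGh _ _ ht0 (latticePt_ne_zero hk), h _ hk]

theorem latticePt_nsmul (t : ℕ) (k : Fin n → ℤ) : latticePt (t • k) = (t : ℝ) • latticePt k := by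
  ext j; simp [latticePt]

/-- The trace of the homogeneous component of degree `-n` depends only on the operator. -/
theorem ncTrace_component_eq {P : smoothTorus θ →ₗ[ℂ] smoothTorus θ}
    {ρ' : EuclideanSpace ℝ (Fin n) → smoothTorus θ}
    {ρh' : ℕ → EuclideanSpace ℝ (Fin n) → smoothTorus θ} {q : ℤ}
    (hρ : IsClassicalSymbol ((-n : ℤ) : ℂ) ρ ρh) (hP : IsPsiDOWithSymbol ρ P)
    (hρ' : IsClassicalSymbol (q : ℂ) ρ' ρh') (hP' : IsPsiDOWithSymbol ρ' P)
    {ξ : EuclideanSpace ℝ (Fin n)} (hξ : ξ ≠ 0) :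
    (if 0 ≤ q + n then ncTrace θ (ρh' (q + n).toNat ξ : ncTorus θ) else 0) =
      ncTrace θ (ρh 0 ξ : ncTorus θ) := by
  have hh : ∀ j : ℕ, IsHomogeneousSymbol ((q - j : ℤ) : ℂ) (ρh' j) := fun j => by
    simpa using hρ'.homogeneous j
  have hh0 : IsHomogeneousSymbol ((-n : ℤ) : ℂ) (ρh 0) := by simpa using hρ.homogeneous 0
  refine eqOn_of_eq_latticePt (q := -n)
    (F := fun ξ => if 0 ≤ q + n then ncTrace θ (ρh' (q + n).toNat ξ : ncTorus θ) else 0)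
    ?_ hh0.continuousOn_ncTrace ?_ (fun t ξ ht hξ => hh0.ncTrace_smul_apply ht hξ) ?_ hξ
  · split_ifs with hq
    · exact (hh _).continuousOn_ncTrace
    · exact continuousOn_const
  · intro t ξ ht hξ
    split_ifs with hq
    · rw [(hh _).ncTrace_smul_apply ht hξ, Int.toNat_of_nonneg hq]
      congr 2
      ring
    · rw [smul_zero]
  -- The points tk are lattice points, where both symbols have the same trace; comparing the two
  -- expansions in powers of t isolates the coefficient of t⁻ⁿ.
  · intro k hk
    obtain ⟨C, hC⟩ := hρ.exists_norm_ncTrace_sub_le 1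
    obtain ⟨C', hC'⟩ := hρ'.exists_norm_ncTrace_sub_le (q + n + 1).toNat
    set x := latticePt k with hx
    have hx0 : x ≠ 0 := latticePt_ne_zero hk
    have hx1 : 1 ≤ ‖x‖ := one_le_norm_latticePt hk
    refine eq_of_norm_sum_sub_le
      (C := |C| * ‖x‖ ^ (-n - 1 : ℤ) + |C'| * ‖x‖ ^ (-n - 1 : ℤ))
      (c := fun j => ncTrace θ (ρh' j x : ncTorus θ)) fun t ht => ?_
    have ht0 : (0 : ℝ) < t := by positivity
    have ht1 : (1 : ℝ) ≤ t := by exact_mod_cast ht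
    have hnorm : ‖(t : ℝ) • x‖ = t * ‖x‖ := by rw [norm_smul, Real.norm_of_nonneg ht0.le]
    have h1 : 1 ≤ ‖(t : ℝ) • x‖ := by
      rw [hnorm]; exact one_le_mul_of_one_le_of_one_le ht1 hx1
    have e1 := hC _ h1
    have e2 := hC' _ h1
    have hlat : ncTrace θ (ρ' ((t : ℝ) • x) : ncTorus θ) =
        ncTrace θ (ρ ((t : ℝ) • x) : ncTorus θ) := by
      rw [hx, ← latticePt_nsmul, ncTrace_symbol hP, ncTrace_symbol hP']
    rw [Finset.sum_range_one, hh0.ncTrace_smul_apply ht0 hx0] at e1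
    simp only [fun j => (hh j).ncTrace_smul_apply ht0 hx0] at e2
    rw [hlat] at e2
    have b1 : C * ‖(t : ℝ) • x‖ ^ (-n - (1 : ℕ) : ℤ) ≤
        |C| * ‖(t : ℝ) • x‖ ^ (-n - 1 : ℤ) := by
      rw [Nat.cast_one]
      gcongr
      exact le_abs_self C
    have b2 : C' * ‖(t : ℝ) • x‖ ^ (q - (q + n + 1).toNat : ℤ) ≤
        |C'| * ‖(t : ℝ) • x‖ ^ (-n - 1 : ℤ) := by
      -- The exponents agree if q + n + 1 ≥ 0; otherwise `toNat` is 0 and q < -n - 1.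
      have hle : ‖(t : ℝ) • x‖ ^ (q - (q + n + 1).toNat : ℤ) ≤
          ‖(t : ℝ) • x‖ ^ (-n - 1 : ℤ) := zpow_le_zpow_right₀ h1 (by omega)
      refine (mul_le_mul_of_nonneg_right (le_abs_self C') (by positivity)).trans ?_
      gcongr
    have key := (norm_sub_le _ _).trans (add_le_add (e1.trans b1) (e2.trans b2))
    rw [sub_sub_sub_cancel_left] at key
    refine key.trans_eq ?_
    rw [hnorm, mul_zpow]
    ring

/-- The choice in `ncResidue` may pick any integer order and any symbol of P; `ncTrace_component_eq`
shows that the integrand is the same. -/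
theorem ncResidue_eq {P : smoothTorus θ →ₗ[ℂ] smoothTorus θ}
    (hρ : IsClassicalSymbol ((-n : ℤ) : ℂ) ρ ρh) (hP : IsPsiDOWithSymbol ρ P) :
    ncResidue P = ∫ ξ : Metric.sphere (0 : EuclideanSpace ℝ (Fin n)) 1,
      ncTrace θ (ρh 0 ξ : ncTorus θ) ∂(volume.toSphere) := by
  have hex : ∃ r, IsNCResidue P r := ⟨_, _, ρ, ρh, hρ, hP, rfl⟩
  rw [ncResidue, dif_pos hex]
  obtain ⟨q, ρ', ρh', hρ', hP', hr⟩ := hex.choose_spec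
  have h : ∀ ξ : Metric.sphere (0 : EuclideanSpace ℝ (Fin n)) 1,
      ncTrace θ (ρh 0 ξ : ncTorus θ) =
        if 0 ≤ q + n then ncTrace θ (ρh' (q + n).toNat ξ : ncTorus θ) else 0 := fun ξ =>
    (ncTrace_component_eq hρ hP hρ' hP' (ne_zero_of_mem_unit_sphere ξ)).symm
  rw [hr]
  simp only [h]
  split_ifs
  · rfl
  · rw [integral_zero]

end Residue

end NCTorus

end

theorem theorem7p1 {n : ℕ} (hn : 2 ≤ n) (θ : Matrix (Fin n) (Fin n) ℝ) (hθ : θ.transpose = -θ)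
    (P : NCTorus.smoothTorus θ →ₗ[ℂ] NCTorus.smoothTorus θ)
    (hP : P ∈ NCTorus.classicalPsiDO θ (-(n : ℂ))) :
    (∃! T : NCTorus.L2NCTorus θ →L[ℂ] NCTorus.L2NCTorus θ, NCTorus.IsBoundedExtension P T) ∧
    ∀ T : NCTorus.L2NCTorus θ →L[ℂ] NCTorus.L2NCTorus θ, NCTorus.IsBoundedExtension P T →
      ∃ hT : T ∈ NCTorus.weakTraceClass (NCTorus.L2NCTorus θ),
        NCTorus.IsStronglyMeasurable (⟨T, hT⟩ : NCTorus.weakTraceClass (NCTorus.L2NCTorus θ)) ∧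
        NCTorus.HasNCIntegral (⟨T, hT⟩ : NCTorus.weakTraceClass (NCTorus.L2NCTorus θ))
          ((1 / (n : ℂ)) * NCTorus.ncResidue P) := by
  obtain ⟨ρ, ρh, hρ, hPρ⟩ := hP
  have hn0 : n ≠ 0 := by omega
  have hρz : NCTorus.IsClassicalSymbol ((-n : ℤ) : ℂ) ρ ρh := by simpa using hρ
  have hh0 : NCTorus.IsHomogeneousSymbol ((-n : ℤ) : ℂ) (ρh 0) := by
    simpa using hρz.homogeneous 0
  obtain ⟨T, D, hT, hD, hφ⟩ := hρ.exists_weakTraceClass hn0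
  have hext := NCTorus.isBoundedExtension_of_apply_ncMonomial hPρ hT
  refine ⟨⟨T, hext, fun S hS => NCTorus.boundedExtension_unique hS hext⟩, fun S hS => ?_⟩
  obtain rfl := NCTorus.boundedExtension_unique hS hext
  have hint : NCTorus.HasNCIntegral T ((1 / (n : ℂ)) * NCTorus.ncResidue P) := fun φ hφt => by
    obtain ⟨C, hC⟩ := hρz.exists_norm_ncTrace_sub_le 1
    rw [hφ φ hφt, NCTorus.ncResidue_eq hρz hPρ]
    -- The leading component `ρh 0` has degree -n, and the one-term expansion leaves a remainder
    -- O(|k|^(-n-1)).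
    refine hφt.map_lattice_of_asymptotic hn0 hh0.continuousOn_ncTrace (fun x r hr hx => ?_)
      (C := C) (fun k hk => ?_) hD
    · rw [hh0.ncTrace_smul_apply hr hx, zpow_neg, zpow_natCast]
    · have h := hC _ (NCTorus.one_le_norm_latticePt hk)
      rw [Finset.sum_range_one] at h
      refine h.trans_eq ?_
      rw [← zpow_natCast, ← zpow_neg]
      congr 2
      push_cast
      ring
  exact ⟨T.2, ⟨_, hint⟩, hint⟩
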